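/- **Setting.** Let $n,N\ge 1$, let $a,b\in\Delta^n$ (the probability simplex of $\mathbb R^n$) with $b_j>0$ for all $j$, let $C^1,\dots,C^N\in\mathbb R^{n\times n}$ be not all zero, and let $\epsilon>0$. For matrices $\pi$ write $r(\pi)=\pi\mathbf 1$, $c(\pi)=\pi^\top\mathbf 1$. Let $\Pi^N_{a,b}$ be the set of $\boldsymbol\pi=(\pi^k)_{k\le N}$ with $\pi^k\ge 0$ entrywise, $r(\sum_k\pi^k)=a$, $c(\sum_k\pi^k)=b$, and let $\ell(\boldsymbol\pi,\lambda)=\sum_k\lambda_k\langle\pi^k,C^k\rangle$. A pair $(\hat{\boldsymbol\pi},\hat\lambda)\in\Pi^N_{a,b}\times\Delta^N$ is an *$\epsilon$-optimal solution* of $\min_{\boldsymbol\pi\in\Pi^N_{a,b}}\max_{\lambda\in\Delta^N}\ell(\boldsymbol\pi,\lambda)$ if $\max_{\lambda\in\Delta^N}\ell(\hat{\boldsymbol\pi},\lambda)-\min_{\boldsymbol\pi\in\Pi^N_{a,b}}\ell(\boldsymbol\pi,\hat\lambda)\le\epsilon$. Put $c_\infty=\max_{k,i,j}|C^k_{ij}|$,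 $\iota=\min_j\log b_j$, $L=\log(n^2N)+1$, $\eta=\min\{\epsilon/(3L),c_\infty\}$, $\tau=\eta/c_\infty^2$, $\gamma_0=\min\{(2c_\infty-\eta\iota)^{-2},(9c_\infty^2)^{-1}\}$, $\epsilon'=\epsilon/(6c_\infty-\eta\iota)$. Let $\zeta^k(f,g,\lambda)_{ij}=\exp((f_i+g_j-\lambda_kC^k_{ij})/\eta)$, $\pi^k(f,g,\lambda)=\zeta^k/\sum_{k'}\|\zeta^{k'}\|_1$, $F(f,g,\lambda)=\langle f,a\rangle+\langle g,b\rangle-\eta\log(\sum_k\|\zeta^k(f,g,\lambda)\|_1)-\eta$, and $F^*=\sup_{f,g\in\mathbb R^n,\lambda\in\Delta^N}F$; then $[\nabla_\lambda F]_k=\langle\pi^k(f,g,\lambda),C^k\rangle$. (If $a_i=0$, the updates below give $f_i=-\infty$, with $\log 0=-\infty$, $e^{-\infty}=0$, $0\cdot(-\infty)=0$ and $0/0=0$.) **Algorithm (PAM).** Start from $f^0=g^0=\mathbf 1$, $\lambda^0=\mathbf 1/N$ and iterate $$f^{t+1}=f^t+\eta\log\frac{a}{r(\sum_k\zeta^k(f^t,g^t,\lambda^t))},\qquad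 g^{t+1}=g^t+\eta\log\frac{b}{c(\sum_k\zeta^k(f^{t+1},g^t,\lambda^t))},$$ $$\lambda^{t+1}=\mathrm{Proj}_{\Delta^N}\big(\lambda^t+\tau\nabla_\lambda F(f^{t+1},g^{t+1},\lambda^t)\big).$$ Let $\tilde{\boldsymbol\pi}_T=\boldsymbol\pi(f^T,g^{T-1},\lambda^{T-1})$. The algorithm stops at the first $T\ge1$ with $$\Big\|c\big(\textstyle\sum_k\tilde\pi^k_T\big)-b\Big\|_1\le\frac{\epsilon}{6(6c_\infty-\eta\iota)},\quad \|\lambda^T-\lambda^{T-1}\|_2\le\frac{\eta\epsilon}{18c_\infty^2},\quad F^*-F(f^T,g^{T-1},\lambda^{T-1})\le\frac{\epsilon}{6}.$$ It then takes $a^k=r(\tilde\pi_T^k)$ and margins $b^k\ge0$ with $\sum_kb^k=b$, $\sum_ia^k_i=\sum_jb^k_j$ for all $k$, and $(b^k_j-c(\tilde\pi^k_T)_j)(b^{k'}_j-c(\tilde\pi^{k'}_T)_j)\ge0$ for all $j,k,k'$; such margins are computed by starting from $b^k=c(\tilde\pi_T^k)+(b-c(\sum_{k'}\tilde\pi_T^{k'}))/N$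 and, while some $b^k_j<0$, choosing $j'$ with $b^k_{j'}>c(\tilde\pi^k_T)_{j'}$ and $k'$ with $b^{k'}_j>0$ and adding $\theta,-\theta,-\theta,\theta$ to $b^k_j,b^k_{j'},b^{k'}_j,b^{k'}_{j'}$, where $\theta=\min\{|b^k_j|,|b^{k'}_j|,|b^k_{j'}-c(\tilde\pi_T^k)_{j'}|\}$ (always taking the first possible $(k,j)$ in row-major order, then the first $j'$ and $k'$). The output is $\hat\lambda=\lambda^{T-1}$, $\hat\pi^k=\mathrm{Round}(\tilde\pi_T^k,a^k,b^k)$, where $\mathrm{Round}(\pi,\alpha,\beta)$ scales row $i$ of $\pi$ by $\min(\alpha_i/r(\pi)_i,1)$, giving $\pi'$, then column $j$ of $\pi'$ by $\min(\beta_j/c(\pi')_j,1)$, giving $\pi''$, and returns $\pi''+uv^\top/\|u\|_1$ with $u=\alpha-r(\pi'')$, $v=\beta-c(\pi'')$ (just $\pi''$ if $u=0$). **Theorem.** The stopping conditions are met; the first $T\ge 1$ at which they hold satisfies $$T\le \bar T:=5+\frac{36}{\eta\sqrt{\gamma_0}\,\epsilon'}+\frac{648c_\infty^2}{\eta\epsilon}+\frac{28}{\eta\gamma_0\epsilon},$$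 and, for every choice of margins $b^k$ with the listed properties, the output $(\hat{\boldsymbol\pi},\hat\lambda)$ is an $\epsilon$-optimal solution. The whole algorithm, including the computation of the margins (which terminates with margins that have the listed properties) and the rounding, and with the number $F^*$ in the stopping test regarded as known, uses at most $K\,Nn^2\,\bar T$ arithmetic operations ($+,-,\times,\div,\exp,\log,|\cdot|,\sqrt{\cdot},\min,\max$; sorting, searching and branching are not counted). Moreover $\gamma_0\le K c_\infty^{-2}$, and if $\epsilon\le c_\infty$ then, with $D=L\,(1+|\iota|/L)^2$, $$\bar T\le K D\,c_\infty^2\epsilon^{-2},$$ and the number of arithmetic operations is at most $K D\,Nn^2c_\infty^2\epsilon^{-2}$. Here $K$ is an absolute constant. Thus the number of iterations is $O(c_\infty^2\epsilon^{-2})$ and the number of arithmetic operations is $O(Nn^2\epsilon^{-2})$, where the first $O$ hides only the factor $D$ (polylogarithmic in $n$, $N$ and $1/\min_jb_j$), and the second also $c_\infty^2$. -/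

import Mathlib

noncomputable section

namespace EOT

open scoped BigOperators

/-! ### The equitable optimal transport problem -/

/-- Data of a discrete EOT problem with `N` agents and `n` support points on each side:
the cost matrices `C k` and the two weight vectors. -/
structure Problem (n N : ℕ) where
  C : Fin N → Fin n → Fin n → ℝ
  a : Fin n → ℝ
  b : Fin n → ℝ

variable {n N : ℕ}

def rowSum (π : Fin n → Fin n → ℝ) (i : Fin n) : ℝ := ∑ j, π i j

def colSum (π : Fin n → Fin n → ℝ) (j : Fin n) : ℝ := ∑ i, π i j

/-- The matrix `∑ₖ πᵏ`. -/
def total (π : Fin N → Fin n → Fin n → ℝ) (i j : Fin n) : ℝ := ∑ k, π k i j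

/-- Sum of all entries of all matrices (`∑ₖ ‖πᵏ‖₁` for a nonnegative family). -/
def mass (π : Fin N → Fin n → Fin n → ℝ) : ℝ := ∑ k, ∑ i, ∑ j, π k i j

def frob (A B : Fin n → Fin n → ℝ) : ℝ := ∑ i, ∑ j, A i j * B i j

def l1 {ι : Type*} [Fintype ι] (x : ι → ℝ) : ℝ := ∑ i, |x i|

def l2 {ι : Type*} [Fintype ι] (x : ι → ℝ) : ℝ := Real.sqrt (∑ i, x i ^ 2)

/-- The coupling decomposition set `Π_{a,b}^N`. -/
def couplings (P : Problem n N) : Set (Fin N → Fin n → Fin n → ℝ) :=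
  {π | rowSum (total π) = P.a ∧ colSum (total π) = P.b ∧ ∀ k i j, 0 ≤ π k i j}

/-- The objective `ℓ(π, λ) = ∑ₖ λₖ ⟨πᵏ, Cᵏ⟩`. -/
def ell (P : Problem n N) (π : Fin N → Fin n → Fin n → ℝ) (lam : Fin N → ℝ) : ℝ :=
  ∑ k, lam k * frob (π k) (P.C k)

/-- `(π, λ)` is feasible and its duality gap
`max_{λ'} ℓ(π, λ') - min_{π'} ℓ(π', λ)` (both extrema being attained) is at most `ε`. -/
def IsEpsOptimal (P : Problem n N) (ε : ℝ) (π : Fin N → Fin n → Fin n → ℝ)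
    (lam : Fin N → ℝ) : Prop :=
  π ∈ couplings P ∧ lam ∈ stdSimplex ℝ (Fin N) ∧
    ∃ M m : ℝ, IsGreatest ((fun lam' => ell P π lam') '' stdSimplex ℝ (Fin N)) M ∧
      IsLeast ((fun π' => ell P π' lam) '' couplings P) m ∧ M - m ≤ ε

/-! ### Constants -/

/-- `c_∞`, the largest absolute value of an entry of a cost matrix. -/
def cInf (P : Problem n N) : ℝ := ⨆ p : Fin N × Fin n × Fin n, |P.C p.1 p.2.1 p.2.2|

/-- `ι = min_j log b_j`. -/
def iota (P : Problem n N) : ℝ := ⨅ j, Real.log (P.b j)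

/-- `log(n² N) + 1`. -/
def logDim (n N : ℕ) : ℝ := Real.log ((n : ℝ) * n * N) + 1

def eta (P : Problem n N) (ε : ℝ) : ℝ := min (ε / (3 * logDim n N)) (cInf P)

def tau (P : Problem n N) (ε : ℝ) : ℝ := eta P ε / (cInf P * cInf P)

def gamma0 (P : Problem n N) (ε : ℝ) : ℝ :=
  min (1 / (2 * cInf P - eta P ε * iota P) ^ 2) (1 / (9 * cInf P ^ 2))

def epsPrime (P : Problem n N) (ε : ℝ) : ℝ := ε / (6 * cInf P - eta P ε * iota P)

/-- The iteration bound. -/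
def iterBound (P : Problem n N) (ε : ℝ) : ℝ :=
  5 + 36 / (eta P ε * Real.sqrt (gamma0 P ε) * epsPrime P ε)
    + 648 * cInf P ^ 2 / (eta P ε * ε) + 28 / (eta P ε * gamma0 P ε * ε)

/-! ### The dual problem of the entropy-regularized problem

The variable `f` takes values in `[-∞, ∞)`: where `a i = 0` the update of `f i` involves
`log 0 = -∞`.  When `a > 0` all the `f` that occur below are real vectors. -/

/-- Exponential with `e^{-∞} = 0`. -/
def xexp (x : EReal) : ℝ := (EReal.exp x).toReal

/-- Logarithm of a nonnegative number with `log 0 = -∞`. -/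
def xlog (x : ℝ) : EReal := ENNReal.log (ENNReal.ofReal x)

/-- `ζᵏ(f, g, λ) = exp((f 1ᵀ + 1 gᵀ - λₖ Cᵏ) / η)`, entrywise. -/
def zeta (P : Problem n N) (η : ℝ) (f : Fin n → EReal) (g : Fin n → ℝ) (lam : Fin N → ℝ)
    (k : Fin N) (i j : Fin n) : ℝ :=
  xexp ((f i + (g j : EReal) - ((lam k * P.C k i j : ℝ) : EReal)) / (η : EReal))

/-- `πᵏ(f, g, λ) = ζᵏ / ∑ₖ ‖ζᵏ‖₁`. -/
def plan (P : Problem n N) (η : ℝ) (f : Fin n → EReal) (g : Fin n → ℝ) (lam : Fin N → ℝ)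
    (k : Fin N) (i j : Fin n) : ℝ :=
  zeta P η f g lam k i j / mass (zeta P η f g lam)

/-- The dual objective
`F(f, g, λ) = ⟨f, a⟩ + ⟨g, b⟩ - η log (∑ₖ ‖ζᵏ(f, g, λ)‖₁) - η` (with `0 · (-∞) = 0`). -/
def dualF (P : Problem n N) (η : ℝ) (f : Fin n → EReal) (g : Fin n → ℝ)
    (lam : Fin N → ℝ) : EReal :=
  ∑ i, f i * (P.a i : EReal) + ((∑ j, g j * P.b j : ℝ) : EReal)
    - (η : EReal) * xlog (mass (zeta P η f g lam)) - (η : EReal)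

/-- The optimal value `F*` of the dual problem over `f, g ∈ ℝⁿ` and `λ ∈ Δ^N`. -/
def dualOpt (P : Problem n N) (η : ℝ) : EReal :=
  ⨆ (f : Fin n → ℝ) (g : Fin n → ℝ) (lam : stdSimplex ℝ (Fin N)),
    dualF P η (fun i => (f i : EReal)) g lam

/-- `∇_λ F(f, g, λ)`, whose `k`-th entry is `⟨πᵏ(f, g, λ), Cᵏ⟩`
(see `hasDerivAt_dualF` below). -/
def gradLam (P : Problem n N) (η : ℝ) (f : Fin n → EReal) (g : Fin n → ℝ)
    (lam : Fin N → ℝ) (k : Fin N) : ℝ :=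
  frob (plan P η f g lam k) (P.C k)

theorem zeta_coe (P : Problem n N) (η : ℝ) (f g : Fin n → ℝ) (lam : Fin N → ℝ)
    (k : Fin N) (i j : Fin n) :
    zeta P η (fun i => (f i : EReal)) g lam k i j
      = Real.exp ((f i + g j - lam k * P.C k i j) / η) := by
  simp only [zeta, xexp]
  rw [← EReal.coe_add, ← EReal.coe_sub, ← EReal.coe_div, EReal.exp_coe,
    ENNReal.toReal_ofReal (Real.exp_pos _).le]

theorem mass_zeta_pos (P : Problem n N) (η : ℝ) (f g : Fin n → ℝ) (lam : Fin N → ℝ)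
    (k : Fin N) (i : Fin n) : 0 < mass (zeta P η (fun i => (f i : EReal)) g lam) := by
  have hp : ∀ k i j, 0 < zeta P η (fun i => (f i : EReal)) g lam k i j := fun k i j => by
    rw [zeta_coe]; exact Real.exp_pos _
  exact Finset.sum_pos (fun k _ => Finset.sum_pos (fun i _ => Finset.sum_pos
    (fun j _ => hp k i j) ⟨i, Finset.mem_univ _⟩) ⟨i, Finset.mem_univ _⟩) ⟨k, Finset.mem_univ _⟩

theorem dualF_coe (P : Problem n N) (η : ℝ) (f g : Fin n → ℝ) (lam : Fin N → ℝ)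
    (k : Fin N) (i : Fin n) :
    dualF P η (fun i => (f i : EReal)) g lam
      = ((∑ i, f i * P.a i + ∑ j, g j * P.b j
          - η * Real.log (mass (zeta P η (fun i => (f i : EReal)) g lam)) - η : ℝ) : EReal) := by
  have hs : ∑ i, (f i : EReal) * (P.a i : EReal) = ((∑ i, f i * P.a i : ℝ) : EReal) := by
    have h0 : ∀ s : Finset (Fin n), ∑ i ∈ s, (f i : EReal) * (P.a i : EReal)
        = ((∑ i ∈ s, f i * P.a i : ℝ) : EReal) := fun s => by
      induction s using Finset.induction_on with
      | empty => simp
      | insert i s hi ih =>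
        rw [Finset.sum_insert hi, Finset.sum_insert hi, ih, EReal.coe_add, EReal.coe_mul]
    exact h0 _
  rw [dualF, hs, xlog, ENNReal.log_ofReal_of_pos (mass_zeta_pos P η f g lam k i)]
  simp only [EReal.coe_add, EReal.coe_sub, EReal.coe_mul]

/-- `gradLam` is the vector of partial derivatives of `F` with respect to `λ`. -/
theorem hasDerivAt_dualF (P : Problem n N) {η : ℝ} (hη : 0 < η) (f g : Fin n → ℝ)
    (lam : Fin N → ℝ) (k : Fin N) (i₀ : Fin n) :
    HasDerivAt (fun x => (dualF P η (fun i => (f i : EReal)) g (Function.update lam k x)).toReal)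
      (gradLam P η (fun i => (f i : EReal)) g lam k) (lam k) := by
  have hm : HasDerivAt
      (fun x => mass (zeta P η (fun i => (f i : EReal)) g (Function.update lam k x)))
      (∑ q, ∑ i, ∑ j, if q = k then
        zeta P η (fun i => (f i : EReal)) g lam k i j * (-P.C k i j / η) else 0) (lam k) := by
    unfold mass
    refine HasDerivAt.fun_sum fun q _ => HasDerivAt.fun_sum fun i _ =>
      HasDerivAt.fun_sum fun j _ => ?_
    simp only [zeta_coe]
    by_cases h : q = k
    · subst h
      simp only [Function.update_self, if_true]
      have h1 : HasDerivAt (fun x : ℝ => (f i + g j - x * P.C q i j) / η)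
          (-P.C q i j / η) (lam q) := by
        simpa using (((hasDerivAt_id (lam q)).mul_const (P.C q i j)).const_sub (f i + g j)).div_const η
      exact h1.exp
    · simp only [Function.update_of_ne h, if_neg h]
      exact hasDerivAt_const _ _
  have hpos := mass_zeta_pos P η f g lam k i₀
  have hm0 : mass (zeta P η (fun i => (f i : EReal)) g (Function.update lam k (lam k))) ≠ 0 := by
    rw [Function.update_eq_self]; exact hpos.ne'
  have h2 := ((((hm.log hm0).const_mul η).const_sub
    (∑ i, f i * P.a i + ∑ j, g j * P.b j)).sub_const η)
  simp only [dualF_coe P η f g _ k i₀, EReal.toReal_coe]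
  refine h2.congr_deriv ?_
  rw [Function.update_eq_self, gradLam, frob]
  have h3 : (∑ q, ∑ i, ∑ j, if q = k then
        zeta P η (fun i => (f i : EReal)) g lam k i j * (-P.C k i j / η) else 0)
      = ∑ i, ∑ j, zeta P η (fun i => (f i : EReal)) g lam k i j * (-P.C k i j / η) := by
    rw [Finset.sum_eq_single k] <;> simp +contextual
  rw [h3, mul_div_assoc', ← neg_div, Finset.mul_sum, ← Finset.sum_neg_distrib, Finset.sum_div]
  refine Finset.sum_congr rfl fun i _ => ?_
  rw [Finset.mul_sum, ← Finset.sum_neg_distrib, Finset.sum_div]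
  refine Finset.sum_congr rfl fun j _ => ?_
  rw [plan]
  field_simp

/-! ### Projected alternating maximization -/

/-- `z` is the Euclidean projection of `y` to the probability simplex. -/
def IsProj (y z : Fin N → ℝ) : Prop :=
  z ∈ stdSimplex ℝ (Fin N) ∧ ∀ w ∈ stdSimplex ℝ (Fin N), l2 (z - y) ≤ l2 (w - y)

def projSimplex (y : Fin N → ℝ) : Fin N → ℝ := Classical.epsilon (IsProj y)

def updateF (P : Problem n N) (η : ℝ) (f : Fin n → EReal) (g : Fin n → ℝ) (lam : Fin N → ℝ)
    (i : Fin n) : EReal :=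
  f i + (η : EReal) * xlog (P.a i / rowSum (total (zeta P η f g lam)) i)

def updateG (P : Problem n N) (η : ℝ) (f : Fin n → EReal) (g : Fin n → ℝ) (lam : Fin N → ℝ)
    (j : Fin n) : ℝ :=
  g j + η * Real.log (P.b j / colSum (total (zeta P η f g lam)) j)

def updateLam (P : Problem n N) (η τ : ℝ) (f : Fin n → EReal) (g : Fin n → ℝ)
    (lam : Fin N → ℝ) : Fin N → ℝ :=
  projSimplex (fun k => lam k + τ * gradLam P η f g lam k)

structure Iterate (n N : ℕ) where
  f : Fin n → EReal
  g : Fin n → ℝ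
  lam : Fin N → ℝ

/-- The PAM iterates `(f^t, g^t, λ^t)`. -/
def pam (P : Problem n N) (ε : ℝ) : ℕ → Iterate n N
  | 0 => ⟨fun _ => 1, fun _ => 1, fun _ => 1 / (N : ℝ)⟩
  | t + 1 =>
    let s := pam P ε t
    let f' := updateF P (eta P ε) s.f s.g s.lam
    let g' := updateG P (eta P ε) f' s.g s.lam
    ⟨f', g', updateLam P (eta P ε) (tau P ε) f' g' s.lam⟩

/-- The unrounded plan `π(f^T, g^{T-1}, λ^{T-1})`, for `T ≥ 1`. -/
def lastPlan (P : Problem n N) (ε : ℝ) (T : ℕ) : Fin N → Fin n → Fin n → ℝ :=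
  plan P (eta P ε) (pam P ε T).f (pam P ε (T - 1)).g (pam P ε (T - 1)).lam

/-- The stopping conditions at the `T`-th iteration, for `T ≥ 1`. Here
`c^{T-1}` is the column sum of `∑ₖ πᵏ(f^T, g^{T-1}, λ^{T-1})`. -/
def Stops (P : Problem n N) (ε : ℝ) (T : ℕ) : Prop :=
  l1 (colSum (total (lastPlan P ε T)) - P.b) ≤ ε / (6 * (6 * cInf P - eta P ε * iota P)) ∧
  l2 ((pam P ε T).lam - (pam P ε (T - 1)).lam) ≤ eta P ε * ε / (18 * (cInf P * cInf P)) ∧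
  dualOpt P (eta P ε)
    - dualF P (eta P ε) (pam P ε T).f (pam P ε (T - 1)).g (pam P ε (T - 1)).lam
      ≤ ((ε / 6 : ℝ) : EReal)

/-! ### Margins and rounding -/

/-- The requirements on the column margins `bᵏ` of a family `π`; the row margins are
`aᵏ = r(πᵏ)`. -/
def IsMargins (π : Fin N → Fin n → Fin n → ℝ) (b : Fin n → ℝ) (bk : Fin N → Fin n → ℝ) :
    Prop :=
  (∀ k j, 0 ≤ bk k j) ∧ (∀ j, ∑ k, bk k j = b j) ∧
  (∀ k, ∑ i, rowSum (π k) i = ∑ j, bk k j) ∧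
  ∀ j k k', 0 ≤ (bk k j - colSum (π k) j) * (bk k' j - colSum (π k') j)

/-- The rounding procedure `Round(π, a, b)`. -/
def roundPlan (π : Fin n → Fin n → ℝ) (a b : Fin n → ℝ) : Fin n → Fin n → ℝ :=
  let π₁ : Fin n → Fin n → ℝ := fun i j => min (a i / rowSum π i) 1 * π i j
  let π₂ : Fin n → Fin n → ℝ := fun i j => π₁ i j * min (b j / colSum π₁ j) 1
  let errA : Fin n → ℝ := fun i => a i - rowSum π₂ i
  let errB : Fin n → ℝ := fun j => b j - colSum π₂ j
  fun i j => π₂ i j + errA i * errB j / l1 errA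

/-- `π̂`, the rounding of `π(f^T, g^{T-1}, λ^{T-1})` with column margins `bk`. -/
def outPlan (P : Problem n N) (ε : ℝ) (T : ℕ) (bk : Fin N → Fin n → ℝ) :
    Fin N → Fin n → Fin n → ℝ :=
  fun k => roundPlan (lastPlan P ε T k) (rowSum (lastPlan P ε T k)) (bk k)

/-- `λ̂ = λ^{T-1}`. -/
def outLam (P : Problem n N) (ε : ℝ) (T : ℕ) : Fin N → ℝ := (pam P ε (T - 1)).lam

/-! ### Counting arithmetic operations

A `Counted α` is a value together with the number of arithmetic operations spent on it.
One unit is charged for each addition, subtraction, multiplication, division, exponential,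
logarithm, absolute value, square root and binary minimum or maximum of scalars.
Copying, indexing, branching, sorting and searching perform no arithmetic and are free. -/

structure Counted (α : Type) where
  val : α
  ops : ℕ

namespace Counted

instance : Monad Counted where
  pure x := ⟨x, 0⟩
  bind x f := ⟨(f x.val).val, x.ops + (f x.val).ops⟩

def opAdd {α : Type} [Add α] (x y : α) : Counted α := ⟨x + y, 1⟩
def opSub {α : Type} [Sub α] (x y : α) : Counted α := ⟨x - y, 1⟩
def opMul {α : Type} [Mul α] (x y : α) : Counted α := ⟨x * y, 1⟩
def opDiv {α : Type} [Div α] (x y : α) : Counted α := ⟨x / y, 1⟩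
def opMin (x y : ℝ) : Counted ℝ := ⟨min x y, 1⟩
def opMax (x y : ℝ) : Counted ℝ := ⟨max x y, 1⟩
def opAbs (x : ℝ) : Counted ℝ := ⟨|x|, 1⟩
def opSqrt (x : ℝ) : Counted ℝ := ⟨Real.sqrt x, 1⟩
def opLog (x : ℝ) : Counted ℝ := ⟨Real.log x, 1⟩
def opXexp (x : EReal) : Counted ℝ := ⟨xexp x, 1⟩
def opXlog (x : ℝ) : Counted EReal := ⟨xlog x, 1⟩

/-- Fill an array indexed by `ι`, computing every entry. -/
def array {ι α : Type} [Fintype ι] (x : ι → Counted α) : Counted (ι → α) :=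
  ⟨fun i => (x i).val, ∑ i, (x i).ops⟩

/-- Compute all the terms and add them up. -/
def sum {ι α : Type} [Fintype ι] [AddCommMonoid α] (x : ι → Counted α) : Counted α :=
  ⟨∑ i, (x i).val, ∑ i, (x i).ops + Fintype.card ι⟩

/-- Compute all the terms and take their maximum. -/
def sup {ι : Type} [Fintype ι] (x : ι → Counted ℝ) : Counted ℝ :=
  ⟨⨆ i, (x i).val, ∑ i, (x i).ops + Fintype.card ι⟩

/-- Compute all the terms and take their minimum. -/
def inf {ι : Type} [Fintype ι] (x : ι → Counted ℝ) : Counted ℝ :=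
  ⟨⨅ i, (x i).val, ∑ i, (x i).ops + Fintype.card ι⟩

/-- All partial sums of a vector, as a running sum with one addition per entry. -/
def partialSums {m : ℕ} (x : Fin m → ℝ) : Counted (Fin m → ℝ) :=
  ⟨fun j => ∑ i ∈ Finset.Iic j, x i, m⟩

/-- `WhileRun test body s s' m c`: the loop `while test do body`, started in `s`, terminates in
`s'` after `m` passes, and `c` operations are spent on tests and passes altogether. -/
inductive WhileRun {σ : Type} (test : σ → Counted Prop) (body : σ → Counted σ) :
    σ → σ → ℕ → ℕ → Prop
  | done {s : σ} : ¬ (test s).val → WhileRun test body s s 0 (test s).ops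
  | pass {s s' : σ} {m c : ℕ} : (test s).val → WhileRun test body (body s).val s' m c →
      WhileRun test body s s' (m + 1) ((test s).ops + (body s).ops + c)

end Counted

open Counted

/-! ### The algorithm as a program -/

def cRowSum (π : Fin n → Fin n → ℝ) : Counted (Fin n → ℝ) :=
  array fun i => Counted.sum fun j => pure (π i j)

def cColSum (π : Fin n → Fin n → ℝ) : Counted (Fin n → ℝ) :=
  array fun j => Counted.sum fun i => pure (π i j)

def cTotal (π : Fin N → Fin n → Fin n → ℝ) : Counted (Fin n → Fin n → ℝ) :=
  array fun i => array fun j => Counted.sum fun k => pure (π k i j)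

def cMass (π : Fin N → Fin n → Fin n → ℝ) : Counted ℝ :=
  Counted.sum fun k => Counted.sum fun i => Counted.sum fun j => pure (π k i j)

def cL1 (x y : Fin n → ℝ) : Counted ℝ :=
  Counted.sum fun i => do
    let d ← opSub (x i) (y i)
    opAbs d

def cL2 (x y : Fin N → ℝ) : Counted ℝ := do
  let s ← Counted.sum fun k => do
    let d ← opSub (x k) (y k)
    opMul d d
  opSqrt s

/-- `c_∞`. -/
def cCInf (P : Problem n N) : Counted ℝ :=
  Counted.sup fun p : Fin N × Fin n × Fin n => opAbs (P.C p.1 p.2.1 p.2.2)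

/-- `ι`. -/
def cIota (P : Problem n N) : Counted ℝ := Counted.inf fun j => opLog (P.b j)

/-- `η`, from `c = c_∞`. -/
def cEta (n N : ℕ) (ε c : ℝ) : Counted ℝ := do
  let n2 ← opMul (n : ℝ) n
  let d ← opMul n2 N
  let l ← opLog d
  let l1 ← opAdd l 1
  let l3 ← opMul 3 l1
  let q ← opDiv ε l3
  opMin q c

/-- `τ`, from `c = c_∞` and `η`. -/
def cTau (η c : ℝ) : Counted ℝ := do
  let c2 ← opMul c c
  opDiv η c2

def cZeta (P : Problem n N) (η : ℝ) (f : Fin n → EReal) (g : Fin n → ℝ) (lam : Fin N → ℝ) :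
    Counted (Fin N → Fin n → Fin n → ℝ) :=
  array fun k => array fun i => array fun j => do
    let s ← opAdd (f i) (g j : EReal)
    let m ← opMul (lam k) (P.C k i j)
    let d ← opSub s (m : EReal)
    let q ← opDiv d (η : EReal)
    opXexp q

def cPlan (P : Problem n N) (η : ℝ) (f : Fin n → EReal) (g : Fin n → ℝ) (lam : Fin N → ℝ) :
    Counted (Fin N → Fin n → Fin n → ℝ) := do
  let z ← cZeta P η f g lam
  let m ← cMass z
  array fun k => array fun i => array fun j => opDiv (z k i j) m

def cDualF (P : Problem n N) (η : ℝ) (f : Fin n → EReal) (g : Fin n → ℝ) (lam : Fin N → ℝ) :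
    Counted EReal := do
  let z ← cZeta P η f g lam
  let m ← cMass z
  let fa ← Counted.sum fun i => opMul (f i) (P.a i : EReal)
  let gb ← Counted.sum fun j => opMul (g j) (P.b j)
  let s ← opAdd fa (gb : EReal)
  let l ← opXlog m
  let h ← opMul (η : EReal) l
  let r ← opSub s h
  opSub r (η : EReal)

def cUpdateF (P : Problem n N) (η : ℝ) (f : Fin n → EReal) (g : Fin n → ℝ)
    (lam : Fin N → ℝ) : Counted (Fin n → EReal) := do
  let z ← cZeta P η f g lam
  let w ← cTotal z
  let r ← cRowSum w
  array fun i => do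
    let q ← opDiv (P.a i) (r i)
    let l ← opXlog q
    let h ← opMul (η : EReal) l
    opAdd (f i) h

def cUpdateG (P : Problem n N) (η : ℝ) (f : Fin n → EReal) (g : Fin n → ℝ)
    (lam : Fin N → ℝ) : Counted (Fin n → ℝ) := do
  let z ← cZeta P η f g lam
  let w ← cTotal z
  let c ← cColSum w
  array fun j => do
    let q ← opDiv (P.b j) (c j)
    let l ← opLog q
    let h ← opMul η l
    opAdd (g j) h

def cGradLam (P : Problem n N) (η : ℝ) (f : Fin n → EReal) (g : Fin n → ℝ)
    (lam : Fin N → ℝ) : Counted (Fin N → ℝ) := do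
  let p ← cPlan P η f g lam
  array fun k => Counted.sum fun i => Counted.sum fun j => opMul (p k i j) (P.C k i j)

/-- Projection to the simplex by sorting: with `y` in decreasing order and partial sums `S_j`,
the projection is `max(y - θ, 0)` for the threshold `θ = max_j (S_j - 1) / j`. -/
def cProj (y : Fin N → ℝ) : Counted (Fin N → ℝ) := do
  let σ := Tuple.sort fun k => OrderDual.toDual (y k)
  let S ← partialSums fun k => y (σ k)
  let θ ← Counted.sup fun j : Fin N => do
    let d ← opSub (S j) 1
    opDiv d ((j : ℕ) + 1 : ℝ)
  array fun k => do
    let d ← opSub (y k) θ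
    opMax d 0

def cUpdateLam (P : Problem n N) (η τ : ℝ) (f : Fin n → EReal) (g : Fin n → ℝ)
    (lam : Fin N → ℝ) : Counted (Fin N → ℝ) := do
  let d ← cGradLam P η f g lam
  let y ← array fun k => do
    let m ← opMul τ (d k)
    opAdd (lam k) m
  cProj y

/-- State of the main loop: the pass counter, the current `(f, g, λ)`, and the `g` and `λ` of the
previous iteration. -/
structure LoopState (n N : ℕ) where
  iter : ℕ
  f : Fin n → EReal
  g : Fin n → ℝ
  lam : Fin N → ℝ
  gPrev : Fin n → ℝ
  lamPrev : Fin N → ℝ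

def cInit (n N : ℕ) : Counted (LoopState n N) := do
  let l ← array fun _ : Fin N => opDiv (1 : ℝ) N
  return ⟨0, fun _ => 1, fun _ => 1, l, fun _ => 1, l⟩

def cBody (P : Problem n N) (η τ : ℝ) (s : LoopState n N) : Counted (LoopState n N) := do
  let f' ← cUpdateF P η s.f s.g s.lam
  let g' ← cUpdateG P η f' s.g s.lam
  let l' ← cUpdateLam P η τ f' g' s.lam
  return ⟨s.iter + 1, f', g', l', s.g, s.lam⟩

/-- The three stopping conditions; the optimal value `Fopt` of the dual problem, which the third
condition refers to, is taken as known. -/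
def cStops (P : Problem n N) (ε c iot η : ℝ) (Fopt : EReal) (s : LoopState n N) :
    Counted Prop := do
  let p ← cPlan P η s.f s.gPrev s.lamPrev
  let w ← cTotal p
  let col ← cColSum w
  let d₁ ← cL1 col P.b
  let c6 ← opMul 6 c
  let ei ← opMul η iot
  let q ← opSub c6 ei
  let q6 ← opMul 6 q
  let t₁ ← opDiv ε q6
  let d₂ ← cL2 s.lam s.lamPrev
  let ee ← opMul η ε
  let cc ← opMul c c
  let c18 ← opMul 18 cc
  let t₂ ← opDiv ee c18
  let v ← cDualF P η s.f s.gPrev s.lamPrev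
  let d₃ ← opSub Fopt v
  let t₃ ← opDiv ε 6
  return d₁ ≤ t₁ ∧ d₂ ≤ t₂ ∧ d₃ ≤ (t₃ : EReal)

/-- Continue as long as the stopping conditions are not met; they are first tested after one
iteration. -/
def cTest (P : Problem n N) (ε c iot η : ℝ) (Fopt : EReal) (s : LoopState n N) :
    Counted Prop :=
  if s.iter = 0 then pure True
  else do
    let p ← cStops P ε c iot η Fopt s
    return ¬ p

/-- First candidate for the margins: `bᵏ = c(πᵏ) + (b - c(∑ₖ πᵏ)) / N`. -/
def cMarginsInit (b : Fin n → ℝ) (π : Fin N → Fin n → Fin n → ℝ) (col : Fin N → Fin n → ℝ) :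
    Counted (Fin N → Fin n → ℝ) := do
  let w ← cTotal π
  let c ← cColSum w
  let e ← array fun j => do
    let d ← opSub (b j) (c j)
    opDiv d (N : ℝ)
  array fun k => array fun j => opAdd (col k j) (e j)

def cMarginsTest (bk : Fin N → Fin n → ℝ) : Counted Prop := pure (∃ k j, bk k j < 0)

open Classical in
/-- One exchange step. The first negative entry `bk k j` in row-major order is selected, then the
first `j'` with `bk k j' > c(πᵏ)_{j'}` and the first `k'` with `bk k' j > 0`, and the amount `θ` is
moved around the four entries. -/
def cMarginsBody (col : Fin N → Fin n → ℝ) (bk : Fin N → Fin n → ℝ) :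
    Counted (Fin N → Fin n → ℝ) :=
  match (List.finRange N ×ˢ List.finRange n).find? fun p => decide (bk p.1 p.2 < 0) with
  | none => pure bk
  | some (k, j) =>
    match (List.finRange n).find? fun j' => decide (0 < bk k j' - col k j'),
      (List.finRange N).find? fun k' => decide (0 < bk k' j) with
    | some j', some k' => do
      let u ← opAbs (bk k j)
      let v ← opAbs (bk k' j)
      let d ← opSub (bk k j') (col k j')
      let w ← opAbs d
      let vw ← opMin v w
      let θ ← opMin u vw
      let x₁ ← opAdd (bk k j) θ
      let x₂ ← opSub (bk k j') θ
      let x₃ ← opSub (bk k' j) θ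
      let x₄ ← opAdd (bk k' j') θ
      return fun p q =>
        if p = k ∧ q = j then x₁
        else if p = k ∧ q = j' then x₂
        else if p = k' ∧ q = j then x₃
        else if p = k' ∧ q = j' then x₄
        else bk p q
    | _, _ => pure bk

def cRound (π : Fin n → Fin n → ℝ) (a b : Fin n → ℝ) : Counted (Fin n → Fin n → ℝ) := do
  let r ← cRowSum π
  let x ← array fun i => do
    let q ← opDiv (a i) (r i)
    opMin q 1
  let π₁ ← array fun i => array fun j => opMul (x i) (π i j)
  let c ← cColSum π₁
  let y ← array fun j => do
    let q ← opDiv (b j) (c j)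
    opMin q 1
  let π₂ ← array fun i => array fun j => opMul (π₁ i j) (y j)
  let r₂ ← cRowSum π₂
  let c₂ ← cColSum π₂
  let errA ← array fun i => opSub (a i) (r₂ i)
  let errB ← array fun j => opSub (b j) (c₂ j)
  let m ← Counted.sum fun i => opAbs (errA i)
  array fun i => array fun j => do
    let p ← opMul (errA i) (errB j)
    let q ← opDiv p m
    opAdd (π₂ i j) q

/-- `PAMRun P ε T bk πhat lamHat ops`: the whole algorithm terminates; its main loop makes `T`
passes, the margins procedure returns `bk`, the output is `(πhat, lamHat)`, and `ops` arithmetic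
operations are performed in total. -/
def PAMRun (P : Problem n N) (ε : ℝ) (T : ℕ) (bk : Fin N → Fin n → ℝ)
    (πhat : Fin N → Fin n → Fin n → ℝ) (lamHat : Fin N → ℝ) (ops : ℕ) : Prop :=
  let par : Counted (ℝ × ℝ × ℝ × ℝ) := do
    let c ← cCInf P
    let iot ← cIota P
    let η ← cEta n N ε c
    let τ ← cTau η c
    return (c, iot, η, τ)
  let c := par.val.1
  let iot := par.val.2.1
  let η := par.val.2.2.1
  let τ := par.val.2.2.2
  ∃ (s : LoopState n N) (ops₁ ops₂ m : ℕ),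
    WhileRun (cTest P ε c iot η (dualOpt P η)) (cBody P η τ) (cInit n N).val s T ops₁ ∧
    let p := cPlan P η s.f s.gPrev s.lamPrev
    let row := array fun k => cRowSum (p.val k)
    let col := array fun k => cColSum (p.val k)
    let b₀ := cMarginsInit P.b p.val col.val
    WhileRun cMarginsTest (cMarginsBody col.val) b₀.val bk m ops₂ ∧
    let out := array fun k => cRound (p.val k) (row.val k) (bk k)
    πhat = out.val ∧ lamHat = s.lamPrev ∧
    ops = par.ops + (cInit n N).ops + ops₁ + p.ops + row.ops + col.ops + b₀.ops + ops₂ + out.ops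

end EOT

end

/-! Each new `f` exactly maximizes the dual objective, so the iteration lives on `(g, λ)` and climbs
the concave function `semiDual` obtained by eliminating `f`. The gradient of `semiDual` is `b` minus
the column sums in `g` and `⟨πᵏ, Cᵏ⟩` in `λ`, both taken at the plan `sPlan`, whose row sums are
exactly `a`.

Let `D` be the distance to the optimal value, `x` the `ℓ¹` error of the column sums, and `z` the
length of the step in `λ` times `c_∞ / η`. Two estimates carry the iteration bound.

Gain (`semiDual_step_ge`): the update of `g` gains `η KL(b ‖ sCol) ≥ η x² / 2` by Pinsker.
Hoeffding's lemma bounds the curvature in `λ` by `c_∞² / η`, so a projected gradient step of size `η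
/ c_∞²` gains `η z² / 2`.

Gap (`semiDual_le_of_centered`): by concavity `D` is at most its first-order terms. An updated `g`
oscillates by at most `R = 2 c_∞ - η ι`, and the variational inequality of the projection controls
`λ`. The result is `D ≤ s (4/3 x + z)` with `s = max R (3 c_∞)`, which is `γ₀ ^ (-1/2)`.

Together they make `D` drop by a multiple of `D²` per iteration, so it falls to `ε / 6` like `1 /
t`. After that, every iteration with `x` or `z` still large consumes a fixed part of the remaining
`ε / 6` (`exists_index_small`).

At the stopping time the duality gap is split at `sPlan`. Rounding costs `c_∞ x`, with no factor `N`
thanks to the sign condition on the margins (`round_family_spec`). The first-order gap in `λ` is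
controlled by `x` and the last step (`sum_sub_mul_frob_sPlan_le`). Rewriting the linear cost through
the Gibbs kernel shows that `sPlan` is optimal up to `⟨g, sCol - b⟩` and an entropy term `η log (N
n)` (`ell_sPlan_le`).

An iteration costs `O(N n²)` operations by inspection. The margins loop needs an argument: an
integer potential of size `O(N n²)` falls in every exchange (`marginsBody_spec`). -/

open scoped BigOperators

namespace EOT

/-! ### Jensen, Hoeffding and Pinsker on a finite set -/

section FiniteProbability

variable {ι : Type*} [Fintype ι]

/-- Jensen's inequality for the exponential, in logarithmic form. -/
theorem sum_mul_le_log_sum_mul_exp {p : ι → ℝ} (hp : ∀ i, 0 ≤ p i) (h1 : ∑ i, p i = 1)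
    (x : ι → ℝ) : ∑ i, p i * x i ≤ Real.log (∑ i, p i * Real.exp (x i)) := by
  have h := convexOn_exp.map_sum_le (t := Finset.univ) (w := p) (p := x)
    (fun i _ => hp i) h1 (fun i _ => Set.mem_univ _)
  simp only [smul_eq_mul] at h
  exact (Real.le_log_iff_exp_le ((Real.exp_pos _).trans_le h)).2 h

theorem sum_mul_exp_pos {p : ι → ℝ} (hp : ∀ i, 0 ≤ p i) (h1 : ∑ i, p i = 1)
    (x : ι → ℝ) : 0 < ∑ i, p i * Real.exp (x i) := by
  have h := convexOn_exp.map_sum_le (t := Finset.univ) (w := p) (p := x)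
    (fun i _ => hp i) h1 (fun i _ => Set.mem_univ _)
  simp only [smul_eq_mul] at h
  exact (Real.exp_pos _).trans_le h

/-- Hoeffding's lemma on a finite probability space. -/
theorem log_sum_mul_exp_le {p : ι → ℝ} (hp : ∀ i, 0 ≤ p i) (h1 : ∑ i, p i = 1)
    {x : ι → ℝ} {B : ℝ} (hx : ∀ i, |x i| ≤ B) :
    Real.log (∑ i, p i * Real.exp (x i)) ≤ ∑ i, p i * x i + B ^ 2 / 2 := by
  classical
  let _ : MeasurableSpace ι := ⊤
  have : MeasurableSingletonClass ι := ⟨fun _ => trivial⟩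
  have hs : ∑ i, ENNReal.ofReal (p i) = 1 := by
    rw [← ENNReal.ofReal_sum_of_nonneg fun i _ => hp i, h1, ENNReal.ofReal_one]
  set q : PMF ι := PMF.ofFintype (fun i => ENNReal.ofReal (p i)) hs with hq
  have hint : ∀ f : ι → ℝ, ∫ i, f i ∂q.toMeasure = ∑ i, p i * f i := fun f => by
    rw [PMF.integral_eq_sum]
    refine Finset.sum_congr rfl fun i _ => ?_
    rw [hq, PMF.ofFintype_apply, ENNReal.toReal_ofReal (hp i), smul_eq_mul]
  have hB : 0 ≤ B := by
    rcases isEmpty_or_nonempty ι with h | ⟨⟨i⟩⟩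
    · simp at h1
    · exact (abs_nonneg _).trans (hx i)
  -- The interval `[-B, B]` has half-length `B`, so the variance proxy is `B ^ 2`.
  have hsg := ProbabilityTheory.hasSubgaussianMGF_of_mem_Icc (μ := q.toMeasure) (X := x)
    (a := -B) (b := B) (measurable_of_finite x).aemeasurable
    (Filter.Eventually.of_forall fun i => abs_le.1 (hx i))
  have hm := hsg.mgf_le 1
  have hnn : (((‖B - -B‖₊ / 2) ^ 2 : NNReal) : ℝ) = B ^ 2 := by
    push_cast
    rw [Real.norm_eq_abs, div_pow, sq_abs]
    ring
  rw [hnn, ProbabilityTheory.mgf, hint, hint] at hm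
  rw [Real.log_le_iff_le_exp (sum_mul_exp_pos hp h1 x), Real.exp_add]
  calc ∑ i, p i * Real.exp (x i)
      = Real.exp (∑ i, p i * x i) * ∑ i, p i * Real.exp (1 * (x i - ∑ i, p i * x i)) := by
        rw [Finset.mul_sum]
        refine Finset.sum_congr rfl fun i _ => ?_
        rw [one_mul, Real.exp_sub]
        field_simp
    _ ≤ _ := by
        refine mul_le_mul_of_nonneg_left (hm.trans (le_of_eq ?_)) (Real.exp_pos _).le
        ring_nf

/-- Jensen's inequality for the logarithm. -/
theorem sum_mul_log_le {p : ι → ℝ} (hp : ∀ i, 0 ≤ p i) (h1 : ∑ i, p i = 1)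
    {x : ι → ℝ} (hx : ∀ i, 0 < x i) :
    ∑ i, p i * Real.log (x i) ≤ Real.log (∑ i, p i * x i) := by
  have h := sum_mul_le_log_sum_mul_exp hp h1 fun i => Real.log (x i)
  simpa only [Real.exp_log (hx _)] using h

/-- Pinsker's inequality. -/
theorem pinsker {p q : ι → ℝ} (hp : ∀ i, 0 < p i) (hq : ∀ i, 0 < q i)
    (hp1 : ∑ i, p i = 1) (hq1 : ∑ i, q i = 1) :
    (∑ i, |q i - p i|) ^ 2 / 2 ≤ ∑ i, p i * Real.log (p i / q i) := by
  set s := ∑ i, |q i - p i| with hs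
  have hs0 : 0 ≤ s := Finset.sum_nonneg fun i _ => abs_nonneg _
  -- Donsker–Varadhan with test function `s * h`, where `h` is the sign of `p - q`. Jensen under `p`
  -- bounds `∑ p (s h) - KL` by the logarithm of the `q`-mean of `exp (s h)`; Hoeffding under `q`
  -- bounds that by `∑ q (s h) + s ^ 2 / 2`.
  set h : ι → ℝ := fun i => if q i ≤ p i then 1 else -1 with hh
  have h1 := sum_mul_le_log_sum_mul_exp (fun i => (hp i).le) hp1
    fun i => s * h i - Real.log (p i / q i)
  have h2 := log_sum_mul_exp_le (fun i => (hq i).le) hq1 (x := fun i => s * h i) (B := s)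
    (fun i => by
      rw [abs_mul, abs_of_nonneg hs0, hh]
      dsimp only
      split_ifs <;> simp)
  have h3 : ∑ i, p i * Real.exp (s * h i - Real.log (p i / q i))
      = ∑ i, q i * Real.exp (s * h i) := by
    refine Finset.sum_congr rfl fun i _ => ?_
    rw [Real.exp_sub, Real.exp_log (div_pos (hp i) (hq i))]
    have := (hp i).ne'
    have := (hq i).ne'
    field_simp
  rw [h3] at h1
  have h4 : ∑ i, p i * (s * h i) - ∑ i, q i * (s * h i) = s * s := by
    conv_rhs => rw [hs, ← hs, Finset.mul_sum]
    rw [← Finset.sum_sub_distrib]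
    refine Finset.sum_congr rfl fun i _ => ?_
    simp only [hh]
    split_ifs with hc
    · rw [abs_of_nonpos (by linarith)]; ring
    · rw [abs_of_pos (by linarith)]; ring
  have h5 : ∑ i, p i * (s * h i - Real.log (p i / q i))
      = ∑ i, p i * (s * h i) - ∑ i, p i * Real.log (p i / q i) := by
    rw [← Finset.sum_sub_distrib]
    exact Finset.sum_congr rfl fun i _ => mul_sub _ _ _
  nlinarith

end FiniteProbability

/-! ### Norms and oscillation -/

section Norms

variable {ι : Type*} [Fintype ι]

theorem l1_nonneg (x : ι → ℝ) : 0 ≤ l1 x := Finset.sum_nonneg fun _ _ => abs_nonneg _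

theorem l2_nonneg (x : ι → ℝ) : 0 ≤ l2 x := Real.sqrt_nonneg _

theorem l2_sq (x : ι → ℝ) : l2 x ^ 2 = ∑ i, x i ^ 2 :=
  Real.sq_sqrt (Finset.sum_nonneg fun _ _ => sq_nonneg _)

theorem abs_le_l2 (x : ι → ℝ) (i : ι) : |x i| ≤ l2 x := by
  refine Real.abs_le_sqrt ?_
  exact Finset.single_le_sum (f := fun i => x i ^ 2) (fun _ _ => sq_nonneg _) (Finset.mem_univ i)

theorem sum_mul_le_mul_l1 {x y : ι → ℝ} {B : ℝ} (hx : ∀ i, |x i| ≤ B) :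
    ∑ i, x i * y i ≤ B * l1 y := by
  rw [l1, Finset.mul_sum]
  refine Finset.sum_le_sum fun i _ => (le_abs_self _).trans ?_
  rw [abs_mul]
  exact mul_le_mul_of_nonneg_right (hx i) (abs_nonneg _)

/-- `g` takes values in an interval of length `R`. -/
def Centered (R : ℝ) (g : ι → ℝ) : Prop := ∃ m, ∀ j, |g j - m| ≤ R / 2

theorem Centered.sum_mul_le {R : ℝ} {g y : ι → ℝ} (hg : Centered R g) (hy : ∑ j, y j = 0) :
    ∑ j, g j * y j ≤ R / 2 * l1 y := by
  obtain ⟨m, hm⟩ := hg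
  have h := sum_mul_le_mul_l1 (y := y) hm
  have h2 : ∑ j, (g j - m) * y j = ∑ j, g j * y j := by
    simp only [sub_mul, Finset.sum_sub_distrib, ← Finset.mul_sum, hy, mul_zero, sub_zero]
  rwa [h2] at h

/-- A zero-sum `y` does not see the midpoints of the two intervals, so each vector contributes half
of `R`. -/
theorem Centered.sum_sub_mul_le {R : ℝ} {g h y : ι → ℝ} (hg : Centered R g)
    (hh : Centered R h) (hy : ∑ j, y j = 0) :
    ∑ j, (h j - g j) * y j ≤ R * l1 y := by
  have h1 := hh.sum_mul_le hy
  have h2 := hg.sum_mul_le (y := -y) (by simp [hy])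
  have h3 : l1 (-y) = l1 y := by simp [l1]
  rw [h3] at h2
  have h4 : ∑ j, (h j - g j) * y j = ∑ j, h j * y j + ∑ j, g j * (-y) j := by
    rw [← Finset.sum_add_distrib]
    exact Finset.sum_congr rfl fun j _ => by simp only [Pi.neg_apply]; ring
  rw [h4]
  linarith

end Norms

/-! ### Euclidean projection to the simplex -/

section Simplex

variable {N : ℕ}

theorem le_one_of_mem_stdSimplex {ι : Type*} [Fintype ι] {x : ι → ℝ}
    (hx : x ∈ stdSimplex ℝ ι) (i : ι) : x i ≤ 1 :=
  hx.2 ▸ Finset.single_le_sum (f := x) (fun j _ => hx.1 j) (Finset.mem_univ i)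

theorem l1_eq_one_of_mem_stdSimplex {ι : Type*} [Fintype ι] {x : ι → ℝ}
    (hx : x ∈ stdSimplex ℝ ι) : l1 x = 1 := by
  rw [← hx.2, l1]
  exact Finset.sum_congr rfl fun j _ => abs_of_nonneg (hx.1 j)

/-- A point of the simplex of the form `max (y - θ) 0` satisfies the variational inequality
that characterizes the projection of `y`. -/
theorem sum_sub_mul_sub_nonpos {y : Fin N → ℝ} {θ : ℝ}
    (hz : (fun k => max (y k - θ) 0) ∈ stdSimplex ℝ (Fin N)) {w : Fin N → ℝ}
    (hw : w ∈ stdSimplex ℝ (Fin N)) :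
    ∑ k, (w k - max (y k - θ) 0) * (y k - max (y k - θ) 0) ≤ 0 := by
  -- On the support of the projection `y - z` equals `θ`, elsewhere it is at most `θ`. The constant
  -- `θ` pairs to zero with a difference of two simplex points.
  have h : ∀ k, (w k - max (y k - θ) 0) * (y k - max (y k - θ) 0)
      ≤ (w k - max (y k - θ) 0) * θ := fun k => by
    rcases le_total (y k - θ) 0 with h | h
    · rw [max_eq_right h]
      nlinarith [hw.1 k]
    · rw [max_eq_left h]
      exact le_of_eq (by ring)
  refine (Finset.sum_le_sum fun k _ => h k).trans ?_
  rw [← Finset.sum_mul, Finset.sum_sub_distrib, hw.2, hz.2, sub_self, zero_mul]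

/-- Pythagoras at an obtuse angle; the extra term `l2 (w - z) ^ 2` yields uniqueness of the
projection. -/
theorem l2_sub_sq_add_le {y z w : Fin N → ℝ} (h : ∑ k, (w k - z k) * (y k - z k) ≤ 0) :
    l2 (z - y) ^ 2 + l2 (w - z) ^ 2 ≤ l2 (w - y) ^ 2 := by
  have h1 : l2 (w - y) ^ 2
      = l2 (z - y) ^ 2 + l2 (w - z) ^ 2 - 2 * ∑ k, (w k - z k) * (y k - z k) := by
    simp only [l2_sq, Finset.mul_sum, ← Finset.sum_add_distrib, ← Finset.sum_sub_distrib,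
      Pi.sub_apply]
    exact Finset.sum_congr rfl fun k _ => by ring
  linarith

theorem eq_of_l2_sub_nonpos {w z : Fin N → ℝ} (h : l2 (w - z) ^ 2 ≤ 0) : w = z := by
  rw [l2_sq] at h
  have h0 := le_antisymm h (Finset.sum_nonneg fun _ _ => sq_nonneg _)
  rw [Finset.sum_eq_zero_iff_of_nonneg fun _ _ => sq_nonneg _] at h0
  funext k
  have := h0 k (Finset.mem_univ k)
  simp only [Pi.sub_apply] at this
  exact sub_eq_zero.1 (pow_eq_zero_iff two_ne_zero |>.1 this)

theorem projSimplex_eq {y : Fin N → ℝ} {θ : ℝ}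
    (hz : (fun k => max (y k - θ) 0) ∈ stdSimplex ℝ (Fin N)) :
    projSimplex y = fun k => max (y k - θ) 0 := by
  set z : Fin N → ℝ := fun k => max (y k - θ) 0 with hzd
  have hmin : ∀ w ∈ stdSimplex ℝ (Fin N), l2 (z - y) ^ 2 + l2 (w - z) ^ 2 ≤ l2 (w - y) ^ 2 :=
    fun w hw => l2_sub_sq_add_le (sum_sub_mul_sub_nonpos hz hw)
  have hproj : IsProj y z := ⟨hz, fun w hw =>
    (sq_le_sq₀ (l2_nonneg _) (l2_nonneg _)).1 (by nlinarith [hmin w hw, sq_nonneg (l2 (w - z))])⟩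
  have he : IsProj y (projSimplex y) := Classical.epsilon_spec ⟨z, hproj⟩
  have h1 := hmin _ he.1
  have h2 := (sq_le_sq₀ (l2_nonneg _) (l2_nonneg _)).2 (he.2 z hz)
  exact eq_of_l2_sub_nonpos (by linarith)

/-- The threshold found by sorting. -/
noncomputable def sortThreshold (y : Fin N → ℝ) : ℝ :=
  ⨆ j : Fin N, ((∑ i ∈ Finset.Iic j, y (Tuple.sort (fun k => OrderDual.toDual (y k)) i)) - 1)
    / ((j : ℕ) + 1 : ℝ)

/-- In decreasing order, every initial segment satisfies `∑ (y - θ) ≤ 1`, with equality at an index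
attaining the supremum. Equality shows that the positive parts sum to at least 1. They are supported
on an initial segment, so they sum to at most 1. -/
theorem max_sub_sortThreshold_mem (hN : 0 < N) (y : Fin N → ℝ) :
    (fun k => max (y k - sortThreshold y) 0) ∈ stdSimplex ℝ (Fin N) := by
  have : Nonempty (Fin N) := ⟨⟨0, hN⟩⟩
  refine ⟨fun k => le_max_right _ _, ?_⟩
  set σ := Tuple.sort (fun k => OrderDual.toDual (y k)) with hσ
  set θ := sortThreshold y with hθ
  have hanti : Antitone fun i => y (σ i) := fun i j hij =>
    Tuple.monotone_sort (fun k => OrderDual.toDual (y k)) hij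
  set φ : Fin N → ℝ := fun j => ((∑ i ∈ Finset.Iic j, y (σ i)) - 1) / ((j : ℕ) + 1 : ℝ) with hφ
  have hθφ : θ = ⨆ j, φ j := rfl
  have hpos : ∀ j : Fin N, (0 : ℝ) < (j : ℕ) + 1 := fun j => by positivity
  have hcard : ∀ j : Fin N, ∑ _i ∈ Finset.Iic j, θ = ((j : ℕ) + 1) * θ := fun j => by
    rw [Finset.sum_const, Fin.card_Iic, nsmul_eq_mul]; push_cast; ring
  have hle : ∀ j, ∑ i ∈ Finset.Iic j, (y (σ i) - θ) ≤ 1 := fun j => by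
    have h : φ j ≤ θ := hθφ ▸ le_ciSup (Set.finite_range φ).bddAbove j
    rw [hφ] at h
    dsimp only at h
    rw [div_le_iff₀ (hpos j)] at h
    rw [Finset.sum_sub_distrib, hcard]
    linarith
  obtain ⟨j₀, hj₀⟩ := exists_eq_ciSup_of_finite (f := φ)
  have heq : ∑ i ∈ Finset.Iic j₀, (y (σ i) - θ) = 1 := by
    have h : φ j₀ = θ := hj₀
    rw [hφ] at h
    dsimp only at h
    rw [div_eq_iff (hpos j₀).ne'] at h
    rw [Finset.sum_sub_distrib, hcard]
    linarith
  rw [← Equiv.sum_comp σ fun k => max (y k - θ) 0]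
  have hge : 1 ≤ ∑ i, max (y (σ i) - θ) 0 := by
    rw [← heq]
    refine (Finset.sum_le_sum fun i _ => le_max_left _ 0).trans ?_
    exact Finset.sum_le_sum_of_subset_of_nonneg (Finset.subset_univ _)
      fun i _ _ => le_max_right _ _
  refine le_antisymm ?_ hge
  by_cases hne : ∃ i, 0 < y (σ i) - θ
  · set A := Finset.univ.filter fun i => 0 < y (σ i) - θ with hA
    have hAne : A.Nonempty := by
      obtain ⟨i, hi⟩ := hne
      exact ⟨i, by simpa [hA] using hi⟩
    set j := A.max' hAne with hj
    have hjA : j ∈ A := A.max'_mem hAne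
    have hAj : ∀ i, i ∈ Finset.Iic j ↔ 0 < y (σ i) - θ := fun i => by
      rw [Finset.mem_Iic]
      constructor
      · intro h
        have h1 : 0 < y (σ j) - θ := by simpa [hA] using hjA
        have h2 := hanti h
        simp only at h2
        linarith
      · intro h
        exact A.le_max' i (by simpa [hA] using h)
    refine le_trans (le_of_eq ?_) (hle j)
    rw [← Finset.sum_subset (Finset.subset_univ (Finset.Iic j))]
    · exact Finset.sum_congr rfl fun i hi => max_eq_left ((hAj i).1 hi).le
    · intro i _ hi
      rw [hAj] at hi
      exact max_eq_right (not_lt.1 hi)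
  · push Not at hne
    rw [Finset.sum_eq_zero fun i _ => max_eq_right (hne i)]
    exact zero_le_one

theorem projSimplex_eq_sort (hN : 0 < N) (y : Fin N → ℝ) :
    projSimplex y = fun k => max (y k - sortThreshold y) 0 :=
  projSimplex_eq (max_sub_sortThreshold_mem hN y)

theorem projSimplex_mem (hN : 0 < N) (y : Fin N → ℝ) :
    projSimplex y ∈ stdSimplex ℝ (Fin N) := by
  rw [projSimplex_eq_sort hN]; exact max_sub_sortThreshold_mem hN y

theorem projSimplex_variational (hN : 0 < N) (y : Fin N → ℝ) {w : Fin N → ℝ}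
    (hw : w ∈ stdSimplex ℝ (Fin N)) :
    ∑ k, (w k - projSimplex y k) * (y k - projSimplex y k) ≤ 0 := by
  rw [projSimplex_eq_sort hN]
  exact sum_sub_mul_sub_nonpos (max_sub_sortThreshold_mem hN y) hw

end Simplex

end EOT

namespace EOT

variable {n N : ℕ}

/-! ### Rearranging sums over agents, rows and columns -/

section TripleSums

theorem mass_eq_sum_prod (π : Fin N → Fin n → Fin n → ℝ) :
    mass π = ∑ p : Fin N × Fin n × Fin n, π p.1 p.2.1 p.2.2 := by
  simp only [mass, Fintype.sum_prod_type]

theorem mass_eq_sum_rowSum (π : Fin N → Fin n → Fin n → ℝ) :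
    mass π = ∑ i, rowSum (total π) i := by
  simp only [mass, rowSum, total]
  rw [Finset.sum_comm]
  exact Finset.sum_congr rfl fun i _ => Finset.sum_comm

theorem sum_prod_mul_row (u : Fin n → ℝ) (π : Fin N → Fin n → Fin n → ℝ) :
    ∑ p : Fin N × Fin n × Fin n, u p.2.1 * π p.1 p.2.1 p.2.2
      = ∑ i, u i * rowSum (total π) i := by
  simp only [Fintype.sum_prod_type, rowSum, total, Finset.mul_sum]
  rw [Finset.sum_comm]
  exact Finset.sum_congr rfl fun i _ => Finset.sum_comm

theorem sum_prod_mul_col (g : Fin n → ℝ) (π : Fin N → Fin n → Fin n → ℝ) :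
    ∑ p : Fin N × Fin n × Fin n, g p.2.2 * π p.1 p.2.1 p.2.2
      = ∑ j, g j * colSum (total π) j := by
  simp only [Fintype.sum_prod_type, colSum, total, Finset.mul_sum]
  rw [Finset.sum_comm]
  conv_rhs => rw [Finset.sum_comm]
  exact Finset.sum_congr rfl fun i _ => Finset.sum_comm

theorem sum_colSum_total (π : Fin N → Fin n → Fin n → ℝ) :
    ∑ j, colSum (total π) j = mass π := by
  have h := sum_prod_mul_col (fun _ => 1) π
  simp only [one_mul] at h
  rw [mass_eq_sum_prod, h]

theorem sum_prod_mul_frob (d : Fin N → ℝ) (π C : Fin N → Fin n → Fin n → ℝ) :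
    ∑ p : Fin N × Fin n × Fin n, π p.1 p.2.1 p.2.2 * (d p.1 * C p.1 p.2.1 p.2.2)
      = ∑ k, d k * frob (π k) (C k) := by
  simp only [Fintype.sum_prod_type, frob, Finset.mul_sum]
  exact Finset.sum_congr rfl fun k _ => Finset.sum_congr rfl fun i _ =>
    Finset.sum_congr rfl fun j _ => by ring

end TripleSums

/-- The standing hypotheses on the data. -/
structure Problem.Admissible (P : Problem n N) : Prop where
  a_mem : P.a ∈ stdSimplex ℝ (Fin n)
  b_mem : P.b ∈ stdSimplex ℝ (Fin n)
  b_pos : ∀ j, 0 < P.b j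
  C_ne : ∃ k i j, P.C k i j ≠ 0

/-! ### The semi-dual objective: concavity and gain -/

section SemiDual

/-- The Gibbs kernel `exp((g_j - λₖ Cᵏ_{ij}) / η)`. -/
noncomputable def kern (P : Problem n N) (η : ℝ) (g : Fin n → ℝ) (lam : Fin N → ℝ)
    (k : Fin N) (i j : Fin n) : ℝ :=
  Real.exp ((g j - lam k * P.C k i j) / η)

noncomputable def rowKern (P : Problem n N) (η : ℝ) (g : Fin n → ℝ) (lam : Fin N → ℝ)
    (i : Fin n) : ℝ :=
  ∑ p : Fin N × Fin n, kern P η g lam p.1 i p.2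

/-- The plan obtained from `g`, `λ` by optimizing over `f`. -/
noncomputable def sPlan (P : Problem n N) (η : ℝ) (g : Fin n → ℝ) (lam : Fin N → ℝ)
    (k : Fin N) (i j : Fin n) : ℝ :=
  P.a i / rowKern P η g lam i * kern P η g lam k i j

/-- Column sums of `sPlan`. -/
noncomputable def sCol (P : Problem n N) (η : ℝ) (g : Fin n → ℝ) (lam : Fin N → ℝ) :
    Fin n → ℝ :=
  colSum (total (sPlan P η g lam))

/-- The dual objective maximized over `f`. -/
noncomputable def semiDual (P : Problem n N) (η : ℝ) (g : Fin n → ℝ) (lam : Fin N → ℝ) : ℝ :=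
  η * ∑ i, P.a i * (Real.log (P.a i) - Real.log (rowKern P η g lam i)) + ∑ j, g j * P.b j - η

/-- The update of `g`. -/
noncomputable def gNext (P : Problem n N) (η : ℝ) (g : Fin n → ℝ) (lam : Fin N → ℝ)
    (j : Fin n) : ℝ :=
  g j + η * Real.log (P.b j / sCol P η g lam j)

/-- The plan after the update of `g`. -/
noncomputable def gPlan (P : Problem n N) (η : ℝ) (g : Fin n → ℝ) (lam : Fin N → ℝ)
    (k : Fin N) (i j : Fin n) : ℝ :=
  sPlan P η g lam k i j * (P.b j / sCol P η g lam j)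

variable {P : Problem n N} {η : ℝ} {g : Fin n → ℝ} {lam : Fin N → ℝ}

theorem Problem.Admissible.pos_N (hP : P.Admissible) : 0 < N := by
  obtain ⟨k, -⟩ := hP.C_ne; exact k.pos

theorem Problem.Admissible.pos_n (hP : P.Admissible) : 0 < n := by
  obtain ⟨-, i, -⟩ := hP.C_ne; exact i.pos

theorem kern_pos (P : Problem n N) (η : ℝ) (g : Fin n → ℝ) (lam : Fin N → ℝ) (k : Fin N)
    (i j : Fin n) : 0 < kern P η g lam k i j := Real.exp_pos _

theorem rowKern_pos (hP : P.Admissible) (i : Fin n) : 0 < rowKern P η g lam i := by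
  have : Nonempty (Fin N × Fin n) := ⟨⟨⟨0, hP.pos_N⟩, i⟩⟩
  exact Finset.sum_pos (fun p _ => kern_pos P η g lam p.1 i p.2) Finset.univ_nonempty

theorem sPlan_nonneg (hP : P.Admissible) (k : Fin N) (i j : Fin n) :
    0 ≤ sPlan P η g lam k i j :=
  mul_nonneg (div_nonneg (hP.a_mem.1 i) (rowKern_pos hP i).le) (kern_pos ..).le

theorem rowSum_total_sPlan (hP : P.Admissible) (i : Fin n) :
    rowSum (total (sPlan P η g lam)) i = P.a i := by
  simp only [rowSum, total, sPlan]
  rw [Finset.sum_comm]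
  simp only [← Finset.mul_sum]
  rw [← Fintype.sum_prod_type' (f := fun k j => kern P η g lam k i j)]
  exact div_mul_cancel₀ _ (rowKern_pos hP i).ne'

theorem mass_sPlan (hP : P.Admissible) : mass (sPlan P η g lam) = 1 := by
  rw [mass_eq_sum_rowSum, ← hP.a_mem.2]
  exact Finset.sum_congr rfl fun i _ => rowSum_total_sPlan hP i

theorem sum_sCol (hP : P.Admissible) : ∑ j, sCol P η g lam j = 1 := by
  unfold sCol
  rw [sum_colSum_total, mass_sPlan hP]

theorem exists_a_pos (hP : P.Admissible) : ∃ i, 0 < P.a i := by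
  by_contra! h
  have h1 := hP.a_mem.2
  rw [Finset.sum_eq_zero fun i _ => le_antisymm (h i) (hP.a_mem.1 i)] at h1
  exact zero_ne_one h1

theorem sCol_pos (hP : P.Admissible) (j : Fin n) : 0 < sCol P η g lam j := by
  obtain ⟨i, hi⟩ := exists_a_pos hP
  refine Finset.sum_pos' (fun i _ => Finset.sum_nonneg fun k _ => sPlan_nonneg hP k i j)
    ⟨i, Finset.mem_univ i, ?_⟩
  have : Nonempty (Fin N) := ⟨⟨0, hP.pos_N⟩⟩
  exact Finset.sum_pos (fun k _ => mul_pos (div_pos hi (rowKern_pos hP i)) (kern_pos ..))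
    Finset.univ_nonempty

theorem gPlan_nonneg (hP : P.Admissible) (k : Fin N) (i j : Fin n) :
    0 ≤ gPlan P η g lam k i j :=
  mul_nonneg (sPlan_nonneg hP k i j) (div_nonneg (hP.b_pos j).le (sCol_pos hP j).le)

theorem mass_gPlan (hP : P.Admissible) : mass (gPlan P η g lam) = 1 := by
  have h := sum_prod_mul_col (fun j => P.b j / sCol P η g lam j) (sPlan P η g lam)
  rw [mass_eq_sum_prod, ← hP.b_mem.2]
  simp only [gPlan]
  rw [show ∑ j, P.b j = ∑ j, P.b j / sCol P η g lam j * colSum (total (sPlan P η g lam)) j from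
    Finset.sum_congr rfl fun j _ => (div_mul_cancel₀ _ (sCol_pos hP j).ne').symm, ← h]
  exact Finset.sum_congr rfl fun p _ => mul_comm _ _

theorem kern_eq_mul (g' : Fin n → ℝ) (lam' : Fin N → ℝ) (k : Fin N) (i j : Fin n) :
    kern P η g' lam' k i j = kern P η g lam k i j
      * Real.exp (((g' j - g j) - (lam' k - lam k) * P.C k i j) / η) := by
  rw [kern, kern, ← Real.exp_add]
  congr 1
  ring

/-- Concavity of the semi-dual objective. -/
theorem semiDual_le (hP : P.Admissible) (hη : 0 < η) (g' : Fin n → ℝ) (lam' : Fin N → ℝ) :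
    semiDual P η g' lam' ≤ semiDual P η g lam + ∑ j, (g' j - g j) * (P.b j - sCol P η g lam j)
      + ∑ k, (lam' k - lam k) * frob (sPlan P η g lam k) (P.C k) := by
  set X : Fin N → Fin n → Fin n → ℝ :=
    fun k i j => ((g' j - g j) - (lam' k - lam k) * P.C k i j) / η with hX
  -- `log (rowKern · i)` is a log-sum-exp, hence convex in `(g, λ)`. This is its tangent inequality,
  -- from Jensen for the Gibbs weights of row `i`.
  have hrow : ∀ i, Real.log (rowKern P η g lam i)
      + ∑ p : Fin N × Fin n, kern P η g lam p.1 i p.2 / rowKern P η g lam i * X p.1 i p.2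
      ≤ Real.log (rowKern P η g' lam' i) := fun i => by
    have hK := rowKern_pos (η := η) (g := g) (lam := lam) hP i
    have h1 : ∑ p : Fin N × Fin n, kern P η g lam p.1 i p.2 / rowKern P η g lam i = 1 := by
      rw [← Finset.sum_div]; exact div_self hK.ne'
    have hp : ∀ p : Fin N × Fin n, 0 ≤ kern P η g lam p.1 i p.2 / rowKern P η g lam i :=
      fun p => div_nonneg (kern_pos ..).le hK.le
    have h2 := sum_mul_le_log_sum_mul_exp hp h1 fun p => X p.1 i p.2
    have h3 : rowKern P η g' lam' i = rowKern P η g lam i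
        * ∑ p : Fin N × Fin n, kern P η g lam p.1 i p.2 / rowKern P η g lam i
          * Real.exp (X p.1 i p.2) := by
      rw [Finset.mul_sum, rowKern]
      refine Finset.sum_congr rfl fun p _ => ?_
      rw [kern_eq_mul (g := g) (lam := lam) g' lam', ← mul_assoc, mul_div_cancel₀ _ hK.ne']
    rw [h3, Real.log_mul hK.ne' (sum_mul_exp_pos hp h1 _).ne']
    linarith
  have hsum : ∑ i, P.a i * ∑ p : Fin N × Fin n,
        kern P η g lam p.1 i p.2 / rowKern P η g lam i * X p.1 i p.2
      = (∑ j, (g' j - g j) * sCol P η g lam j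
        - ∑ k, (lam' k - lam k) * frob (sPlan P η g lam k) (P.C k)) / η := by
    rw [← sum_prod_mul_frob, sCol, ← sum_prod_mul_col, ← Finset.sum_sub_distrib, Finset.sum_div]
    simp only [Finset.mul_sum, Fintype.sum_prod_type]
    rw [Finset.sum_comm]
    refine Finset.sum_congr rfl fun k _ => Finset.sum_congr rfl fun i _ =>
      Finset.sum_congr rfl fun j _ => ?_
    rw [hX, sPlan]
    ring
  have hle : ∑ i, P.a i * (Real.log (P.a i) - Real.log (rowKern P η g' lam' i))
      ≤ ∑ i, P.a i * (Real.log (P.a i) - Real.log (rowKern P η g lam i))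
        - (∑ j, (g' j - g j) * sCol P η g lam j
        - ∑ k, (lam' k - lam k) * frob (sPlan P η g lam k) (P.C k)) / η := by
    rw [← hsum, ← Finset.sum_sub_distrib]
    refine Finset.sum_le_sum fun i _ => ?_
    rw [← mul_sub]
    exact mul_le_mul_of_nonneg_left (by linarith [hrow i]) (hP.a_mem.1 i)
  have hle2 := mul_le_mul_of_nonneg_left hle hη.le
  rw [mul_sub, mul_div_cancel₀ _ hη.ne'] at hle2
  have e1 : ∑ j, (g' j - g j) * (P.b j - sCol P η g lam j)
      = ∑ j, g' j * P.b j - ∑ j, g j * P.b j - ∑ j, (g' j - g j) * sCol P η g lam j := by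
    rw [← Finset.sum_sub_distrib, ← Finset.sum_sub_distrib]
    exact Finset.sum_congr rfl fun j _ => by ring
  rw [semiDual, semiDual, e1]
  linarith

/-- Increase of the semi-dual objective under the update of `g` and a change of `λ`. -/
theorem semiDual_gNext_ge (hP : P.Admissible) (hη : 0 < η) {c : ℝ}
    (hc : ∀ k i j, |P.C k i j| ≤ c) (lam' : Fin N → ℝ) :
    semiDual P η g lam + η * ∑ j, P.b j * Real.log (P.b j / sCol P η g lam j)
      + ∑ k, (lam' k - lam k) * frob (gPlan P η g lam k) (P.C k)
      - c ^ 2 / (2 * η) * l2 (lam' - lam) ^ 2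
      ≤ semiDual P η (gNext P η g lam) lam' := by
  have hc0 : 0 ≤ c := by
    obtain ⟨k, i, j, -⟩ := hP.C_ne
    exact (abs_nonneg _).trans (hc k i j)
  set X : Fin N × Fin n × Fin n → ℝ :=
    fun p => -((lam' p.1 - lam p.1) * P.C p.1 p.2.1 p.2.2 / η) with hX
  have hkern : ∀ k i j, kern P η (gNext P η g lam) lam' k i j
      = kern P η g lam k i j * (P.b j / sCol P η g lam j * Real.exp (X (k, i, j))) :=
    fun k i j => by
      rw [kern_eq_mul (g := g) (lam := lam) _ lam', gNext,
        show (g j + η * Real.log (P.b j / sCol P η g lam j) - g j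
          - (lam' k - lam k) * P.C k i j) / η
          = Real.log (P.b j / sCol P η g lam j) + X (k, i, j) by
            rw [hX]; dsimp only; field_simp; ring,
        Real.exp_add, Real.exp_log (div_pos (hP.b_pos j) (sCol_pos hP j))]
  have hratio : ∀ i, 0 < rowKern P η (gNext P η g lam) lam' i / rowKern P η g lam i :=
    fun i => div_pos (rowKern_pos hP i) (rowKern_pos hP i)
  -- This amounts to keeping `f` fixed while `g` and `λ` move: Jensen merges the row normalizers
  -- into a single one, the mean of `exp X` under `gPlan`.
  have h1 := sum_mul_log_le hP.a_mem.1 hP.a_mem.2 hratio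
  have h2 : ∑ i, P.a i * (rowKern P η (gNext P η g lam) lam' i / rowKern P η g lam i)
      = ∑ p : Fin N × Fin n × Fin n, gPlan P η g lam p.1 p.2.1 p.2.2 * Real.exp (X p) := by
    simp only [rowKern, Fintype.sum_prod_type, hkern]
    conv_rhs => rw [Finset.sum_comm]
    refine Finset.sum_congr rfl fun i _ => ?_
    rw [Finset.sum_div, Finset.mul_sum]
    refine Finset.sum_congr rfl fun k _ => ?_
    rw [Finset.sum_div, Finset.mul_sum]
    refine Finset.sum_congr rfl fun j _ => ?_
    simp only [gPlan, sPlan, rowKern, Fintype.sum_prod_type]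
    ring
  have hXB : ∀ p, |X p| ≤ c * l2 (lam' - lam) / η := fun p => by
    rw [hX]
    dsimp only
    rw [abs_neg, abs_div, abs_of_pos hη, abs_mul, mul_comm]
    refine div_le_div_of_nonneg_right ?_ hη.le
    exact mul_le_mul (hc _ _ _) (abs_le_l2 (lam' - lam) p.1) (abs_nonneg _) hc0
  -- Hoeffding with `|X| ≤ c d / η` produces the quadratic loss `η (c d / η)² / 2 = c² d² / (2 η)`,
  -- where `d` is the length of the step in `λ`.
  have h3 := log_sum_mul_exp_le (p := fun p : Fin N × Fin n × Fin n =>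
      gPlan P η g lam p.1 p.2.1 p.2.2) (fun p => gPlan_nonneg hP _ _ _)
    (by rw [← mass_eq_sum_prod, mass_gPlan hP]) hXB
  have h4 : ∑ p : Fin N × Fin n × Fin n, gPlan P η g lam p.1 p.2.1 p.2.2 * X p
      = -(∑ k, (lam' k - lam k) * frob (gPlan P η g lam k) (P.C k)) / η := by
    rw [← sum_prod_mul_frob, ← Finset.sum_neg_distrib, Finset.sum_div]
    refine Finset.sum_congr rfl fun p _ => ?_
    rw [hX]
    ring
  rw [← h2, h4] at h3
  have h5 : ∑ i, P.a i * (Real.log (P.a i) - Real.log (rowKern P η (gNext P η g lam) lam' i))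
      = ∑ i, P.a i * (Real.log (P.a i) - Real.log (rowKern P η g lam i))
        - ∑ i, P.a i * Real.log
          (rowKern P η (gNext P η g lam) lam' i / rowKern P η g lam i) := by
    rw [← Finset.sum_sub_distrib]
    refine Finset.sum_congr rfl fun i _ => ?_
    rw [Real.log_div (rowKern_pos hP i).ne' (rowKern_pos hP i).ne']
    ring
  have h6 : ∑ j, gNext P η g lam j * P.b j
      = ∑ j, g j * P.b j + η * ∑ j, P.b j * Real.log (P.b j / sCol P η g lam j) := by
    rw [Finset.mul_sum, ← Finset.sum_add_distrib]
    exact Finset.sum_congr rfl fun j _ => by rw [gNext]; ring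
  have h7 := mul_le_mul_of_nonneg_left (h1.trans h3) hη.le
  have h8 : η * (-(∑ k, (lam' k - lam k) * frob (gPlan P η g lam k) (P.C k)) / η
      + (c * l2 (lam' - lam) / η) ^ 2 / 2)
      = -(∑ k, (lam' k - lam k) * frob (gPlan P η g lam k) (P.C k))
        + c ^ 2 / (2 * η) * l2 (lam' - lam) ^ 2 := by
    field_simp
  rw [h8] at h7
  rw [semiDual, semiDual, h5, h6, mul_sub]
  linarith

/-- The gain `η KL(b ‖ sCol)` is nonnegative by Pinsker. This lets an arbitrary competitor `g'` be
replaced by its update, whose oscillation is under control. -/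
theorem semiDual_le_gNext (hP : P.Admissible) (hη : 0 < η) :
    semiDual P η g lam ≤ semiDual P η (gNext P η g lam) lam := by
  obtain ⟨c, hc⟩ : ∃ c, ∀ k i j, |P.C k i j| ≤ c := by
    refine ⟨∑ p : Fin N × Fin n × Fin n, |P.C p.1 p.2.1 p.2.2|, fun k i j => ?_⟩
    exact Finset.single_le_sum (f := fun p : Fin N × Fin n × Fin n => |P.C p.1 p.2.1 p.2.2|)
      (fun _ _ => abs_nonneg _) (Finset.mem_univ (k, i, j))
  have h := semiDual_gNext_ge (g := g) (lam := lam) hP hη hc lam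
  have hp := pinsker hP.b_pos (sCol_pos (η := η) (g := g) (lam := lam) hP) hP.b_mem.2
    (sum_sCol hP)
  have h0 : l2 (lam - lam) = 0 := by simp [l2]
  simp only [sub_self, zero_mul, Finset.sum_const_zero] at h
  rw [show (0 : Fin N → ℝ) = lam - lam by simp, h0] at h
  have := mul_nonneg hη.le ((by positivity : (0:ℝ) ≤ _).trans hp)
  linarith

end SemiDual

end EOT

namespace EOT

variable {n N : ℕ}

/-! ### Signs and sizes of the constants -/

section Constants

variable {P : Problem n N}

theorem abs_C_le_cInf (P : Problem n N) (k : Fin N) (i j : Fin n) : |P.C k i j| ≤ cInf P :=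
  le_ciSup (f := fun p : Fin N × Fin n × Fin n => |P.C p.1 p.2.1 p.2.2|)
    (Set.finite_range _).bddAbove (k, i, j)

theorem cInf_pos (hP : P.Admissible) : 0 < cInf P := by
  obtain ⟨k, i, j, h⟩ := hP.C_ne
  exact (abs_pos.2 h).trans_le (abs_C_le_cInf P k i j)

theorem iota_le (P : Problem n N) (j : Fin n) : iota P ≤ Real.log (P.b j) :=
  ciInf_le (Set.finite_range _).bddBelow j

theorem log_b_nonpos (hP : P.Admissible) (j : Fin n) : Real.log (P.b j) ≤ 0 :=
  Real.log_nonpos (hP.b_mem.1 j) (le_one_of_mem_stdSimplex hP.b_mem j)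

theorem iota_nonpos (hP : P.Admissible) : iota P ≤ 0 :=
  (iota_le P ⟨0, hP.pos_n⟩).trans (log_b_nonpos hP _)

theorem one_le_logDim (hP : P.Admissible) : 1 ≤ logDim n N := by
  have hn : (1 : ℝ) ≤ n := by exact_mod_cast hP.pos_n
  have hN : (1 : ℝ) ≤ N := by exact_mod_cast hP.pos_N
  have h : 0 ≤ Real.log ((n : ℝ) * n * N) :=
    Real.log_nonneg (one_le_mul_of_one_le_of_one_le (one_le_mul_of_one_le_of_one_le hn hn) hN)
  rw [logDim]
  linarith

theorem eta_pos (hP : P.Admissible) {ε : ℝ} (hε : 0 < ε) : 0 < eta P ε :=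
  lt_min (div_pos hε (by linarith [one_le_logDim hP])) (cInf_pos hP)

theorem eta_le_cInf (P : Problem n N) (ε : ℝ) : eta P ε ≤ cInf P := min_le_right _ _

end Constants

/-! ### One iteration: oscillation, gap and gain -/

section Step

variable {P : Problem n N} {η : ℝ} {g : Fin n → ℝ} {lam : Fin N → ℝ}

/-- The projected gradient step for `λ`. -/
noncomputable def lamNext (P : Problem n N) (η τ : ℝ) (g : Fin n → ℝ) (lam : Fin N → ℝ) :
    Fin N → ℝ :=
  projSimplex fun k => lam k + τ * frob (gPlan P η g lam k) (P.C k)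

theorem lamNext_mem (hP : P.Admissible) (τ : ℝ) :
    lamNext P η τ g lam ∈ stdSimplex ℝ (Fin N) := projSimplex_mem hP.pos_N _

/-- In the update the old `g j` cancels, leaving `η log (b j) - η log (S j)`, where `S j` depends on
`j` only through the costs. As `|λₖ Cᵏ| ≤ c_∞`, `S j` is within a factor `exp (± c_∞ / η)` of `U`,
while `η log (b j)` lies in `[η ι, 0]`. -/
theorem centered_gNext (hP : P.Admissible) (hη : 0 < η) (hlam : lam ∈ stdSimplex ℝ (Fin N)) :
    Centered (2 * cInf P - η * iota P) (gNext P η g lam) := by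
  set U : ℝ := ∑ i : Fin n, ∑ _k : Fin N, P.a i / rowKern P η g lam i with hU
  set S : Fin n → ℝ := fun j => ∑ i, ∑ k, P.a i / rowKern P η g lam i
    * Real.exp (-(lam k * P.C k i j) / η) with hS
  have : Nonempty (Fin N) := ⟨⟨0, hP.pos_N⟩⟩
  have hterm : ∀ i, 0 ≤ P.a i / rowKern P η g lam i :=
    fun i => div_nonneg (hP.a_mem.1 i) (rowKern_pos hP i).le
  have hU0 : 0 < U := by
    obtain ⟨i, hi⟩ := exists_a_pos hP
    refine Finset.sum_pos' (fun i _ => Finset.sum_nonneg fun _ _ => hterm i)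
      ⟨i, Finset.mem_univ i, Finset.sum_pos (fun _ _ => div_pos hi (rowKern_pos hP i))
        Finset.univ_nonempty⟩
  have hcol : ∀ j, sCol P η g lam j = Real.exp (g j / η) * S j := fun j => by
    simp only [sCol, colSum, total, hS, Finset.mul_sum]
    refine Finset.sum_congr rfl fun i _ => Finset.sum_congr rfl fun k _ => ?_
    rw [sPlan, kern, show (g j - lam k * P.C k i j) / η
      = g j / η + -(lam k * P.C k i j) / η by ring, Real.exp_add]
    ring
  have hlc : ∀ k i j, |lam k * P.C k i j| ≤ cInf P := fun k i j => by
    rw [abs_mul, abs_of_nonneg (hlam.1 k)]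
    exact (mul_le_of_le_one_left (abs_nonneg _) (le_one_of_mem_stdSimplex hlam k)).trans
      (abs_C_le_cInf P k i j)
  have hupper : ∀ j, S j ≤ Real.exp (cInf P / η) * U := fun j => by
    rw [hS, hU, Finset.mul_sum]
    refine Finset.sum_le_sum fun i _ => ?_
    rw [Finset.mul_sum]
    refine Finset.sum_le_sum fun k _ => ?_
    rw [mul_comm]
    refine mul_le_mul_of_nonneg_right (Real.exp_le_exp.2 ?_) (hterm i)
    exact div_le_div_of_nonneg_right (by linarith [neg_le_abs (lam k * P.C k i j), hlc k i j])
      hη.le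
  have hlower : ∀ j, Real.exp (-(cInf P / η)) * U ≤ S j := fun j => by
    rw [hS, hU, Finset.mul_sum]
    refine Finset.sum_le_sum fun i _ => ?_
    rw [Finset.mul_sum]
    refine Finset.sum_le_sum fun k _ => ?_
    rw [mul_comm]
    refine mul_le_mul_of_nonneg_left (Real.exp_le_exp.2 ?_) (hterm i)
    rw [← neg_div]
    exact div_le_div_of_nonneg_right (by linarith [le_abs_self (lam k * P.C k i j), hlc k i j])
      hη.le
  have hS0 : ∀ j, 0 < S j := fun j => lt_of_lt_of_le (by positivity) (hlower j)
  refine ⟨η * iota P / 2 - η * Real.log U, fun j => ?_⟩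
  have hg : gNext P η g lam j = η * Real.log (P.b j) - η * Real.log (S j) := by
    rw [gNext, hcol, Real.log_div (hP.b_pos j).ne' (mul_pos (Real.exp_pos _) (hS0 j)).ne',
      Real.log_mul (Real.exp_pos _).ne' (hS0 j).ne', Real.log_exp]
    field_simp
    ring
  have h1 : η * Real.log (S j) ≤ cInf P + η * Real.log U := by
    have h := Real.log_le_log (hS0 j) (hupper j)
    rw [Real.log_mul (Real.exp_pos _).ne' hU0.ne', Real.log_exp] at h
    have h' := mul_le_mul_of_nonneg_left h hη.le
    rwa [mul_add, mul_div_cancel₀ _ hη.ne'] at h'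
  have h2 : -cInf P + η * Real.log U ≤ η * Real.log (S j) := by
    have h := Real.log_le_log (by positivity) (hlower j)
    rw [Real.log_mul (Real.exp_pos _).ne' hU0.ne', Real.log_exp] at h
    have h' := mul_le_mul_of_nonneg_left h hη.le
    rwa [mul_add, mul_neg, mul_div_cancel₀ _ hη.ne'] at h'
  have h3 := mul_le_mul_of_nonneg_left (iota_le P j) hη.le
  have h4 := mul_nonpos_of_nonneg_of_nonpos hη.le (log_b_nonpos hP j)
  rw [hg, abs_le]
  constructor <;> linarith

theorem sum_abs_frob_le (P : Problem n N) (π : Fin N → Fin n → Fin n → ℝ) :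
    ∑ k, |frob (π k) (P.C k)|
      ≤ cInf P * ∑ p : Fin N × Fin n × Fin n, |π p.1 p.2.1 p.2.2| := by
  simp only [Fintype.sum_prod_type, Finset.mul_sum, frob]
  refine Finset.sum_le_sum fun k _ => ?_
  refine (Finset.abs_sum_le_sum_abs _ _).trans (Finset.sum_le_sum fun i _ => ?_)
  refine (Finset.abs_sum_le_sum_abs _ _).trans (Finset.sum_le_sum fun j _ => ?_)
  rw [abs_mul, mul_comm]
  exact mul_le_mul_of_nonneg_right (abs_C_le_cInf P k i j) (abs_nonneg _)

theorem abs_sub_le_one {w : Fin N → ℝ} (hw : w ∈ stdSimplex ℝ (Fin N))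
    (hlam : lam ∈ stdSimplex ℝ (Fin N)) (k : Fin N) : |w k - lam k| ≤ 1 := by
  rw [abs_le]
  constructor <;> linarith [hw.1 k, hlam.1 k, le_one_of_mem_stdSimplex hw k,
    le_one_of_mem_stdSimplex hlam k]

/-- The gradient step in `λ` uses the plan after the update of `g`, the gap estimate the plan before
it. The two differ by the column factors `b j / sCol j`, so their `ℓ¹` distance is exactly the
marginal error. -/
theorem sum_sub_mul_frob_sub_le (hP : P.Admissible) {w : Fin N → ℝ}
    (hw : w ∈ stdSimplex ℝ (Fin N)) (hlam : lam ∈ stdSimplex ℝ (Fin N)) :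
    ∑ k, (w k - lam k) * (frob (sPlan P η g lam k) (P.C k) - frob (gPlan P η g lam k) (P.C k))
      ≤ cInf P * l1 (sCol P η g lam - P.b) := by
  refine (sum_mul_le_mul_l1 (abs_sub_le_one hw hlam)).trans ?_
  rw [one_mul]
  have h := sum_abs_frob_le P fun k i j => sPlan P η g lam k i j - gPlan P η g lam k i j
  have h1 : ∀ k, frob (fun i j => sPlan P η g lam k i j - gPlan P η g lam k i j) (P.C k)
      = frob (sPlan P η g lam k) (P.C k) - frob (gPlan P η g lam k) (P.C k) := fun k => by
    simp only [frob, sub_mul, Finset.sum_sub_distrib]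
  simp only [h1] at h
  refine h.trans (le_of_eq ?_)
  congr 1
  have h2 := sum_prod_mul_col (fun j => |1 - P.b j / sCol P η g lam j|) (sPlan P η g lam)
  have h3 : ∀ p : Fin N × Fin n × Fin n,
      |sPlan P η g lam p.1 p.2.1 p.2.2 - gPlan P η g lam p.1 p.2.1 p.2.2|
        = |1 - P.b p.2.2 / sCol P η g lam p.2.2| * sPlan P η g lam p.1 p.2.1 p.2.2 := fun p => by
    rw [gPlan, show ∀ x y : ℝ, x - x * y = (1 - y) * x from fun x y => by ring, abs_mul,
      abs_of_nonneg (sPlan_nonneg hP _ _ _)]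
  simp only [h3]
  rw [h2, l1]
  refine Finset.sum_congr rfl fun j _ => ?_
  have h4 := sCol_pos (η := η) (g := g) (lam := lam) hP j
  have h5 : colSum (total (sPlan P η g lam)) j = |sCol P η g lam j| := (abs_of_pos h4).symm
  rw [h5, ← abs_mul, sub_mul, div_mul_cancel₀ _ h4.ne', one_mul, Pi.sub_apply]

/-- The variational inequality of the projection, tested at the current point `lam`. -/
theorem sq_l2_le_sum_lamNext (hP : P.Admissible) {τ : ℝ}
    (hlam : lam ∈ stdSimplex ℝ (Fin N)) :
    l2 (lamNext P η τ g lam - lam) ^ 2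
      ≤ τ * ∑ k, (lamNext P η τ g lam k - lam k) * frob (gPlan P η g lam k) (P.C k) := by
  have h := projSimplex_variational hP.pos_N
    (fun k => lam k + τ * frob (gPlan P η g lam k) (P.C k)) hlam
  change ∑ k, (lam k - lamNext P η τ g lam k) * (lam k + τ * frob (gPlan P η g lam k) (P.C k)
    - lamNext P η τ g lam k) ≤ 0 at h
  have h2 : ∑ k, (lam k - lamNext P η τ g lam k)
      * (lam k + τ * frob (gPlan P η g lam k) (P.C k) - lamNext P η τ g lam k)
      = l2 (lamNext P η τ g lam - lam) ^ 2
        - τ * ∑ k, (lamNext P η τ g lam k - lam k) * frob (gPlan P η g lam k) (P.C k) := by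
    rw [l2_sq, Finset.mul_sum, ← Finset.sum_sub_distrib]
    refine Finset.sum_congr rfl fun k _ => ?_
    rw [Pi.sub_apply]
    ring
  linarith

/-- The factor 3 is 2 + 1. The variational inequality at `w`, divided by `τ`, gives `2 c_∞² / η`, as
two simplex points are at `ℓ¹` distance at most 2. Passing from `z` back to `lam` costs `c_∞ ≤ c_∞²
/ η`, because `η ≤ c_∞`. -/
theorem sum_sub_mul_frob_gPlan_le (hP : P.Admissible) (hη : 0 < η) (hηc : η ≤ cInf P)
    {w : Fin N → ℝ} (hw : w ∈ stdSimplex ℝ (Fin N)) :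
    ∑ k, (w k - lam k) * frob (gPlan P η g lam k) (P.C k)
      ≤ 3 * cInf P ^ 2 / η * l2 (lamNext P η (η / (cInf P * cInf P)) g lam - lam) := by
  have hc := cInf_pos hP
  set τ := η / (cInf P * cInf P) with hτ
  have hτ0 : 0 < τ := by positivity
  set z := lamNext P η τ g lam with hz
  have hzm : z ∈ stdSimplex ℝ (Fin N) := lamNext_mem hP τ
  set d := l2 (z - lam) with hd
  have hd0 : 0 ≤ d := l2_nonneg _
  have h := projSimplex_variational hP.pos_N
    (fun k => lam k + τ * frob (gPlan P η g lam k) (P.C k)) hw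
  change ∑ k, (w k - z k) * (lam k + τ * frob (gPlan P η g lam k) (P.C k) - z k) ≤ 0 at h
  have h1 : ∑ k, (w k - z k) * (lam k + τ * frob (gPlan P η g lam k) (P.C k) - z k)
      = τ * ∑ k, (w k - z k) * frob (gPlan P η g lam k) (P.C k)
        - ∑ k, (z k - lam k) * (w k - z k) := by
    rw [Finset.mul_sum, ← Finset.sum_sub_distrib]
    exact Finset.sum_congr rfl fun k _ => by ring
  have h2 : ∑ k, (z k - lam k) * (w k - z k) ≤ d * 2 := by
    refine (sum_mul_le_mul_l1 (fun k => abs_le_l2 (z - lam) k)).trans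
      (mul_le_mul_of_nonneg_left ?_ hd0)
    calc l1 (fun k => w k - z k) ≤ l1 w + l1 z := by
          rw [l1, l1, l1, ← Finset.sum_add_distrib]
          exact Finset.sum_le_sum fun k _ => abs_sub _ _
      _ = 2 := by
          rw [l1_eq_one_of_mem_stdSimplex hw, l1_eq_one_of_mem_stdSimplex hzm]; norm_num
  have h3 : ∑ k, (z k - lam k) * frob (gPlan P η g lam k) (P.C k) ≤ d * cInf P := by
    refine (sum_mul_le_mul_l1 (fun k => abs_le_l2 (z - lam) k)).trans
      (mul_le_mul_of_nonneg_left ?_ hd0)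
    refine (sum_abs_frob_le P _).trans (le_of_eq ?_)
    simp only [abs_of_nonneg (gPlan_nonneg hP _ _ _)]
    rw [← mass_eq_sum_prod, mass_gPlan hP, mul_one]
  have h4 : ∑ k, (w k - lam k) * frob (gPlan P η g lam k) (P.C k)
      = ∑ k, (w k - z k) * frob (gPlan P η g lam k) (P.C k)
        + ∑ k, (z k - lam k) * frob (gPlan P η g lam k) (P.C k) := by
    rw [← Finset.sum_add_distrib]
    exact Finset.sum_congr rfl fun k _ => by ring
  have h5 : ∑ k, (w k - z k) * frob (gPlan P η g lam k) (P.C k) ≤ 2 * cInf P ^ 2 / η * d := by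
    have h6 : τ * ∑ k, (w k - z k) * frob (gPlan P η g lam k) (P.C k) ≤ d * 2 := by linarith
    rw [← le_div_iff₀' hτ0] at h6
    refine h6.trans (le_of_eq ?_)
    rw [hτ]
    field_simp
  have h7 : d * cInf P ≤ cInf P ^ 2 / η * d := by
    rw [mul_comm]
    refine mul_le_mul_of_nonneg_right ?_ hd0
    rw [le_div_iff₀ hη, sq]
    exact mul_le_mul_of_nonneg_left hηc hc.le
  rw [h4]
  calc _ ≤ 2 * cInf P ^ 2 / η * d + cInf P ^ 2 / η * d := add_le_add h5 (h3.trans h7)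
    _ = _ := by ring

/-- First-order gap in `λ` at the plan before the update of `g`. -/
theorem sum_sub_mul_frob_sPlan_le (hP : P.Admissible) (hη : 0 < η) (hηc : η ≤ cInf P)
    {w : Fin N → ℝ} (hw : w ∈ stdSimplex ℝ (Fin N)) (hlam : lam ∈ stdSimplex ℝ (Fin N)) :
    ∑ k, (w k - lam k) * frob (sPlan P η g lam k) (P.C k)
      ≤ cInf P * l1 (sCol P η g lam - P.b)
        + 3 * cInf P ^ 2 / η * l2 (lamNext P η (η / (cInf P * cInf P)) g lam - lam) := by
  have h1 := sum_sub_mul_frob_sub_le (η := η) (g := g) hP hw hlam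
  have h2 := sum_sub_mul_frob_gPlan_le (g := g) (lam := lam) hP hη hηc hw
  simp only [mul_sub, Finset.sum_sub_distrib] at h1
  linarith

theorem sum_sub_sCol_eq_zero (hP : P.Admissible) : ∑ j, (P.b - sCol P η g lam) j = 0 := by
  simp only [Pi.sub_apply, Finset.sum_sub_distrib, hP.b_mem.2, sum_sCol hP, sub_self]

theorem l1_sub_comm {ι : Type*} [Fintype ι] (x y : ι → ℝ) : l1 (x - y) = l1 (y - x) := by
  simp only [l1, Pi.sub_apply, abs_sub_comm]

/-- Suboptimality of `(g, λ)` in terms of the marginal error and the movement of `λ`. -/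
theorem semiDual_le_of_centered (hP : P.Admissible) (hη : 0 < η) (hηc : η ≤ cInf P)
    (hg : Centered (2 * cInf P - η * iota P) g) (hlam : lam ∈ stdSimplex ℝ (Fin N))
    (g' : Fin n → ℝ) {w : Fin N → ℝ} (hw : w ∈ stdSimplex ℝ (Fin N)) :
    semiDual P η g' w ≤ semiDual P η g lam
      + (2 * cInf P - η * iota P + cInf P) * l1 (sCol P η g lam - P.b)
      + 3 * cInf P ^ 2 / η * l2 (lamNext P η (η / (cInf P * cInf P)) g lam - lam) := by
  have h1 := semiDual_le_gNext (g := g') (lam := w) hP hη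
  have h2 := semiDual_le (g := g) (lam := lam) hP hη (gNext P η g' w) w
  have h3 := hg.sum_sub_mul_le (centered_gNext (g := g') hP hη hw)
    (sum_sub_sCol_eq_zero (η := η) (g := g) (lam := lam) hP)
  have h4 := sum_sub_mul_frob_sPlan_le (g := g) hP hη hηc hw hlam
  rw [l1_sub_comm] at h3
  simp only [Pi.sub_apply] at h3
  linarith

/-- Increase of the semi-dual objective in one iteration. -/
theorem semiDual_step_ge (hP : P.Admissible) (hη : 0 < η) (hlam : lam ∈ stdSimplex ℝ (Fin N)) :
    semiDual P η g lam + η / 2 * (l1 (sCol P η g lam - P.b) ^ 2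
      + (cInf P / η * l2 (lamNext P η (η / (cInf P * cInf P)) g lam - lam)) ^ 2)
      ≤ semiDual P η (gNext P η g lam) (lamNext P η (η / (cInf P * cInf P)) g lam) := by
  have hc := cInf_pos hP
  have h1 := semiDual_gNext_ge (g := g) (lam := lam) hP hη (abs_C_le_cInf P)
    (lamNext P η (η / (cInf P * cInf P)) g lam)
  have h2 := pinsker hP.b_pos (sCol_pos (η := η) (g := g) (lam := lam) hP) hP.b_mem.2
    (sum_sCol hP)
  have h3 := sq_l2_le_sum_lamNext (η := η) (g := g) (τ := η / (cInf P * cInf P)) hP hlam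
  rw [← div_le_iff₀' (by positivity)] at h3
  have h4 := mul_le_mul_of_nonneg_left h2 hη.le
  change η * (l1 (sCol P η g lam - P.b) ^ 2 / 2) ≤ _ at h4
  set d := l2 (lamNext P η (η / (cInf P * cInf P)) g lam - lam)
  -- Of the linear gain `c_∞² d² / η`, the Hoeffding loss takes back exactly half.
  have h5 : d ^ 2 / (η / (cInf P * cInf P)) = cInf P ^ 2 / (2 * η) * d ^ 2
      + η / 2 * (cInf P / η * d) ^ 2 := by
    field_simp
    ring
  rw [h5] at h3
  linarith

end Step

end EOT

/-! ### Rate of convergence from gap and gain -/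

namespace EOT

/-- A nonnegative sequence with `D (t + 1) ≤ D t - κ (D t)²` decays like `1 / (κ t)`. -/
theorem mul_le_one_of_quadratic_decrease {D : ℕ → ℝ} {κ : ℝ} (hκ : 0 < κ)
    (hD : ∀ t, 0 ≤ D t) (hdec : ∀ t, D (t + 1) + κ * D t ^ 2 ≤ D t) (t : ℕ) :
    (t : ℝ) * (κ * D t) ≤ 1 := by
  induction t with
  | zero => simp
  | succ t ih =>
    have h1 := hdec t
    have h2 := hD t
    have h3 := hD (t + 1)
    push_cast
    set u := κ * D t with hu
    set v := κ * D (t + 1) with hv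
    have hu0 : 0 ≤ u := by positivity
    have huv : v ≤ u - u ^ 2 := by
      have := mul_le_mul_of_nonneg_left h1 hκ.le
      rw [hu, hv]
      nlinarith
    have ht : (0 : ℝ) ≤ t := Nat.cast_nonneg t
    have h4 : ((t : ℝ) + 1) * v ≤ (t + 1) * (u - u ^ 2) :=
      mul_le_mul_of_nonneg_left huv (by linarith)
    -- When `(t + 1) u` exceeds 1, the loss `(t + 1) u ^ 2` outweighs the extra `u` added to `t * u
    -- ≤ 1`.
    rcases le_total ((t + 1) * u) 1 with h | h
    · nlinarith [mul_nonneg (by linarith : (0 : ℝ) ≤ t + 1) (sq_nonneg u)]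
    · nlinarith

/-- Two phases. Gap and gain combine into `D (t + 1) ≤ D t - κ (D t)²`, so `D ≤ ε / 6` from some
index on. From there, each index with `x` or `z` above `q` uses up `η q² / 2` of the remaining `ε /
6`. The bound is on `t + 1` because the pair `(g, λ)` of iterate `t` is tested at pass `t + 1`. -/
theorem exists_index_small {D x z : ℕ → ℝ} {η s ε q : ℝ} (hη : 0 < η) (hs : 0 < s) (hε : 0 < ε)
    (hq : 0 < q) (hD : ∀ t, 0 ≤ D t)
    (hgap : ∀ t, D t ≤ s * (4 / 3 * x t + z t))
    (hgain : ∀ t, D (t + 1) + η / 2 * (x t ^ 2 + z t ^ 2) ≤ D t) :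
    ∃ t : ℕ, (t : ℝ) + 1 ≤ 100 * s ^ 2 / (3 * η * ε) + ε / (3 * η * q ^ 2) + 2 ∧
      D t ≤ ε / 6 ∧ x t ≤ q ∧ z t ≤ q := by
  -- By Cauchy–Schwarz with constant `(4/3)² + 1 = 25/9`; `κ` solves `κ s² · 25/9 = η / 2`.
  set κ := 9 * η / (50 * s ^ 2) with hκ
  have hκ0 : 0 < κ := by positivity
  have hdec : ∀ t, D (t + 1) + κ * D t ^ 2 ≤ D t := fun t => by
    have h1 : D t ^ 2 ≤ (s * (4 / 3 * x t + z t)) ^ 2 := pow_le_pow_left₀ (hD t) (hgap t) 2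
    have h2 : (4 / 3 * x t + z t) ^ 2 ≤ 25 / 9 * (x t ^ 2 + z t ^ 2) := by
      nlinarith [sq_nonneg (x t - 4 / 3 * z t)]
    have h3 : κ * D t ^ 2 ≤ η / 2 * (x t ^ 2 + z t ^ 2) := by
      calc κ * D t ^ 2 ≤ κ * (s ^ 2 * (25 / 9 * (x t ^ 2 + z t ^ 2))) := by
            refine mul_le_mul_of_nonneg_left (h1.trans ?_) hκ0.le
            rw [mul_pow]
            exact mul_le_mul_of_nonneg_left h2 (sq_nonneg s)
        _ = η / 2 * (x t ^ 2 + z t ^ 2) := by rw [hκ]; field_simp; ring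
    linarith [hgain t]
  -- `A = 6 / (κ ε)` is the time at which `1 / (κ t)` reaches `ε / 6`.
  set A := 100 * s ^ 2 / (3 * η * ε) with hA
  have hA0 : 0 < A := by positivity
  have hmono : ∀ t, D (t + 1) ≤ D t := fun t => by
    have := hgain t
    have : 0 ≤ η / 2 * (x t ^ 2 + z t ^ 2) := by positivity
    linarith
  have hanti : Antitone D := antitone_nat_of_succ_le hmono
  set t₁ := ⌈A⌉₊ with ht₁
  have hsmall : D t₁ ≤ ε / 6 := by
    have h1 := mul_le_one_of_quadratic_decrease hκ0 hD hdec t₁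
    have h2 : A ≤ t₁ := Nat.le_ceil A
    have h3 : A * (κ * D t₁) ≤ 1 :=
      (mul_le_mul_of_nonneg_right h2 (mul_nonneg hκ0.le (hD t₁))).trans h1
    have h4 : A * (κ * D t₁) = 6 * D t₁ / ε := by rw [hA, hκ]; field_simp; ring
    rw [h4, div_le_one hε] at h3
    linarith
  -- `B` is `ε / 6` divided by `η q² / 2`; since `M > B`, a run of `M` failures would make `D`
  -- negative.
  set B := ε / (3 * η * q ^ 2) with hB
  have hB0 : 0 < B := by positivity
  set M := ⌊B⌋₊ + 1 with hM
  have hMB : B < M := by rw [hM]; push_cast; exact Nat.lt_floor_add_one B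
  by_contra! hcon
  have hfail : ∀ i, i < M → D (t₁ + i + 1) + η / 2 * q ^ 2 ≤ D (t₁ + i) := fun i hi => by
    have h1 : ((t₁ + i : ℕ) : ℝ) + 1 ≤ A + B + 2 := by
      have h2 : (t₁ : ℝ) < A + 1 := Nat.ceil_lt_add_one hA0.le
      have h3 : (i : ℝ) + 1 ≤ M := by exact_mod_cast hi
      have h4 : (M : ℝ) ≤ B + 1 := by
        rw [hM]; push_cast; linarith [Nat.floor_le hB0.le]
      push_cast
      linarith
    have h5 := hcon (t₁ + i) h1 ((hanti (Nat.le_add_right t₁ i)).trans hsmall)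
    have h6 : q ^ 2 ≤ x (t₁ + i) ^ 2 + z (t₁ + i) ^ 2 := by
      rcases le_or_gt (x (t₁ + i)) q with h | h
      · have := pow_le_pow_left₀ hq.le (h5 h).le 2
        linarith [sq_nonneg (x (t₁ + i))]
      · have := pow_le_pow_left₀ hq.le h.le 2
        linarith [sq_nonneg (z (t₁ + i))]
    have h7 := mul_le_mul_of_nonneg_left h6 (by positivity : 0 ≤ η / 2)
    linarith [hgain (t₁ + i)]
  have hsum : ∀ i, i ≤ M → D (t₁ + i) + i * (η / 2 * q ^ 2) ≤ D t₁ := fun i => by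
    induction i with
    | zero => simp
    | succ i ih =>
      intro hi
      have h1 := ih (by omega)
      have h2 := hfail i (by omega)
      push_cast
      rw [← add_assoc]
      linarith
  have h1 := hsum M le_rfl
  have h2 : B * (η / 2 * q ^ 2) = ε / 6 := by rw [hB]; field_simp; ring
  have h3 : B * (η / 2 * q ^ 2) < M * (η / 2 * q ^ 2) :=
    mul_lt_mul_of_pos_right hMB (by positivity)
  linarith [hD (t₁ + M)]

/-! ### The explicit iteration bound -/

section IterBound

variable {n N : ℕ} {P : Problem n N} {ε : ℝ}

/-- Identifies `γ₀` with the inverse square of the factor `s` in the gap estimate. -/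
theorem sqrt_gamma0 (hP : P.Admissible) (hε : 0 < ε) :
    Real.sqrt (gamma0 P ε) = 1 / max (2 * cInf P - eta P ε * iota P) (3 * cInf P) ∧
    gamma0 P ε = 1 / max (2 * cInf P - eta P ε * iota P) (3 * cInf P) ^ 2 := by
  have hc := cInf_pos hP
  have hR : 0 < 2 * cInf P - eta P ε * iota P := by
    nlinarith [mul_nonneg (eta_pos hP hε).le (neg_nonneg.2 (iota_nonpos hP))]
  set R := 2 * cInf P - eta P ε * iota P with hRdef
  have h2 : gamma0 P ε = 1 / max R (3 * cInf P) ^ 2 := by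
    rw [gamma0, ← hRdef, show 9 * cInf P ^ 2 = (3 * cInf P) ^ 2 by ring]
    rcases le_total R (3 * cInf P) with h | h
    · rw [max_eq_right h, min_eq_right]
      exact one_div_le_one_div_of_le (by positivity) (pow_le_pow_left₀ hR.le h 2)
    · rw [max_eq_left h, min_eq_left]
      exact one_div_le_one_div_of_le (by positivity) (pow_le_pow_left₀ (by positivity) h 2)
  refine ⟨?_, h2⟩
  rw [h2, Real.sqrt_div zero_le_one, Real.sqrt_one, Real.sqrt_sq]
  exact le_max_of_le_left hR.le

theorem iterBound_eq (hP : P.Admissible) (hε : 0 < ε) :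
    iterBound P ε = 5 + (36 * max (2 * cInf P - eta P ε * iota P) (3 * cInf P)
        * (6 * cInf P - eta P ε * iota P) + 648 * cInf P ^ 2
        + 28 * max (2 * cInf P - eta P ε * iota P) (3 * cInf P) ^ 2) / (eta P ε * ε) := by
  obtain ⟨h1, h2⟩ := sqrt_gamma0 hP hε
  have hc := cInf_pos hP
  have hη := eta_pos hP hε
  have hm : 0 < 6 * cInf P - eta P ε * iota P := by
    nlinarith [mul_nonneg hη.le (neg_nonneg.2 (iota_nonpos hP))]
  have hs : 0 < max (2 * cInf P - eta P ε * iota P) (3 * cInf P) :=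
    lt_max_of_lt_right (by positivity)
  rw [iterBound, epsPrime, h1, h2]
  set s := max (2 * cInf P - eta P ε * iota P) (3 * cInf P)
  set m := 6 * cInf P - eta P ε * iota P
  field_simp
  ring

/-- With `q = ε' / 6` and `m = 6 c_∞ - η ι` the two phases take `(100/3 s² + 12 m²) / (η ε)` steps.
As `s ≤ m` and `3 m ≤ 7 s`, the numerator is at most `28 s² + 36 s m`. -/
theorem index_bound_le_iterBound (hP : P.Admissible) (hε : 0 < ε) :
    100 * max (2 * cInf P - eta P ε * iota P) (3 * cInf P) ^ 2 / (3 * eta P ε * ε)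
      + ε / (3 * eta P ε * (epsPrime P ε / 6) ^ 2) + 2 ≤ iterBound P ε := by
  have hc := cInf_pos hP
  have hη := eta_pos hP hε
  have hηι := mul_nonneg hη.le (neg_nonneg.2 (iota_nonpos hP))
  rw [iterBound_eq hP hε, epsPrime]
  have hR : 2 * cInf P - eta P ε * iota P
      = 6 * cInf P - eta P ε * iota P - 4 * cInf P := by ring
  have hm : 6 * cInf P ≤ 6 * cInf P - eta P ε * iota P := by linarith
  rw [hR]
  set m := 6 * cInf P - eta P ε * iota P with hmdef
  set s := max (m - 4 * cInf P) (3 * cInf P) with hs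
  have h1 : m - 4 * cInf P ≤ s := le_max_left _ _
  have h2 : 3 * cInf P ≤ s := le_max_right _ _
  have h3 : s ≤ m := max_le (by linarith) (by linarith)
  have hs0 : 0 < s := by linarith
  have hm0 : 0 < m := by linarith
  have e1 : 100 * s ^ 2 / (3 * eta P ε * ε) + ε / (3 * eta P ε * (ε / m / 6) ^ 2)
      = (100 / 3 * s ^ 2 + 12 * m ^ 2) / (eta P ε * ε) := by
    field_simp
    ring
  rw [e1]
  have h4 : (100 / 3 * s ^ 2 + 12 * m ^ 2) / (eta P ε * ε)
      ≤ (36 * s * m + 648 * cInf P ^ 2 + 28 * s ^ 2) / (eta P ε * ε) := by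
    refine div_le_div_of_nonneg_right ?_ (by positivity)
    have h5 : 3 * m ≤ 7 * s := by linarith
    nlinarith [mul_le_mul_of_nonneg_left h5 hm0.le, mul_le_mul_of_nonneg_left h3 hs0.le,
      sq_nonneg (cInf P)]
  linarith

theorem five_le_iterBound (hP : P.Admissible) (hε : 0 < ε) : 5 ≤ iterBound P ε := by
  have hc := cInf_pos hP
  have hη := eta_pos hP hε
  have hηι := mul_nonneg hη.le (neg_nonneg.2 (iota_nonpos hP))
  have hm : 0 < 6 * cInf P - eta P ε * iota P := by linarith
  have hs : 0 < max (2 * cInf P - eta P ε * iota P) (3 * cInf P) :=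
    lt_max_of_lt_right (by positivity)
  rw [iterBound_eq hP hε]
  exact le_add_of_nonneg_right (by positivity)

theorem gamma0_le (hP : P.Admissible) : gamma0 P ε ≤ 1 / cInf P ^ 2 := by
  have hc := cInf_pos hP
  refine (min_le_right _ _).trans (one_div_le_one_div_of_le (by positivity) ?_)
  nlinarith [sq_nonneg (cInf P)]

/-- For `ε ≤ c_∞` the minimum in `η` is `ε / (3 L)`, and `s`, `m` are at most `6 v` with `v = c_∞ (1
+ |ι| / L)`. The numerator is then at most `(36 · 36 + 648 + 28 · 36) v² = 2952 v²`. Division by `η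
ε` brings in `3 L`, hence 8856, and the additive 5 is absorbed since the remaining factors are at
least 1. -/
theorem iterBound_le (hP : P.Admissible) (hε : 0 < ε) (hεc : ε ≤ cInf P) :
    iterBound P ε ≤ 10000 * (logDim n N * (1 + |iota P| / logDim n N) ^ 2)
      * (cInf P ^ 2 / ε ^ 2) := by
  have hc := cInf_pos hP
  have hη := eta_pos hP hε
  have hL := one_le_logDim hP
  have hL0 : 0 < logDim n N := by linarith
  have hηι := mul_nonneg hη.le (neg_nonneg.2 (iota_nonpos hP))
  have heta : eta P ε = ε / (3 * logDim n N) := by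
    refine min_eq_left ((div_le_iff₀ (by linarith)).2 ?_)
    nlinarith
  set q := 1 + |iota P| / logDim n N with hq
  have hq1 : 1 ≤ q := by
    rw [hq]; exact le_add_of_nonneg_right (by positivity)
  have hm : 6 * cInf P - eta P ε * iota P ≤ 6 * (cInf P * q) := by
    have h1 : -(eta P ε * iota P) ≤ cInf P * (|iota P| / logDim n N) := by
      rw [heta, abs_of_nonpos (iota_nonpos hP), ← mul_neg, mul_div_assoc', div_mul_eq_mul_div,
        div_le_div_iff₀ (by positivity) hL0]
      have : ε * -iota P ≤ cInf P * -iota P :=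
        mul_le_mul_of_nonneg_right hεc (neg_nonneg.2 (iota_nonpos hP))
      have h0 : 0 ≤ cInf P * -iota P := mul_nonneg hc.le (neg_nonneg.2 (iota_nonpos hP))
      nlinarith
    have h0 : 0 ≤ cInf P * (|iota P| / logDim n N) := by positivity
    rw [hq]
    linarith
  rw [iterBound_eq hP hε]
  have hs1 : max (2 * cInf P - eta P ε * iota P) (3 * cInf P) ≤ 6 * (cInf P * q) :=
    max_le (by linarith) (by nlinarith)
  have hs0 : 0 < max (2 * cInf P - eta P ε * iota P) (3 * cInf P) :=
    lt_max_of_lt_right (by positivity)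
  have hm0 : 0 < 6 * cInf P - eta P ε * iota P := by linarith
  set s := max (2 * cInf P - eta P ε * iota P) (3 * cInf P)
  set m := 6 * cInf P - eta P ε * iota P
  set v := cInf P * q with hv
  have hcv : cInf P ≤ v := by rw [hv]; nlinarith
  have hnum : 36 * s * m + 648 * cInf P ^ 2 + 28 * s ^ 2 ≤ 2952 * v ^ 2 := by
    have h1 : s * m ≤ (6 * v) * (6 * v) := mul_le_mul hs1 hm hm0.le (by positivity)
    have h2 : s ^ 2 ≤ (6 * v) ^ 2 := pow_le_pow_left₀ hs0.le hs1 2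
    have h3 : cInf P ^ 2 ≤ v ^ 2 := pow_le_pow_left₀ hc.le hcv 2
    nlinarith
  have h5 : (36 * s * m + 648 * cInf P ^ 2 + 28 * s ^ 2) / (eta P ε * ε)
      ≤ 8856 * (logDim n N * q ^ 2) * (cInf P ^ 2 / ε ^ 2) := by
    calc _ ≤ 2952 * v ^ 2 / (eta P ε * ε) := div_le_div_of_nonneg_right hnum (by positivity)
      _ = _ := by rw [heta, hv]; field_simp; ring
  have h6 : 1 ≤ logDim n N * q ^ 2 := one_le_mul_of_one_le_of_one_le hL (one_le_pow₀ hq1)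
  have h7 : 1 ≤ cInf P ^ 2 / ε ^ 2 := by
    rw [one_le_div (by positivity)]; exact pow_le_pow_left₀ hε.le hεc 2
  have h8 := one_le_mul_of_one_le_of_one_le h6 h7
  nlinarith

end IterBound

end EOT

namespace EOT

variable {n N : ℕ}

/-! ### Potentials with value `-∞` and reduction to the semi-dual -/

section Extended

theorem ereal_coe_sum {ι : Type*} (s : Finset ι) (x : ι → ℝ) :
    ∑ i ∈ s, (x i : EReal) = ((∑ i ∈ s, x i : ℝ) : EReal) := by
  classical
  induction s using Finset.induction_on with
  | empty => simp
  | insert i s hi ih => rw [Finset.sum_insert hi, Finset.sum_insert hi, ih, EReal.coe_add]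

theorem xexp_coe (x : ℝ) : xexp x = Real.exp x := by
  rw [xexp, EReal.exp_coe, ENNReal.toReal_ofReal (Real.exp_pos _).le]

theorem xexp_bot : xexp ⊥ = 0 := by simp [xexp]

theorem xlog_zero : xlog 0 = ⊥ := by simp [xlog]

theorem xlog_of_pos {x : ℝ} (hx : 0 < x) : xlog x = (Real.log x : EReal) := by
  rw [xlog, ENNReal.log_ofReal_of_pos hx]

variable {P : Problem n N} {η : ℝ}

theorem zeta_of_coe {f : Fin n → EReal} {i : Fin n} {x : ℝ} (hf : f i = x) (g : Fin n → ℝ)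
    (lam : Fin N → ℝ) (k : Fin N) (j : Fin n) :
    zeta P η f g lam k i j = Real.exp (x / η) * kern P η g lam k i j := by
  simp only [zeta, hf]
  rw [← EReal.coe_add, ← EReal.coe_sub, ← EReal.coe_div, xexp_coe, kern, ← Real.exp_add]
  congr 1
  ring

theorem zeta_of_bot (hη : 0 < η) {f : Fin n → EReal} {i : Fin n} (hf : f i = ⊥) (g : Fin n → ℝ)
    (lam : Fin N → ℝ) (k : Fin N) (j : Fin n) :
    zeta P η f g lam k i j = 0 := by
  simp only [zeta, hf]
  rw [EReal.bot_add, EReal.bot_sub, EReal.bot_div_of_pos_ne_top (by exact_mod_cast hη)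
    (EReal.coe_ne_top _), xexp_bot]

/-- The maximizer of the dual objective in `f`. -/
noncomputable def fOpt (P : Problem n N) (η : ℝ) (g : Fin n → ℝ) (lam : Fin N → ℝ)
    (i : Fin n) : EReal :=
  (η : EReal) * xlog (P.a i / rowKern P η g lam i)

theorem fOpt_of_zero (hη : 0 < η) (g : Fin n → ℝ) (lam : Fin N → ℝ) {i : Fin n}
    (hi : P.a i = 0) : fOpt P η g lam i = ⊥ := by
  rw [fOpt, hi, zero_div, xlog_zero, EReal.coe_mul_bot_of_pos hη]

theorem fOpt_of_pos (hP : P.Admissible) (g : Fin n → ℝ) (lam : Fin N → ℝ) {i : Fin n}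
    (hi : 0 < P.a i) :
    fOpt P η g lam i = ((η * Real.log (P.a i / rowKern P η g lam i) : ℝ) : EReal) := by
  rw [fOpt, xlog_of_pos (div_pos hi (rowKern_pos hP i)), EReal.coe_mul]

theorem zeta_fOpt (hP : P.Admissible) (hη : 0 < η) (g g' : Fin n → ℝ) (lam lam' : Fin N → ℝ)
    (k : Fin N) (i j : Fin n) :
    zeta P η (fOpt P η g lam) g' lam' k i j
      = P.a i / rowKern P η g lam i * kern P η g' lam' k i j := by
  rcases (hP.a_mem.1 i).eq_or_lt with h | h
  · rw [zeta_of_bot hη (fOpt_of_zero hη g lam h.symm), ← h, zero_div, zero_mul]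
  · rw [zeta_of_coe (fOpt_of_pos hP g lam h), mul_div_cancel_left₀ _ hη.ne',
      Real.exp_log (div_pos h (rowKern_pos hP i))]

theorem zeta_fOpt_self (hP : P.Admissible) (hη : 0 < η) (g : Fin n → ℝ) (lam : Fin N → ℝ) :
    zeta P η (fOpt P η g lam) g lam = sPlan P η g lam := by
  funext k i j
  rw [zeta_fOpt hP hη, sPlan]

theorem plan_fOpt_self (hP : P.Admissible) (hη : 0 < η) (g : Fin n → ℝ) (lam : Fin N → ℝ) :
    plan P η (fOpt P η g lam) g lam = sPlan P η g lam := by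
  funext k i j
  rw [plan, zeta_fOpt_self hP hη, mass_sPlan hP, div_one]

theorem kern_gNext (hP : P.Admissible) (hη : 0 < η) (g : Fin n → ℝ) (lam : Fin N → ℝ)
    (k : Fin N) (i j : Fin n) :
    kern P η (gNext P η g lam) lam k i j
      = kern P η g lam k i j * (P.b j / sCol P η g lam j) := by
  rw [kern_eq_mul (g := g) (lam := lam), gNext, sub_self, zero_mul, sub_zero, add_sub_cancel_left,
    mul_div_cancel_left₀ _ hη.ne', Real.exp_log (div_pos (hP.b_pos j) (sCol_pos hP j))]

theorem plan_fOpt_gNext (hP : P.Admissible) (hη : 0 < η) (g : Fin n → ℝ) (lam : Fin N → ℝ) :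
    plan P η (fOpt P η g lam) (gNext P η g lam) lam = gPlan P η g lam := by
  have h : zeta P η (fOpt P η g lam) (gNext P η g lam) lam = gPlan P η g lam := by
    funext k i j
    rw [zeta_fOpt hP hη, kern_gNext hP hη, gPlan, sPlan, mul_assoc]
  funext k i j
  rw [plan, h, mass_gPlan hP, div_one]

theorem rowSum_total_zeta {f : Fin n → EReal} {i : Fin n} {x : ℝ} (hf : f i = x)
    (g : Fin n → ℝ) (lam : Fin N → ℝ) :
    rowSum (total (zeta P η f g lam)) i = Real.exp (x / η) * rowKern P η g lam i := by
  simp only [rowSum, total, zeta_of_coe hf, rowKern, Fintype.sum_prod_type, Finset.mul_sum]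
  exact Finset.sum_comm

/-- The row sum contains the factor `exp (f i / η)`, so the old `f i` cancels. Where `a i = 0` the
update adds `⊥`, which absorbs any `f i`. -/
theorem updateF_eq_fOpt (hP : P.Admissible) (hη : 0 < η) {f : Fin n → EReal}
    (hf : ∀ i, 0 < P.a i → ∃ x : ℝ, f i = x) (g : Fin n → ℝ) (lam : Fin N → ℝ) :
    updateF P η f g lam = fOpt P η g lam := by
  funext i
  rw [updateF]
  rcases (hP.a_mem.1 i).eq_or_lt with h | h
  · rw [← h, zero_div, xlog_zero, EReal.coe_mul_bot_of_pos hη, EReal.add_bot,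
      fOpt_of_zero hη g lam h.symm]
  · obtain ⟨x, hx⟩ := hf i h
    have hK := rowKern_pos (η := η) (g := g) (lam := lam) hP i
    rw [rowSum_total_zeta hx, hx, xlog_of_pos (by positivity), fOpt_of_pos hP g lam h,
      ← EReal.coe_mul, ← EReal.coe_add]
    congr 1
    rw [Real.log_div h.ne' (by positivity), Real.log_mul (Real.exp_pos _).ne' hK.ne',
      Real.log_exp, Real.log_div h.ne' hK.ne']
    field_simp
    ring

theorem updateG_eq_gNext (hP : P.Admissible) (hη : 0 < η) (g : Fin n → ℝ) (lam : Fin N → ℝ) :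
    updateG P η (fOpt P η g lam) g lam = gNext P η g lam := by
  funext j
  rw [updateG, zeta_fOpt_self hP hη, gNext, sCol]

theorem updateLam_eq_lamNext (hP : P.Admissible) (hη : 0 < η) (τ : ℝ) (g : Fin n → ℝ)
    (lam : Fin N → ℝ) :
    updateLam P η τ (fOpt P η g lam) (gNext P η g lam) lam = lamNext P η τ g lam := by
  simp only [updateLam, lamNext, gradLam, plan_fOpt_gNext hP hη]

theorem dualF_fOpt (hP : P.Admissible) (hη : 0 < η) (g : Fin n → ℝ) (lam : Fin N → ℝ) :
    dualF P η (fOpt P η g lam) g lam = (semiDual P η g lam : EReal) := by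
  have h : ∀ i, fOpt P η g lam i * (P.a i : EReal)
      = ((η * (P.a i * (Real.log (P.a i) - Real.log (rowKern P η g lam i))) : ℝ) : EReal) :=
    fun i => by
      rcases (hP.a_mem.1 i).eq_or_lt with h | h
      · rw [← h]; simp
      · rw [fOpt_of_pos hP g lam h, ← EReal.coe_mul,
          Real.log_div h.ne' (rowKern_pos hP i).ne']
        congr 1
        ring
  rw [dualF, zeta_fOpt_self hP hη, mass_sPlan hP, Finset.sum_congr rfl fun i _ => h i,
    ereal_coe_sum, xlog_of_pos one_pos, Real.log_one, ← EReal.coe_mul, ← EReal.coe_add,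
    ← EReal.coe_sub, ← EReal.coe_sub, semiDual, Finset.mul_sum]
  congr 1
  ring

theorem mass_zeta_coe (f g : Fin n → ℝ) (lam : Fin N → ℝ) :
    mass (zeta P η (fun i => (f i : EReal)) g lam)
      = ∑ i, Real.exp (f i / η) * rowKern P η g lam i := by
  rw [mass_eq_sum_rowSum]
  exact Finset.sum_congr rfl fun i _ => rowSum_total_zeta rfl g lam

theorem dualF_coe_eq (hP : P.Admissible) (f g : Fin n → ℝ) (lam : Fin N → ℝ) :
    dualF P η (fun i => (f i : EReal)) g lam
      = ((∑ i, f i * P.a i + ∑ j, g j * P.b j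
          - η * Real.log (∑ i, Real.exp (f i / η) * rowKern P η g lam i) - η : ℝ) : EReal) := by
  rw [dualF_coe P η f g lam ⟨0, hP.pos_N⟩ ⟨0, hP.pos_n⟩, mass_zeta_coe]

/-- Jensen with weights `a`, applied to `f / η + log rowKern - log a`. Rows with `a i = 0` only
enlarge the total mass, which lowers the left side. -/
theorem dualF_coe_le_semiDual (hP : P.Admissible) (hη : 0 < η) (f g : Fin n → ℝ)
    (lam : Fin N → ℝ) :
    dualF P η (fun i => (f i : EReal)) g lam ≤ (semiDual P η g lam : EReal) := by
  rw [dualF_coe_eq hP, EReal.coe_le_coe_iff, semiDual]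
  have h1 := sum_mul_le_log_sum_mul_exp hP.a_mem.1 hP.a_mem.2
    fun i => f i / η + Real.log (rowKern P η g lam i) - Real.log (P.a i)
  have hpos := sum_mul_exp_pos hP.a_mem.1 hP.a_mem.2
    fun i => f i / η + Real.log (rowKern P η g lam i) - Real.log (P.a i)
  have h2 : ∑ i, P.a i * Real.exp (f i / η + Real.log (rowKern P η g lam i) - Real.log (P.a i))
      ≤ ∑ i, Real.exp (f i / η) * rowKern P η g lam i := by
    refine Finset.sum_le_sum fun i _ => ?_
    have hK := rowKern_pos (η := η) (g := g) (lam := lam) hP i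
    rcases (hP.a_mem.1 i).eq_or_lt with h | h
    · rw [← h, zero_mul]; positivity
    · rw [Real.exp_sub, Real.exp_add, Real.exp_log hK, Real.exp_log h,
        mul_div_cancel₀ _ h.ne']
  have h3 := mul_le_mul_of_nonneg_left (h1.trans (Real.log_le_log hpos h2)) hη.le
  have h4 : η * ∑ i, P.a i * (f i / η + Real.log (rowKern P η g lam i) - Real.log (P.a i))
      = ∑ i, f i * P.a i
        - η * ∑ i, P.a i * (Real.log (P.a i) - Real.log (rowKern P η g lam i)) := by
    rw [Finset.mul_sum, Finset.mul_sum, ← Finset.sum_sub_distrib]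
    refine Finset.sum_congr rfl fun i _ => ?_
    field_simp
    ring
  linarith

/-- Where `a i = 0` the maximizer is `-∞`. Using `s = δ / (η n)` in place of `a i` there keeps `f`
real and adds at most `n s` to the mass, so the value drops by at most `η n s = δ`. -/
theorem exists_dualF_coe_ge (hP : P.Admissible) (hη : 0 < η) (g : Fin n → ℝ) (lam : Fin N → ℝ)
    {δ : ℝ} (hδ : 0 < δ) :
    ∃ f : Fin n → ℝ, ((semiDual P η g lam - δ : ℝ) : EReal)
      ≤ dualF P η (fun i => (f i : EReal)) g lam := by
  have hn : (0 : ℝ) < n := by exact_mod_cast hP.pos_n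
  set s := δ / (η * n) with hs
  have hs0 : 0 < s := by positivity
  set u : Fin n → ℝ := fun i => if P.a i = 0 then s else P.a i with hu
  have hu0 : ∀ i, 0 < u i := fun i => by
    rw [hu]
    dsimp only
    split_ifs with h
    · exact hs0
    · exact lt_of_le_of_ne (hP.a_mem.1 i) (Ne.symm h)
  have hK : ∀ i, 0 < rowKern P η g lam i := rowKern_pos hP
  refine ⟨fun i => η * Real.log (u i / rowKern P η g lam i), ?_⟩
  rw [dualF_coe_eq hP, EReal.coe_le_coe_iff, semiDual]
  have h1 : ∑ i, Real.exp (η * Real.log (u i / rowKern P η g lam i) / η) * rowKern P η g lam i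
      = ∑ i, u i := by
    refine Finset.sum_congr rfl fun i _ => ?_
    rw [mul_div_cancel_left₀ _ hη.ne', Real.exp_log (div_pos (hu0 i) (hK i)),
      div_mul_cancel₀ _ (hK i).ne']
  have h2 : ∑ i, u i ≤ 1 + n * s := by
    calc ∑ i, u i ≤ ∑ i, (P.a i + s) := Finset.sum_le_sum fun i _ => by
          rw [hu]
          dsimp only
          split_ifs with h
          · rw [h, zero_add]
          · linarith
      _ = 1 + n * s := by rw [Finset.sum_add_distrib, hP.a_mem.2]; simp
  have hsum : 0 < ∑ i, u i := by
    have : Nonempty (Fin n) := ⟨⟨0, hP.pos_n⟩⟩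
    exact Finset.sum_pos (fun i _ => hu0 i) Finset.univ_nonempty
  have h3 : η * Real.log (∑ i, u i) ≤ δ := by
    have h4 := Real.log_le_sub_one_of_pos hsum
    have h5 : η * (n * s) = δ := by rw [hs]; field_simp
    rw [← h5]
    exact mul_le_mul_of_nonneg_left (by linarith) hη.le
  have h6 : ∑ i, η * Real.log (u i / rowKern P η g lam i) * P.a i
      = η * ∑ i, P.a i * (Real.log (P.a i) - Real.log (rowKern P η g lam i)) := by
    rw [Finset.mul_sum]
    refine Finset.sum_congr rfl fun i _ => ?_
    by_cases h : P.a i = 0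
    · rw [h]; ring
    · rw [hu]
      dsimp only
      rw [if_neg h, Real.log_div h (hK i).ne']
      ring
  rw [h1, h6]
  linarith

/-- The dual optimal value is the supremum of the semi-dual objective. -/
theorem exists_dualOpt_eq (hP : P.Admissible) (hη : 0 < η) (hηc : η ≤ cInf P) :
    ∃ Fs : ℝ, dualOpt P η = (Fs : EReal) ∧
      (∀ g, ∀ lam ∈ stdSimplex ℝ (Fin N), semiDual P η g lam ≤ Fs) ∧
      ∀ B : ℝ, (∀ g, ∀ lam ∈ stdSimplex ℝ (Fin N), semiDual P η g lam ≤ B) → Fs ≤ B := by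
  have hup : ∀ B : ℝ, (∀ g, ∀ lam ∈ stdSimplex ℝ (Fin N), semiDual P η g lam ≤ B) →
      dualOpt P η ≤ (B : EReal) := fun B hB =>
    iSup_le fun f => iSup_le fun g => iSup_le fun lam =>
      (dualF_coe_le_semiDual hP hη f g lam).trans (EReal.coe_le_coe_iff.2 (hB g lam lam.2))
  have hlow : ∀ g, ∀ lam ∈ stdSimplex ℝ (Fin N), ∀ δ > 0,
      ((semiDual P η g lam - δ : ℝ) : EReal) ≤ dualOpt P η := fun g lam hlam δ hδ => by
    obtain ⟨f, hf⟩ := exists_dualF_coe_ge hP hη g lam hδ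
    exact hf.trans (le_iSup_of_le f (le_iSup_of_le g (le_iSup_of_le ⟨lam, hlam⟩ le_rfl)))
  have hlam₀ : Pi.single (⟨0, hP.pos_N⟩ : Fin N) (1 : ℝ) ∈ stdSimplex ℝ (Fin N) :=
    single_mem_stdSimplex ℝ _
  have hcent : Centered (2 * cInf P - η * iota P) (fun _ : Fin n => (0 : ℝ)) :=
    ⟨0, fun j => by
      simp only [sub_zero, abs_zero]
      have := cInf_pos hP
      have := mul_nonneg hη.le (neg_nonneg.2 (iota_nonpos hP))
      linarith⟩
  -- The gap estimate at `g = 0` bounds the supremum from above, so that it is a real number.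
  have hB := hup _ fun g lam hlam => semiDual_le_of_centered hP hη hηc hcent hlam₀ g hlam
  have hbot : dualOpt P η ≠ ⊥ := fun h => by
    have h1 := hlow (fun _ => 0) _ hlam₀ 1 one_pos
    rw [h, le_bot_iff] at h1
    exact EReal.coe_ne_bot _ h1
  have htop : dualOpt P η ≠ ⊤ := fun h => by
    rw [h, top_le_iff] at hB
    exact EReal.coe_ne_top _ hB
  have hFs := EReal.coe_toReal htop hbot
  refine ⟨(dualOpt P η).toReal, hFs.symm, fun g lam hlam => ?_, fun B hB => ?_⟩
  · refine le_of_forall_pos_le_add fun δ hδ => ?_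
    have h1 := hlow g lam hlam δ hδ
    rw [← hFs, EReal.coe_le_coe_iff] at h1
    linarith
  · have h1 := hup B hB
    rwa [← hFs, EReal.coe_le_coe_iff] at h1

end Extended

/-! ### The PAM iterates and the stopping time -/

section Iterates

variable {P : Problem n N} {ε : ℝ}

theorem pam_f_coe (hP : P.Admissible) (hε : 0 < ε) (t : ℕ) :
    ∀ i, 0 < P.a i → ∃ x : ℝ, (pam P ε t).f i = x := by
  induction t with
  | zero => exact fun i _ => ⟨1, rfl⟩
  | succ t ih =>
    intro i hi
    exact ⟨_, (congrFun (updateF_eq_fOpt hP (eta_pos hP hε) ih _ _) i).trans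
      (fOpt_of_pos hP _ _ hi)⟩

theorem pam_succ_f (hP : P.Admissible) (hε : 0 < ε) (t : ℕ) :
    (pam P ε (t + 1)).f = fOpt P (eta P ε) (pam P ε t).g (pam P ε t).lam :=
  updateF_eq_fOpt hP (eta_pos hP hε) (pam_f_coe hP hε t) _ _

theorem pam_succ_g (hP : P.Admissible) (hε : 0 < ε) (t : ℕ) :
    (pam P ε (t + 1)).g = gNext P (eta P ε) (pam P ε t).g (pam P ε t).lam := by
  change updateG P (eta P ε) (pam P ε (t + 1)).f (pam P ε t).g (pam P ε t).lam = _
  rw [pam_succ_f hP hε, updateG_eq_gNext hP (eta_pos hP hε)]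

theorem pam_succ_lam (hP : P.Admissible) (hε : 0 < ε) (t : ℕ) :
    (pam P ε (t + 1)).lam = lamNext P (eta P ε) (tau P ε) (pam P ε t).g (pam P ε t).lam := by
  change updateLam P (eta P ε) (tau P ε) (pam P ε (t + 1)).f (pam P ε (t + 1)).g
    (pam P ε t).lam = _
  rw [pam_succ_f hP hε, pam_succ_g hP hε, updateLam_eq_lamNext hP (eta_pos hP hε)]

theorem pam_lam_mem (hP : P.Admissible) (hε : 0 < ε) (t : ℕ) :
    (pam P ε t).lam ∈ stdSimplex ℝ (Fin N) := by
  cases t with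
  | zero =>
    have hN : (N : ℝ) ≠ 0 := by exact_mod_cast hP.pos_N.ne'
    refine ⟨fun k => by simp only [pam]; positivity, ?_⟩
    simp [pam, hN]
  | succ t =>
    rw [pam_succ_lam hP hε]
    exact lamNext_mem hP _

theorem pam_g_centered (hP : P.Admissible) (hε : 0 < ε) (t : ℕ) :
    Centered (2 * cInf P - eta P ε * iota P) (pam P ε t).g := by
  cases t with
  | zero =>
    refine ⟨1, fun j => ?_⟩
    have := cInf_pos hP
    have := mul_nonneg (eta_pos hP hε).le (neg_nonneg.2 (iota_nonpos hP))
    simp only [pam, sub_self, abs_zero]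
    linarith
  | succ t =>
    rw [pam_succ_g hP hε]
    exact centered_gNext hP (eta_pos hP hε) (pam_lam_mem hP hε t)

/-- The test at pass `t + 1` uses the new `f` with the old `g` and `λ`; that `f` is their maximizer,
so the tested plan has row sums exactly `a`. -/
theorem lastPlan_succ (hP : P.Admissible) (hε : 0 < ε) (t : ℕ) :
    lastPlan P ε (t + 1) = sPlan P (eta P ε) (pam P ε t).g (pam P ε t).lam := by
  rw [lastPlan, pam_succ_f hP hε, Nat.add_sub_cancel, plan_fOpt_self hP (eta_pos hP hε)]

/-- The stopping conditions are met within the claimed number of iterations. -/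
theorem exists_stops (hP : P.Admissible) (hε : 0 < ε) :
    ∃ T : ℕ, 1 ≤ T ∧ (T : ℝ) ≤ iterBound P ε ∧ Stops P ε T := by
  have hη := eta_pos hP hε
  have hηc := eta_le_cInf P ε
  have hc := cInf_pos hP
  have hηι := mul_nonneg hη.le (neg_nonneg.2 (iota_nonpos hP))
  obtain ⟨Fs, hFs, hFle, hFmin⟩ := exists_dualOpt_eq hP hη hηc
  set R := 2 * cInf P - eta P ε * iota P with hR
  set m := 6 * cInf P - eta P ε * iota P with hm
  have hm0 : 0 < m := by linarith
  set s := max R (3 * cInf P) with hs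
  have hs0 : 0 < s := lt_max_of_lt_right (by linarith)
  set D : ℕ → ℝ := fun t => Fs - semiDual P (eta P ε) (pam P ε t).g (pam P ε t).lam with hD
  set x : ℕ → ℝ := fun t => l1 (sCol P (eta P ε) (pam P ε t).g (pam P ε t).lam - P.b) with hx
  set y : ℕ → ℝ := fun t => l2 ((pam P ε (t + 1)).lam - (pam P ε t).lam) with hy
  have hτ : tau P ε = eta P ε / (cInf P * cInf P) := rfl
  have hy' : ∀ t, y t = l2 (lamNext P (eta P ε) (eta P ε / (cInf P * cInf P)) (pam P ε t).g
      (pam P ε t).lam - (pam P ε t).lam) := fun t => by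
    rw [hy]; dsimp only; rw [pam_succ_lam hP hε, hτ]
  have hx0 : ∀ t, 0 ≤ x t := fun t => l1_nonneg _
  have hy0 : ∀ t, 0 ≤ y t := fun t => l2_nonneg _
  obtain ⟨t, ht, hDt, hxt, hzt⟩ := exists_index_small (D := D) (x := x)
    (z := fun t => cInf P / eta P ε * y t) (q := epsPrime P ε / 6) hη hs0 hε
    (by rw [epsPrime]; positivity)
    (fun t => sub_nonneg.2 (hFle _ _ (pam_lam_mem hP hε t)))
    (fun t => by
      have h1 := hFmin _ fun g lam hlam => semiDual_le_of_centered hP hη hηc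
        (pam_g_centered hP hε t) (pam_lam_mem hP hε t) g hlam
      rw [← hy'] at h1
      -- From `R ≤ s` and `c_∞ ≤ s / 3`; this is the 4/3 of the gap estimate.
      have h2 : R + cInf P ≤ 4 / 3 * s := by
        linarith [le_max_left R (3 * cInf P), le_max_right R (3 * cInf P)]
      have h3 := mul_le_mul_of_nonneg_right h2 (hx0 t)
      have h4 : 3 * cInf P ^ 2 / eta P ε * y t ≤ s * (cInf P / eta P ε * y t) := by
        have h5 : 0 ≤ cInf P / eta P ε * y t := mul_nonneg (by positivity) (hy0 t)
        have h6 := mul_le_mul_of_nonneg_right (le_max_right R (3 * cInf P)) h5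
        refine le_trans (le_of_eq ?_) h6
        ring
      simp only [hD]
      simp only [hx] at h3 ⊢
      linarith)
    (fun t => by
      have h1 := semiDual_step_ge (g := (pam P ε t).g) hP hη (pam_lam_mem hP hε t)
      rw [← hy', ← hτ, ← pam_succ_g hP hε, ← pam_succ_lam hP hε] at h1
      simp only [hD, hx]
      linarith)
  refine ⟨t + 1, by omega, ?_, ?_, ?_, ?_⟩
  · push_cast
    exact ht.trans (index_bound_le_iterBound hP hε)
  · rw [lastPlan_succ hP hε]
    refine hxt.trans (le_of_eq ?_)
    rw [epsPrime, div_div, mul_comm m 6]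
  · rw [Nat.add_sub_cancel]
    change y t ≤ _
    -- Since `m ≥ 6 c_∞`, the bound `z ≤ ε' / 6` is stronger than the second stopping condition by
    -- at least a factor 2.
    have h1 : epsPrime P ε / 6 ≤ ε / (18 * cInf P) := by
      rw [epsPrime, div_div]
      exact div_le_div_of_nonneg_left hε.le (by positivity) (by linarith)
    have h2 : cInf P / eta P ε * y t ≤ ε / (18 * cInf P) := hzt.trans h1
    calc y t = eta P ε / cInf P * (cInf P / eta P ε * y t) := by field_simp
      _ ≤ eta P ε / cInf P * (ε / (18 * cInf P)) :=
        mul_le_mul_of_nonneg_left h2 (by positivity)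
      _ = _ := by field_simp
  · rw [hFs, pam_succ_f hP hε, Nat.add_sub_cancel, dualF_fOpt hP hη, ← EReal.coe_sub,
      EReal.coe_le_coe_iff]
    exact hDt

end Iterates

end EOT

namespace EOT

variable {n N : ℕ}

/-! ### Rounding to prescribed margins -/

section Rounding

theorem eq_zero_of_rowSum_eq_zero {π : Fin n → Fin n → ℝ} (hπ : ∀ i j, 0 ≤ π i j) {i : Fin n}
    (h : rowSum π i = 0) (j : Fin n) : π i j = 0 :=
  (Finset.sum_eq_zero_iff_of_nonneg fun j _ => hπ i j).1 h j (Finset.mem_univ j)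

theorem sum_rowSum_eq_sum_colSum (π : Fin n → Fin n → ℝ) :
    ∑ i, rowSum π i = ∑ j, colSum π j := Finset.sum_comm

/-- The rounding of a matrix with the row sums kept and the column sums prescribed. -/
theorem roundPlan_spec {π : Fin n → Fin n → ℝ} (hπ : ∀ i j, 0 ≤ π i j) {b : Fin n → ℝ}
    (hb : ∀ j, 0 ≤ b j) (hab : ∑ i, rowSum π i = ∑ j, b j) :
    (∀ i j, 0 ≤ roundPlan π (rowSum π) b i j) ∧
    rowSum (roundPlan π (rowSum π) b) = rowSum π ∧
    colSum (roundPlan π (rowSum π) b) = b ∧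
    ∑ i, ∑ j, |roundPlan π (rowSum π) b i j - π i j| ≤ ∑ j, |b j - colSum π j| := by
  have hcol0 : ∀ j, 0 ≤ colSum π j := fun j => Finset.sum_nonneg fun i _ => hπ i j
  -- The row scaling does nothing, since the row margins are the row sums of `π`; where `0 / 0 = 0`
  -- occurs, the whole row vanishes.
  have h1 : ∀ i j, min (rowSum π i / rowSum π i) 1 * π i j = π i j := fun i j => by
    by_cases h : rowSum π i = 0
    · rw [eq_zero_of_rowSum_eq_zero hπ h j, mul_zero]
    · rw [div_self h, min_self, one_mul]
  set y : Fin n → ℝ := fun j => min (b j / colSum π j) 1 with hy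
  have hy0 : ∀ j, 0 ≤ y j := fun j => le_min (div_nonneg (hb j) (hcol0 j)) zero_le_one
  have hy1 : ∀ j, y j ≤ 1 := fun j => min_le_right _ _
  set π₂ : Fin n → Fin n → ℝ := fun i j => π i j * y j with hπ₂
  set u : Fin n → ℝ := fun i => rowSum π i - rowSum π₂ i with hu
  set v : Fin n → ℝ := fun j => b j - colSum π₂ j with hv
  have hround : roundPlan π (rowSum π) b = fun i j => π₂ i j + u i * v j / l1 u := by
    simp only [roundPlan, h1]
    rfl
  have hπ₂0 : ∀ i j, 0 ≤ π₂ i j := fun i j => mul_nonneg (hπ i j) (hy0 j)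
  have hπ₂le : ∀ i j, π₂ i j ≤ π i j := fun i j => mul_le_of_le_one_right (hπ i j) (hy1 j)
  have hcol₂ : ∀ j, colSum π₂ j = min (b j) (colSum π j) := fun j => by
    have h2 : colSum π₂ j = colSum π j * y j := by simp only [colSum, hπ₂, Finset.sum_mul]
    rw [h2, hy]
    dsimp only
    rcases (hcol0 j).eq_or_lt with h | h
    · rw [← h, zero_mul, min_eq_right (hb j)]
    · rw [mul_min_of_nonneg _ _ h.le, mul_div_cancel₀ _ h.ne', mul_one]
  have hu0 : ∀ i, 0 ≤ u i := fun i => sub_nonneg.2 (Finset.sum_le_sum fun j _ => hπ₂le i j)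
  have hv0 : ∀ j, 0 ≤ v j := fun j => sub_nonneg.2 (by rw [hcol₂]; exact min_le_left _ _)
  have hl1 : l1 u = ∑ i, u i := Finset.sum_congr rfl fun i _ => abs_of_nonneg (hu0 i)
  have huv : ∑ i, u i = ∑ j, v j := by
    simp only [hu, hv, Finset.sum_sub_distrib]
    rw [hab, sum_rowSum_eq_sum_colSum]
  have hsu0 : 0 ≤ ∑ i, u i := Finset.sum_nonneg fun i _ => hu0 i
  -- If the sum of `u` vanishes, so do `u` and `v`, and `x / 0 = 0` gives no correction.
  have hrow : ∀ i, ∑ j, u i * v j / l1 u = u i := fun i => by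
    rw [← Finset.sum_div, ← Finset.mul_sum, hl1, ← huv]
    by_cases h : ∑ i, u i = 0
    · rw [h, (Finset.sum_eq_zero_iff_of_nonneg fun i _ => hu0 i).1 h i (Finset.mem_univ i)]
      simp
    · rw [mul_div_cancel_right₀ _ h]
  have hcol : ∀ j, ∑ i, u i * v j / l1 u = v j := fun j => by
    rw [← Finset.sum_div, ← Finset.sum_mul, hl1]
    by_cases h : ∑ i, u i = 0
    · rw [h, (Finset.sum_eq_zero_iff_of_nonneg fun j _ => hv0 j).1 (huv ▸ h) j
        (Finset.mem_univ j)]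
      simp
    · rw [mul_div_cancel_left₀ _ h]
  have hnn : ∀ i j, 0 ≤ u i * v j / l1 u := fun i j =>
    div_nonneg (mul_nonneg (hu0 i) (hv0 j)) (l1_nonneg u)
  rw [hround]
  refine ⟨fun i j => add_nonneg (hπ₂0 i j) (hnn i j), ?_, ?_, ?_⟩
  · funext i
    simp only [rowSum, Finset.sum_add_distrib, hrow]
    simp only [hu, rowSum]
    ring
  · funext j
    simp only [colSum, Finset.sum_add_distrib, hcol]
    simp only [hv, colSum]
    ring
  · calc ∑ i, ∑ j, |π₂ i j + u i * v j / l1 u - π i j|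
        ≤ ∑ i, ∑ j, ((π i j - π₂ i j) + u i * v j / l1 u) := by
          refine Finset.sum_le_sum fun i _ => Finset.sum_le_sum fun j _ => ?_
          rw [abs_le]
          constructor <;> linarith [hπ₂le i j, hnn i j]
      _ = ∑ j, ((colSum π j - colSum π₂ j) + v j) := by
          rw [Finset.sum_comm]
          refine Finset.sum_congr rfl fun j _ => ?_
          rw [Finset.sum_add_distrib, hcol, Finset.sum_sub_distrib]
          rfl
      -- `colSum π₂ j` is the smaller of `b j` and `colSum π j`, so one of the two terms is zero and
      -- the other is the absolute difference.
      _ ≤ _ := by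
          refine Finset.sum_le_sum fun j _ => ?_
          simp only [hv]
          rw [hcol₂]
          rcases le_total (b j) (colSum π j) with h | h
          · rw [min_eq_left h, abs_of_nonpos (by linarith)]; linarith
          · rw [min_eq_right h, abs_of_nonneg (by linarith)]; linarith

/-- All entries share one sign. In each column of the margins this makes the errors of the agents
add up to the error of the total plan. -/
theorem sum_abs_eq_abs_sum_of_mul_nonneg {ι : Type*} [Fintype ι] {x : ι → ℝ}
    (h : ∀ k k', 0 ≤ x k * x k') : ∑ k, |x k| = |∑ k, x k| := by
  by_cases hp : ∃ k, 0 < x k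
  · obtain ⟨k, hk⟩ := hp
    have h0 : ∀ k', 0 ≤ x k' := fun k' => nonneg_of_mul_nonneg_right (h k k') hk
    rw [abs_of_nonneg (Finset.sum_nonneg fun k' _ => h0 k')]
    exact Finset.sum_congr rfl fun k' _ => abs_of_nonneg (h0 k')
  · push Not at hp
    rw [abs_of_nonpos (Finset.sum_nonpos fun k' _ => hp k'), ← Finset.sum_neg_distrib]
    exact Finset.sum_congr rfl fun k' _ => abs_of_nonpos (hp k')

/-- Rounding a family with admissible margins. -/
theorem round_family_spec {P : Problem n N} {π : Fin N → Fin n → Fin n → ℝ}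
    (hπ : ∀ k i j, 0 ≤ π k i j) (hrow : rowSum (total π) = P.a) {bk : Fin N → Fin n → ℝ}
    (hbk : IsMargins π P.b bk) :
    (fun k => roundPlan (π k) (rowSum (π k)) (bk k)) ∈ couplings P ∧
    ∑ p : Fin N × Fin n × Fin n,
      |roundPlan (π p.1) (rowSum (π p.1)) (bk p.1) p.2.1 p.2.2 - π p.1 p.2.1 p.2.2|
      ≤ l1 (colSum (total π) - P.b) := by
  obtain ⟨hb0, hbs, hbm, hsign⟩ := hbk
  have h := fun k => roundPlan_spec (hπ k) (hb0 k) (hbm k)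
  have hrt : ∀ (ρ : Fin N → Fin n → Fin n → ℝ) i, rowSum (total ρ) i = ∑ k, rowSum (ρ k) i :=
    fun ρ i => Finset.sum_comm
  have hct : ∀ (ρ : Fin N → Fin n → Fin n → ℝ) j, colSum (total ρ) j = ∑ k, colSum (ρ k) j :=
    fun ρ j => Finset.sum_comm
  refine ⟨⟨?_, ?_, fun k => (h k).1⟩, ?_⟩
  · rw [← hrow]
    funext i
    rw [hrt, hrt]
    exact Finset.sum_congr rfl fun k _ => congrFun (h k).2.1 i
  · funext j
    rw [hct, ← hbs j]
    exact Finset.sum_congr rfl fun k _ => congrFun (h k).2.2.1 j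
  · simp only [Fintype.sum_prod_type]
    refine (Finset.sum_le_sum fun k _ => (h k).2.2.2).trans (le_of_eq ?_)
    rw [Finset.sum_comm, l1]
    refine Finset.sum_congr rfl fun j _ => ?_
    rw [sum_abs_eq_abs_sum_of_mul_nonneg (hsign j), Finset.sum_sub_distrib, hbs, ← hct,
      Pi.sub_apply, abs_sub_comm]

end Rounding

/-! ### From the stopping conditions to ε-optimality -/

section Optimality

variable {P : Problem n N} {η : ℝ} {g : Fin n → ℝ} {lam : Fin N → ℝ}

/-- Since `λₖ Cᵏ = g - η log kern`, the linear cost is, for any `g`, a marginal term minus `η` times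
the pairing with the log-kernel. -/
theorem ell_eq_sub (hη : 0 < η) (g : Fin n → ℝ) (π : Fin N → Fin n → Fin n → ℝ)
    (lam : Fin N → ℝ) :
    ell P π lam = ∑ j, g j * colSum (total π) j
      - η * ∑ p : Fin N × Fin n × Fin n,
        π p.1 p.2.1 p.2.2 * Real.log (kern P η g lam p.1 p.2.1 p.2.2) := by
  rw [ell, ← sum_prod_mul_frob, ← sum_prod_mul_col, Finset.mul_sum, ← Finset.sum_sub_distrib]
  refine Finset.sum_congr rfl fun p _ => ?_
  rw [kern, Real.log_exp]
  field_simp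
  ring

/-- Each kernel entry is at most its row sum. -/
theorem sum_mul_log_kern_le {π : Fin N → Fin n → Fin n → ℝ}
    (hπ : ∀ k i j, 0 ≤ π k i j) (hrow : rowSum (total π) = P.a) :
    ∑ p : Fin N × Fin n × Fin n,
        π p.1 p.2.1 p.2.2 * Real.log (kern P η g lam p.1 p.2.1 p.2.2)
      ≤ ∑ i, Real.log (rowKern P η g lam i) * P.a i := by
  rw [← hrow, ← sum_prod_mul_row]
  refine Finset.sum_le_sum fun p _ => ?_
  rw [mul_comm]
  refine mul_le_mul_of_nonneg_right (Real.log_le_log (kern_pos ..) ?_) (hπ _ _ _)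
  exact Finset.single_le_sum (f := fun q : Fin N × Fin n => kern P η g lam q.1 p.2.1 q.2)
    (fun _ _ => (kern_pos ..).le) (Finset.mem_univ (p.1, p.2.2))

/-- A converse for the Gibbs plan: in each row the entropy of the Gibbs weights is at most `log (N
n)`, by Jensen. -/
theorem le_sum_sPlan_mul_log_kern (hP : P.Admissible) :
    ∑ i, Real.log (rowKern P η g lam i) * P.a i - Real.log (N * n)
      ≤ ∑ p : Fin N × Fin n × Fin n,
        sPlan P η g lam p.1 p.2.1 p.2.2 * Real.log (kern P η g lam p.1 p.2.1 p.2.2) := by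
  have hi : ∀ i, Real.log (rowKern P η g lam i) - Real.log (N * n)
      ≤ ∑ p : Fin N × Fin n, kern P η g lam p.1 i p.2 / rowKern P η g lam i
        * Real.log (kern P η g lam p.1 i p.2) := fun i => by
    have hK := rowKern_pos (η := η) (g := g) (lam := lam) hP i
    have h1 : ∑ p : Fin N × Fin n, kern P η g lam p.1 i p.2 / rowKern P η g lam i = 1 := by
      rw [← Finset.sum_div]; exact div_self hK.ne'
    have h2 := sum_mul_log_le (p := fun p : Fin N × Fin n =>
        kern P η g lam p.1 i p.2 / rowKern P η g lam i)
      (fun p => div_nonneg (kern_pos ..).le hK.le) h1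
      (x := fun p => rowKern P η g lam i / kern P η g lam p.1 i p.2)
      (fun p => div_pos hK (kern_pos ..))
    have h3 : ∑ p : Fin N × Fin n, kern P η g lam p.1 i p.2 / rowKern P η g lam i
        * (rowKern P η g lam i / kern P η g lam p.1 i p.2) = N * n := by
      rw [Finset.sum_congr rfl fun p _ => div_mul_div_cancel₀' (kern_pos P η g lam p.1 i p.2).ne'
        _ _]
      simp [div_self hK.ne']
    rw [h3] at h2
    have h4 : ∑ p : Fin N × Fin n, kern P η g lam p.1 i p.2 / rowKern P η g lam i
        * Real.log (rowKern P η g lam i / kern P η g lam p.1 i p.2)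
        = Real.log (rowKern P η g lam i)
          - ∑ p : Fin N × Fin n, kern P η g lam p.1 i p.2 / rowKern P η g lam i
            * Real.log (kern P η g lam p.1 i p.2) := by
      simp only [fun p : Fin N × Fin n => Real.log_div hK.ne' (kern_pos P η g lam p.1 i p.2).ne',
        mul_sub, Finset.sum_sub_distrib, ← Finset.sum_mul, h1, one_mul]
    linarith
  have hsum : ∑ p : Fin N × Fin n × Fin n,
        sPlan P η g lam p.1 p.2.1 p.2.2 * Real.log (kern P η g lam p.1 p.2.1 p.2.2)
      = ∑ i, P.a i * ∑ p : Fin N × Fin n, kern P η g lam p.1 i p.2 / rowKern P η g lam i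
        * Real.log (kern P η g lam p.1 i p.2) := by
    simp only [Finset.mul_sum, Fintype.sum_prod_type]
    rw [Finset.sum_comm]
    refine Finset.sum_congr rfl fun k _ => Finset.sum_congr rfl fun i _ =>
      Finset.sum_congr rfl fun j _ => ?_
    rw [sPlan]
    ring
  rw [hsum]
  calc _ = ∑ i, P.a i * (Real.log (rowKern P η g lam i) - Real.log (N * n)) := by
        simp only [mul_sub, Finset.sum_sub_distrib, ← Finset.sum_mul, hP.a_mem.2, one_mul]
        congr 1
        exact Finset.sum_congr rfl fun i _ => mul_comm _ _
    _ ≤ _ := Finset.sum_le_sum fun i _ => mul_le_mul_of_nonneg_left (hi i) (hP.a_mem.1 i)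

/-- Near-optimality of the entropic plan for the linear objective. -/
theorem ell_sPlan_le (hP : P.Admissible) (hη : 0 < η) {π : Fin N → Fin n → Fin n → ℝ}
    (hπ : π ∈ couplings P) :
    ell P (sPlan P η g lam) lam ≤ ell P π lam + ∑ j, g j * (sCol P η g lam - P.b) j
      + η * logDim n N := by
  obtain ⟨hrow, hcol, h0⟩ := hπ
  rw [ell_eq_sub hη g, ell_eq_sub hη g, hcol]
  have h1 := mul_le_mul_of_nonneg_left
    (sum_mul_log_kern_le (η := η) (g := g) (lam := lam) h0 hrow) hη.le
  have h2 := mul_le_mul_of_nonneg_left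
    (le_sum_sPlan_mul_log_kern (η := η) (g := g) (lam := lam) hP) hη.le
  have h3 : η * Real.log (N * n) ≤ η * logDim n N := by
    have hn : (1 : ℝ) ≤ n := by exact_mod_cast hP.pos_n
    have hN : (1 : ℝ) ≤ N := by exact_mod_cast hP.pos_N
    refine mul_le_mul_of_nonneg_left ?_ hη.le
    have : Real.log ((N : ℝ) * n) ≤ Real.log ((n : ℝ) * n * N) := by
      refine Real.log_le_log (by positivity) ?_
      nlinarith [mul_le_mul_of_nonneg_right hn (by positivity : (0 : ℝ) ≤ n * N)]
    rw [logDim]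
    linarith
  have h4 : ∑ j, g j * (sCol P η g lam - P.b) j
      = ∑ j, g j * colSum (total (sPlan P η g lam)) j - ∑ j, g j * P.b j := by
    rw [← Finset.sum_sub_distrib]
    exact Finset.sum_congr rfl fun j _ => mul_sub _ _ _
  rw [h4]
  linarith

theorem continuous_ell_right (P : Problem n N) (π : Fin N → Fin n → Fin n → ℝ) :
    Continuous fun lam => ell P π lam := by
  unfold ell
  fun_prop

theorem continuous_ell_left (P : Problem n N) (lam : Fin N → ℝ) :
    Continuous fun π : Fin N → Fin n → Fin n → ℝ => ell P π lam := by
  unfold ell frob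
  fun_prop

theorem isCompact_couplings (P : Problem n N) : IsCompact (couplings P) := by
  refine IsCompact.of_isClosed_subset (isCompact_Icc (a := (0 : Fin N → Fin n → Fin n → ℝ))
    (b := fun _ i _ => P.a i)) ?_ ?_
  · have e : couplings P = {π | rowSum (total π) = P.a} ∩ ({π | colSum (total π) = P.b}
        ∩ ⋂ k, ⋂ i, ⋂ j, {π | 0 ≤ π k i j}) := by
      ext π
      simp [couplings]
    rw [e]
    refine (isClosed_eq ?_ continuous_const).inter ((isClosed_eq ?_ continuous_const).inter ?_)
    · unfold rowSum total; fun_prop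
    · unfold colSum total; fun_prop
    · exact isClosed_iInter fun k => isClosed_iInter fun i => isClosed_iInter fun j =>
        isClosed_le continuous_const (by fun_prop)
  · rintro π ⟨hrow, -, h0⟩
    refine ⟨fun k i j => h0 k i j, fun k i j => ?_⟩
    rw [← hrow]
    calc π k i j ≤ total π i j :=
          Finset.single_le_sum (f := fun k => π k i j) (fun k _ => h0 k i j) (Finset.mem_univ k)
      _ ≤ rowSum (total π) i :=
          Finset.single_le_sum (f := fun j => total π i j)
            (fun j _ => Finset.sum_nonneg fun k _ => h0 k i j) (Finset.mem_univ j)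

theorem isEpsOptimal_of_forall {ε : ℝ} {π : Fin N → Fin n → Fin n → ℝ} (hπ : π ∈ couplings P)
    (hlam : lam ∈ stdSimplex ℝ (Fin N))
    (h : ∀ w ∈ stdSimplex ℝ (Fin N), ∀ π' ∈ couplings P, ell P π w - ell P π' lam ≤ ε) :
    IsEpsOptimal P ε π lam := by
  obtain ⟨M, hM⟩ := ((isCompact_stdSimplex ℝ (Fin N)).image
    (continuous_ell_right P π)).exists_isGreatest (Set.Nonempty.image _ ⟨lam, hlam⟩)
  obtain ⟨m, hm⟩ := ((isCompact_couplings P).image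
    (continuous_ell_left P lam)).exists_isLeast (Set.Nonempty.image _ ⟨π, hπ⟩)
  refine ⟨hπ, hlam, M, m, hM, hm, ?_⟩
  obtain ⟨w, hw, rfl⟩ := hM.1
  obtain ⟨π', hπ', rfl⟩ := hm.1
  exact h w hw π' hπ'

theorem ell_sub_le {π π' : Fin N → Fin n → Fin n → ℝ} {w : Fin N → ℝ}
    (hw : w ∈ stdSimplex ℝ (Fin N)) :
    ell P π w - ell P π' w
      ≤ cInf P * ∑ p : Fin N × Fin n × Fin n, |π p.1 p.2.1 p.2.2 - π' p.1 p.2.1 p.2.2| := by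
  have h1 : ell P π w - ell P π' w
      = ∑ k, w k * frob (fun i j => π k i j - π' k i j) (P.C k) := by
    simp only [ell, frob, sub_mul, Finset.sum_sub_distrib, mul_sub]
  rw [h1]
  refine (sum_mul_le_mul_l1 (B := 1) fun k => ?_).trans ?_
  · rw [abs_of_nonneg (hw.1 k)]; exact le_one_of_mem_stdSimplex hw k
  · rw [one_mul]
    exact sum_abs_frob_le P fun k i j => π k i j - π' k i j

/-- Rounding after the stopping conditions hold gives an `ε`-optimal solution. -/
theorem isEpsOptimal_outPlan (hP : P.Admissible) {ε : ℝ} (hε : 0 < ε) {t : ℕ}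
    (hSt : Stops P ε (t + 1)) {bk : Fin N → Fin n → ℝ}
    (hbk : IsMargins (lastPlan P ε (t + 1)) P.b bk) :
    IsEpsOptimal P ε (outPlan P ε (t + 1) bk) (outLam P ε (t + 1)) := by
  have hη := eta_pos hP hε
  have hηc := eta_le_cInf P ε
  have hc := cInf_pos hP
  have hηι := mul_nonneg hη.le (neg_nonneg.2 (iota_nonpos hP))
  have hcent := pam_g_centered hP hε t
  have hlam := pam_lam_mem hP hε t
  obtain ⟨h1, h2, -⟩ := hSt
  have hout : outPlan P ε (t + 1) bk = fun k => roundPlan (lastPlan P ε (t + 1) k)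
    (rowSum (lastPlan P ε (t + 1) k)) (bk k) := rfl
  rw [hout]
  rw [lastPlan_succ hP hε] at h1 hbk ⊢
  rw [pam_succ_lam hP hε, Nat.add_sub_cancel] at h2
  have hol : outLam P ε (t + 1) = (pam P ε t).lam := rfl
  rw [hol]
  set g := (pam P ε t).g
  set lam := (pam P ε t).lam
  set η := eta P ε with hηdef
  obtain ⟨hmem, hdist⟩ := round_family_spec (P := P) (sPlan_nonneg hP)
    (funext fun i => rowSum_total_sPlan hP i) hbk
  change l1 (sCol P η g lam - P.b) ≤ _ at h1
  change _ ≤ l1 (sCol P η g lam - P.b) at hdist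
  change l2 (lamNext P η (η / (cInf P * cInf P)) g lam - lam) ≤ _ at h2
  -- The difference is split at `sPlan`: rounding (`s1`), first-order gap in `λ` (`s2`), Gibbs plan
  -- against `π'` (`s4`). The bounds add up to `(1 + 7 + 3 + 12) ε / 36`.
  refine isEpsOptimal_of_forall hmem hlam fun w hw π' hπ' => ?_
  set x := l1 (sCol P η g lam - P.b)
  set m := 6 * cInf P - η * iota P with hm
  have hm6 : 6 * cInf P ≤ m := by linarith
  have hm0 : 0 < m := by linarith
  have hx0 : 0 ≤ x := l1_nonneg _
  have hmx : m * x ≤ ε / 6 := by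
    calc m * x ≤ m * (ε / (6 * m)) := mul_le_mul_of_nonneg_left h1 hm0.le
      _ = ε / 6 := by field_simp
  have s1 := (ell_sub_le (P := P) (π := fun k => roundPlan (sPlan P η g lam k)
      (rowSum (sPlan P η g lam k)) (bk k)) (π' := sPlan P η g lam) hw).trans
    (mul_le_mul_of_nonneg_left hdist hc.le)
  have s2 := sum_sub_mul_frob_sPlan_le (g := g) hP hη hηc hw hlam
  have s2' : ∑ k, (w k - lam k) * frob (sPlan P η g lam k) (P.C k)
      = ell P (sPlan P η g lam) w - ell P (sPlan P η g lam) lam := by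
    simp only [ell, sub_mul, Finset.sum_sub_distrib]
  rw [s2'] at s2
  have s3 : 3 * cInf P ^ 2 / η * l2 (lamNext P η (η / (cInf P * cInf P)) g lam - lam)
      ≤ ε / 6 := by
    calc _ ≤ 3 * cInf P ^ 2 / η * (η * ε / (18 * (cInf P * cInf P))) :=
          mul_le_mul_of_nonneg_left h2 (by positivity)
      _ = ε / 6 := by field_simp; norm_num
  have s4 := ell_sPlan_le (g := g) (lam := lam) hP hη hπ'
  have s5 := hcent.sum_mul_le (y := sCol P η g lam - P.b) (by
    have := sum_sub_sCol_eq_zero (η := η) (g := g) (lam := lam) hP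
    simp only [Pi.sub_apply, Finset.sum_sub_distrib] at this ⊢
    linarith)
  have s6 : η * logDim n N ≤ ε / 3 := by
    have hL := one_le_logDim hP
    have h : η ≤ ε / (3 * logDim n N) := min_le_left _ _
    rw [le_div_iff₀ (by linarith)] at h
    linarith
  have s7 : cInf P * x ≤ ε / 36 := by
    have := mul_le_mul_of_nonneg_right hm6 hx0
    linarith
  have s8 : (2 * cInf P - η * iota P) / 2 * x ≤ ε / 12 := by
    have := mul_le_mul_of_nonneg_right (by linarith : 2 * cInf P - η * iota P ≤ m) hx0
    linarith
  change ∑ j, g j * (sCol P η g lam - P.b) j ≤ _ at s5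
  linarith

end Optimality

end EOT

namespace EOT

open Counted

variable {n N : ℕ}

/-! ### Termination and cost of the margins loop -/

section Margins

open Classical in
/-- First negative entry in row-major order. -/
noncomputable def firstNeg (bk : Fin N → Fin n → ℝ) : Option (Fin N × Fin n) :=
  (List.finRange N ×ˢ List.finRange n).find? fun p => decide (bk p.1 p.2 < 0)

theorem exists_firstNeg {bk : Fin N → Fin n → ℝ} (h : ∃ k j, bk k j < 0) :
    ∃ k j, firstNeg bk = some (k, j) ∧ bk k j < 0 := by
  rcases hf : firstNeg bk with _ | ⟨k, j⟩
  · obtain ⟨k, j, hkj⟩ := h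
    unfold firstNeg at hf
    rw [List.find?_eq_none] at hf
    exact absurd (decide_eq_true hkj) (hf (k, j) (by simp))
  · refine ⟨k, j, rfl, ?_⟩
    unfold firstNeg at hf
    simpa using List.find?_some hf

/-- The selected entry depends only on the set of negative entries, so the loop stays on one entry
until that set shrinks. -/
theorem firstNeg_congr {bk bk' : Fin N → Fin n → ℝ} (h : ∀ k j, bk k j < 0 ↔ bk' k j < 0) :
    firstNeg bk = firstNeg bk' := by
  unfold firstNeg
  simp only [h]

/-- The exchange of the amount `θ` among four entries. -/
noncomputable def exchange (bk : Fin N → Fin n → ℝ) (k k' : Fin N) (j j' : Fin n) (θ : ℝ) :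
    Fin N → Fin n → ℝ := fun p q =>
  if p = k ∧ q = j then bk k j + θ
  else if p = k ∧ q = j' then bk k j' - θ
  else if p = k' ∧ q = j then bk k' j - θ
  else if p = k' ∧ q = j' then bk k' j' + θ
  else bk p q

/-- Written as a rank-one perturbation by differences of unit vectors, the exchange visibly
preserves all row and column sums. -/
theorem exchange_eq {bk : Fin N → Fin n → ℝ} {k k' : Fin N} {j j' : Fin n} (hk : k ≠ k')
    (hj : j ≠ j') (θ : ℝ) (p : Fin N) (q : Fin n) :
    exchange bk k k' j j' θ p q = bk p q
      + θ * ((if p = k then 1 else 0) - (if p = k' then 1 else 0))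
        * ((if q = j then 1 else 0) - (if q = j' then 1 else 0)) := by
  unfold exchange
  by_cases h1 : p = k <;> by_cases h2 : q = j <;> by_cases h3 : p = k' <;> by_cases h4 : q = j' <;>
    simp_all [sub_eq_add_neg]

theorem sum_exchange_row {bk : Fin N → Fin n → ℝ} {k k' : Fin N} {j j' : Fin n} (hk : k ≠ k')
    (hj : j ≠ j') (θ : ℝ) (p : Fin N) :
    ∑ q, exchange bk k k' j j' θ p q = ∑ q, bk p q := by
  simp only [exchange_eq hk hj, Finset.sum_add_distrib, ← Finset.mul_sum, Finset.sum_sub_distrib]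
  simp

theorem sum_exchange_col {bk : Fin N → Fin n → ℝ} {k k' : Fin N} {j j' : Fin n} (hk : k ≠ k')
    (hj : j ≠ j') (θ : ℝ) (q : Fin n) :
    ∑ p, exchange bk k k' j j' θ p q = ∑ p, bk p q := by
  simp only [exchange_eq hk hj, Finset.sum_add_distrib, ← Finset.mul_sum, ← Finset.sum_mul,
    Finset.sum_sub_distrib]
  simp

/-- Invariant of the margins loop; `e` is the column deficit that is distributed. -/
structure MarginsInv (b e : Fin n → ℝ) (col bk : Fin N → Fin n → ℝ) : Prop where
  col_sum : ∀ j, ∑ k, bk k j = b j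
  row_sum : ∀ k, ∑ j, bk k j = ∑ j, col k j
  le_col : ∀ j, e j < 0 → ∀ k, bk k j ≤ col k j
  col_le : ∀ j, 0 ≤ e j → ∀ k, col k j ≤ bk k j

variable {b e : Fin n → ℝ} {col bk : Fin N → Fin n → ℝ}

open Classical in
noncomputable def negEntries (bk : Fin N → Fin n → ℝ) : Finset (Fin N × Fin n) :=
  Finset.univ.filter fun p => bk p.1 p.2 < 0

open Classical in
noncomputable def posEntries (e : Fin n → ℝ) (bk : Fin N → Fin n → ℝ) : Finset (Fin N × Fin n) :=
  Finset.univ.filter fun p => e p.2 < 0 ∧ 0 < bk p.1 p.2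

open Classical in
noncomputable def slackEntries (col bk : Fin N → Fin n → ℝ) (k : Fin N) : Finset (Fin n) :=
  Finset.univ.filter fun j => 0 < bk k j - col k j

/-- Only the row being repaired is counted; the count may jump when another row is selected, which
the weight `n + 1` of the negative entries pays for. -/
noncomputable def activeSlack (col bk : Fin N → Fin n → ℝ) : ℕ :=
  (firstNeg bk).elim 0 fun p => (slackEntries col bk p.1).card

/-- A quantity that decreases with each pass of the margins loop. -/
noncomputable def marginsPotential (e : Fin n → ℝ) (col bk : Fin N → Fin n → ℝ) : ℕ :=
  (n + 1) * (negEntries bk).card + (posEntries e bk).card + activeSlack col bk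

theorem activeSlack_le (col bk : Fin N → Fin n → ℝ) : activeSlack col bk ≤ n := by
  unfold activeSlack
  rcases firstNeg bk with _ | p
  · exact Nat.zero_le _
  · exact (Finset.card_le_univ _).trans (le_of_eq (Fintype.card_fin n))

theorem marginsPotential_le (e : Fin n → ℝ) (col bk : Fin N → Fin n → ℝ) (hN : 0 < N) :
    marginsPotential e col bk ≤ 4 * (N * n ^ 2) := by
  have h1 : (negEntries bk).card ≤ N * n :=
    (Finset.card_le_univ _).trans (le_of_eq (by simp))
  have h2 : (posEntries e bk).card ≤ N * n :=
    (Finset.card_le_univ _).trans (le_of_eq (by simp))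
  have h3 := activeSlack_le col bk
  have h4 : (n + 1) * (negEntries bk).card ≤ (n + 1) * (N * n) := Nat.mul_le_mul_left _ h1
  have h5 : N * n ≤ N * n ^ 2 := Nat.mul_le_mul_left _ (Nat.le_self_pow two_ne_zero n)
  have h6 : n ≤ N * n ^ 2 := (Nat.le_mul_of_pos_left n hN).trans h5
  have h7 : (n + 1) * (N * n) = N * n ^ 2 + N * n := by ring
  unfold marginsPotential
  omega

/-- One pass of the margins loop. -/
theorem marginsBody_spec (hb : ∀ j, 0 < b j) (hcol : ∀ k j, 0 ≤ col k j)
    (hinv : MarginsInv b e col bk) (hneg : ∃ k j, bk k j < 0) :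
    MarginsInv b e col (cMarginsBody col bk).val ∧
    marginsPotential e col (cMarginsBody col bk).val < marginsPotential e col bk ∧
    (cMarginsBody col bk).ops = 10 := by
  classical
  obtain ⟨k, j, hfirst, hkj⟩ := exists_firstNeg hneg
  -- In a column with `e j ≥ 0` all entries stay above `col ≥ 0`, so a negative entry sits in a
  -- deficit column.
  have hej : e j < 0 := by
    by_contra h
    linarith [hinv.col_le j (not_lt.1 h) k, hcol k j]
  -- Row `k` has the same sum as `col k` and lies below it at `j`, hence above it somewhere.
  obtain ⟨j', hfj, hkj'⟩ : ∃ j', ((List.finRange n).find? fun j' =>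
      @decide (0 < bk k j' - col k j') (Classical.propDecidable _)) = some j' ∧ 0 < bk k j' - col k j' := by
    rcases hf : ((List.finRange n).find? fun j' =>
      @decide (0 < bk k j' - col k j') (Classical.propDecidable _)) with _ | j'
    · exfalso
      rw [List.find?_eq_none] at hf
      have hle : ∀ q, bk k q ≤ col k q := fun q => by
        have := hf q (List.mem_finRange q)
        rw [decide_eq_true_iff] at this
        linarith
      have hlt := Finset.sum_lt_sum (s := Finset.univ) (fun q _ => hle q)
        ⟨j, Finset.mem_univ j, by linarith [hcol k j]⟩
      exact hlt.ne (hinv.row_sum k)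
    · exact ⟨j', rfl, by simpa using List.find?_some hf⟩
  -- Column `j` sums to `b j > 0`, so it has a positive entry.
  obtain ⟨k', hfk, hk'j⟩ : ∃ k', ((List.finRange N).find? fun k' =>
      @decide (0 < bk k' j) (Classical.propDecidable _)) = some k' ∧ 0 < bk k' j := by
    rcases hf : ((List.finRange N).find? fun k' =>
      @decide (0 < bk k' j) (Classical.propDecidable _)) with _ | k'
    · exfalso
      rw [List.find?_eq_none] at hf
      have hle : ∀ q, bk q j ≤ 0 := fun q => by
        have := hf q (List.mem_finRange q)
        rw [decide_eq_true_iff] at this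
        linarith
      have h1 := Finset.sum_nonpos fun q (_ : q ∈ Finset.univ) => hle q
      rw [hinv.col_sum j] at h1
      exact absurd (hb j) (not_lt.2 h1)
    · exact ⟨k', rfl, by simpa using List.find?_some hf⟩
  have hkk : k ≠ k' := by rintro rfl; linarith
  have hjj : j ≠ j' := by rintro rfl; linarith [hcol k j]
  have hej' : 0 ≤ e j' := by
    by_contra h
    linarith [hinv.le_col j' (not_le.1 h) k]
  set θ := min |bk k j| (min |bk k' j| |bk k j' - col k j'|) with hθ
  have hθ0 : 0 < θ := lt_min (abs_pos.2 hkj.ne) (lt_min (abs_pos.2 hk'j.ne') (abs_pos.2 hkj'.ne'))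
  have habs : θ = min (-bk k j) (min (bk k' j) (bk k j' - col k j')) := by
    rw [hθ, abs_of_neg hkj, abs_of_pos hk'j, abs_of_pos hkj']
  have hθ1 : θ ≤ -bk k j := habs ▸ min_le_left _ _
  have hθ2 : θ ≤ bk k' j := habs ▸ (min_le_right _ _).trans (min_le_left _ _)
  have hθ3 : θ ≤ bk k j' - col k j' := habs ▸ (min_le_right _ _).trans (min_le_right _ _)
  have hθeq : θ = -bk k j ∨ θ = bk k' j ∨ θ = bk k j' - col k j' := by
    rw [habs]
    rcases min_choice (-bk k j) (min (bk k' j) (bk k j' - col k j')) with h | h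
    · exact Or.inl h
    · rw [h]
      exact Or.inr (min_choice _ _)
  have hbody : (cMarginsBody col bk).val = exchange bk k k' j j' θ ∧
      (cMarginsBody col bk).ops = 10 := by
    unfold firstNeg at hfirst
    unfold cMarginsBody
    simp only [hfirst]
    rw [hfj, hfk]
    exact ⟨rfl, rfl⟩
  obtain ⟨hval, hops⟩ := hbody
  rw [hval]
  refine ⟨?_, ?_, hops⟩
  · refine ⟨fun q => ?_, fun p => ?_, fun q hq p => ?_, fun q hq p => ?_⟩
    · rw [sum_exchange_col hkk hjj, hinv.col_sum]
    · rw [sum_exchange_row hkk hjj, hinv.row_sum]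
    · have h := hinv.le_col q hq p
      unfold exchange
      split_ifs with h1 h2 h3 h4
      · rw [h1.1, h1.2]; linarith [hcol k j]
      · rw [h2.2] at hq; linarith
      · rw [h3.1, h3.2] at h ⊢; linarith
      · rw [h4.2] at hq; linarith
      · exact h
    · have h := hinv.col_le q hq p
      unfold exchange
      split_ifs with h1 h2 h3 h4
      · rw [h1.2] at hq; linarith
      · rw [h2.1, h2.2]; linarith
      · rw [h3.2] at hq; linarith
      · rw [h4.1, h4.2] at h ⊢; linarith
      · exact h
  · set nb := exchange bk k k' j j' θ with hnb
    have hnegsub : ∀ p q, nb p q < 0 → bk p q < 0 := fun p q => by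
      rw [hnb]
      unfold exchange
      split_ifs with h1 h2 h3 h4
      · rw [h1.1, h1.2]; exact fun _ => hkj
      · intro h; linarith [hcol k j']
      · intro h; linarith
      · rw [h4.1, h4.2]; intro h; linarith
      · exact id
    have hpossub : ∀ p q, e q < 0 → 0 < nb p q → 0 < bk p q := fun p q hq => by
      rw [hnb]
      unfold exchange
      split_ifs with h1 h2 h3 h4
      · intro h; linarith
      · rw [h2.2] at hq; linarith
      · rw [h3.1, h3.2]; exact fun _ => hk'j
      · rw [h4.2] at hq; linarith
      · exact id
    have hslacksub : ∀ q, 0 < nb k q - col k q → 0 < bk k q - col k q := fun q => by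
      rw [hnb]
      unfold exchange
      split_ifs with h1 h2 h3 h4
      · intro h; linarith [hcol k q, h1.2 ▸ hcol k q]
      · rw [h2.2]; exact fun _ => hkj'
      · exact absurd h3.1 hkk
      · exact absurd h4.1 hkk
      · exact id
    have hvkj : nb k j = bk k j + θ := by rw [hnb]; simp [exchange]
    have hvkj' : nb k j' = bk k j' - θ := by rw [hnb]; simp [exchange, hjj.symm]
    have hvk'j : nb k' j = bk k' j - θ := by rw [hnb]; simp [exchange, hkk.symm]
    have hA : negEntries nb ⊆ negEntries bk := fun p => by
      simp only [negEntries, Finset.mem_filter, Finset.mem_univ, true_and]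
      exact hnegsub p.1 p.2
    have hB : posEntries e nb ⊆ posEntries e bk := fun p => by
      simp only [posEntries, Finset.mem_filter, Finset.mem_univ, true_and]
      exact fun h => ⟨h.1, hpossub p.1 p.2 h.1 h.2⟩
    have hS : slackEntries col nb k ⊆ slackEntries col bk k := fun q => by
      simp only [slackEntries, Finset.mem_filter, Finset.mem_univ, true_and]
      exact hslacksub q
    have hactive : activeSlack col bk = (slackEntries col bk k).card := by
      rw [activeSlack, hfirst]; rfl
    have hBc := Finset.card_le_card hB
    have hSc := Finset.card_le_card hS
    by_cases hAeq : negEntries nb = negEntries bk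
    · have hiff : ∀ p q, nb p q < 0 ↔ bk p q < 0 := fun p q => by
        have := Finset.ext_iff.1 hAeq (p, q)
        simpa [negEntries] using this
      have hactive' : activeSlack col nb = (slackEntries col nb k).card := by
        rw [activeSlack, firstNeg_congr hiff, hfirst]; rfl
      have hnegkj : nb k j < 0 := (hiff k j).2 hkj
      unfold marginsPotential
      rw [hAeq, hactive, hactive']
      -- If no negative entry disappears, `θ` is one of the other two amounts: either the positive
      -- entry `(k', j)` or the slack at `(k, j')` is used up.
      rcases hθeq with h | h | h
      · rw [hvkj] at hnegkj; linarith
      · have hlt : posEntries e nb ⊂ posEntries e bk := by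
          refine (Finset.ssubset_iff_of_subset hB).2 ⟨(k', j), ?_, ?_⟩
          · simp [posEntries, hej, hk'j]
          · simp [posEntries, hvk'j, h]
        have := Finset.card_lt_card hlt
        omega
      · have hlt : slackEntries col nb k ⊂ slackEntries col bk k := by
          refine (Finset.ssubset_iff_of_subset hS).2 ⟨j', ?_, ?_⟩
          · simpa [slackEntries] using hkj'
          · simp [slackEntries, hvkj', h]
        have := Finset.card_lt_card hlt
        omega
    -- One negative entry fewer lowers the potential by `n + 1`, more than the active slack can
    -- gain.
    · have hlt := Finset.card_lt_card (hA.ssubset_of_ne hAeq)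
      have hle := activeSlack_le col nb
      have hmul : (n + 1) * ((negEntries nb).card + 1) ≤ (n + 1) * (negEntries bk).card :=
        Nat.mul_le_mul_left _ hlt
      rw [mul_add, mul_one] at hmul
      unfold marginsPotential
      omega

theorem exists_marginsRun (hb : ∀ j, 0 < b j) (hcol : ∀ k j, 0 ≤ col k j) (M : ℕ)
    (bk : Fin N → Fin n → ℝ) (hinv : MarginsInv b e col bk)
    (hM : marginsPotential e col bk ≤ M) :
    ∃ bk' m c, WhileRun cMarginsTest (cMarginsBody col) bk bk' m c ∧ MarginsInv b e col bk' ∧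
      (∀ k j, 0 ≤ bk' k j) ∧ c ≤ 10 * M := by
  induction M using Nat.strong_induction_on generalizing bk with
  | _ M ih =>
    by_cases hneg : ∃ k j, bk k j < 0
    · obtain ⟨h1, h2, h3⟩ := marginsBody_spec hb hcol hinv hneg
      obtain ⟨bk', m, c, hrun, hinv', hpos, hc⟩ := ih (M - 1) (by omega) _ h1 (by omega)
      refine ⟨bk', m + 1, _, WhileRun.pass hneg hrun, hinv', hpos, ?_⟩
      have h4 : (cMarginsTest bk).ops = 0 := rfl
      rw [h3, h4]
      omega
    · refine ⟨bk, 0, _, WhileRun.done hneg, hinv, ?_, ?_⟩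
      · push Not at hneg
        exact hneg
      · exact Nat.zero_le _

end Margins

end EOT

namespace EOT

open Counted

variable {n N : ℕ}

/-! ### The program computes the mathematical iterates -/

section Values

/-- The program's threshold is `sortThreshold` by definition; the content lies in the sorted form of
the projection. -/
theorem cProj_val (hN : 0 < N) (y : Fin N → ℝ) : (cProj y).val = projSimplex y := by
  rw [projSimplex_eq_sort hN]
  rfl

theorem cUpdateLam_val (hN : 0 < N) (P : Problem n N) (η τ : ℝ) (f : Fin n → EReal)
    (g : Fin n → ℝ) (lam : Fin N → ℝ) :
    (cUpdateLam P η τ f g lam).val = updateLam P η τ f g lam :=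
  cProj_val hN _

/-- The state of the main loop after `t` passes. -/
noncomputable def loopState (P : Problem n N) (ε : ℝ) (t : ℕ) : LoopState n N :=
  ⟨t, (pam P ε t).f, (pam P ε t).g, (pam P ε t).lam, (pam P ε (t - 1)).g, (pam P ε (t - 1)).lam⟩

theorem cBody_val (hN : 0 < N) (P : Problem n N) (ε : ℝ) (t : ℕ) :
    (cBody P (eta P ε) (tau P ε) (loopState P ε t)).val = loopState P ε (t + 1) := by
  change (⟨t + 1, updateF P (eta P ε) _ _ _, updateG P (eta P ε) _ _ _,
    (cUpdateLam P (eta P ε) (tau P ε) _ _ _).val, _, _⟩ : LoopState n N) = _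
  rw [cUpdateLam_val hN]
  rfl

theorem cStops_val (P : Problem n N) (ε : ℝ) (t : ℕ) :
    (cStops P ε (cInf P) (iota P) (eta P ε) (dualOpt P (eta P ε)) (loopState P ε t)).val
      = Stops P ε t := by
  have h : (cL2 (pam P ε t).lam (pam P ε (t - 1)).lam).val
      = l2 ((pam P ε t).lam - (pam P ε (t - 1)).lam) := by
    simp only [l2, sq]
    rfl
  unfold Stops
  rw [← h]
  rfl

end Values

/-! ### Operation counts of the subroutines -/

section Operations

theorem ops_bind {α β : Type} (x : Counted α) (f : α → Counted β) :
    (x >>= f).ops = x.ops + (f x.val).ops := rfl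

theorem ops_pure {α : Type} (x : α) : (pure x : Counted α).ops = 0 := rfl

theorem ops_array {ι α : Type} [Fintype ι] (x : ι → Counted α) :
    (array x).ops = ∑ i, (x i).ops := rfl

theorem ops_sum {ι α : Type} [Fintype ι] [AddCommMonoid α] (x : ι → Counted α) :
    (Counted.sum x).ops = ∑ i, (x i).ops + Fintype.card ι := rfl

theorem ops_sup {ι : Type} [Fintype ι] (x : ι → Counted ℝ) :
    (Counted.sup x).ops = ∑ i, (x i).ops + Fintype.card ι := rfl

theorem ops_inf {ι : Type} [Fintype ι] (x : ι → Counted ℝ) :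
    (Counted.inf x).ops = ∑ i, (x i).ops + Fintype.card ι := rfl

variable (P : Problem n N) (η : ℝ) (f : Fin n → EReal) (g : Fin n → ℝ) (lam : Fin N → ℝ)

theorem ops_cRowSum (π : Fin n → Fin n → ℝ) : (cRowSum π).ops = n * n := by
  simp [cRowSum, ops_array, ops_sum, ops_pure]

theorem ops_cColSum (π : Fin n → Fin n → ℝ) : (cColSum π).ops = n * n := by
  simp [cColSum, ops_array, ops_sum, ops_pure]

theorem ops_cTotal (π : Fin N → Fin n → Fin n → ℝ) : (cTotal π).ops = n * (n * N) := by
  simp [cTotal, ops_array, ops_sum, ops_pure]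

theorem ops_cMass (π : Fin N → Fin n → Fin n → ℝ) : (cMass π).ops = N * (n * n + n) + N := by
  simp [cMass, ops_sum, ops_pure]

theorem ops_cZeta : (cZeta P η f g lam).ops = N * (n * (n * 5)) := by
  simp [cZeta, ops_array, ops_bind, opAdd, opMul, opSub, opDiv, opXexp]

theorem ops_cPlan : (cPlan P η f g lam).ops
    = N * (n * (n * 5)) + (N * (n * n + n) + N + N * (n * n)) := by
  simp [cPlan, ops_array, ops_bind, opDiv, ops_cZeta, ops_cMass]

theorem ops_cDualF : (cDualF P η f g lam).ops
    = N * (n * (n * 5)) + (N * (n * n + n) + N + (n + n + (n + n + 5))) := by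
  simp [cDualF, ops_bind, opAdd, opMul, opSub, opXlog, ops_sum, ops_cZeta, ops_cMass]

theorem ops_cUpdateF : (cUpdateF P η f g lam).ops
    = N * (n * (n * 5)) + (n * (n * N) + (n * n + n * 4)) := by
  simp [cUpdateF, ops_array, ops_bind, opAdd, opMul, opDiv, opXlog, ops_cZeta, ops_cTotal,
    ops_cRowSum]

theorem ops_cUpdateG : (cUpdateG P η f g lam).ops
    = N * (n * (n * 5)) + (n * (n * N) + (n * n + n * 4)) := by
  simp [cUpdateG, ops_array, ops_bind, opAdd, opMul, opDiv, opLog, ops_cZeta, ops_cTotal,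
    ops_cColSum]

theorem ops_cProj (y : Fin N → ℝ) : (cProj y).ops = N + (N * 2 + N + N * 2) := by
  simp [cProj, ops_array, ops_bind, opSub, opDiv, opMax, ops_sup, partialSums]

theorem ops_cUpdateLam (τ : ℝ) : (cUpdateLam P η τ f g lam).ops
    = N * (n * (n * 5)) + (N * (n * n + n) + N + N * (n * n)) + N * (n * (n + n) + n)
      + (N * 2 + (N + (N * 2 + N + N * 2))) := by
  simp [cUpdateLam, cGradLam, ops_array, ops_bind, ops_sum, opAdd, opMul, ops_cProj, ops_cPlan]

theorem ops_cInit : (cInit n N).ops = N := by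
  simp [cInit, ops_array, ops_bind, ops_pure, opDiv]

theorem monomials_le (hn : 0 < n) (hN : 0 < N) :
    1 ≤ N * n ^ 2 ∧ n ≤ N * n ^ 2 ∧ N ≤ N * n ^ 2 ∧ n * n ≤ N * n ^ 2 ∧ N * n ≤ N * n ^ 2 := by
  have h1 : n ≤ n ^ 2 := Nat.le_self_pow two_ne_zero n
  have h2 : n ^ 2 ≤ N * n ^ 2 := Nat.le_mul_of_pos_left _ hN
  have h3 : N * n ≤ N * n ^ 2 := Nat.mul_le_mul_left _ h1
  have h4 : N ≤ N * n := Nat.le_mul_of_pos_right _ hn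
  have h5 : n * n = n ^ 2 := (sq n).symm
  omega

theorem ops_cBody_le (hn : 0 < n) (hN : 0 < N) (τ : ℝ) (s : LoopState n N) :
    (cBody P η τ s).ops ≤ 50 * (N * n ^ 2) := by
  obtain ⟨h1, h2, h3, h4, h5⟩ := monomials_le hn hN
  simp only [cBody, ops_bind, ops_pure, ops_cUpdateF, ops_cUpdateG, ops_cUpdateLam]
  nlinarith

theorem ops_cStops_le (hn : 0 < n) (hN : 0 < N) (ε c iot : ℝ) (Fopt : EReal)
    (s : LoopState n N) : (cStops P ε c iot η Fopt s).ops ≤ 60 * (N * n ^ 2) := by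
  obtain ⟨h1, h2, h3, h4, h5⟩ := monomials_le hn hN
  simp only [cStops, cL1, cL2, ops_bind, ops_pure, ops_sum, ops_cPlan, ops_cTotal, ops_cColSum,
    ops_cDualF, opMul, opSub, opDiv, opAbs, opSqrt, Finset.sum_const, Finset.card_univ,
    Fintype.card_fin, smul_eq_mul]
  nlinarith

theorem ops_cTest_le (hn : 0 < n) (hN : 0 < N) (ε c iot : ℝ) (Fopt : EReal)
    (s : LoopState n N) : (cTest P ε c iot η Fopt s).ops ≤ 60 * (N * n ^ 2) := by
  unfold cTest
  split_ifs
  · exact Nat.zero_le _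
  · simp only [ops_bind, ops_pure, add_zero]
    exact ops_cStops_le P η hn hN ε c iot Fopt s

/-- The nested sum, with its final `0` from `pure`, is the shape to which the binds of the parameter
block unfold. -/
theorem ops_parameters_le (hn : 0 < n) (hN : 0 < N) (ε : ℝ) :
    (cCInf P).ops + ((cIota P).ops + ((cEta n N ε (cInf P)).ops
      + ((cTau (eta P ε) (cInf P)).ops + 0))) ≤ 20 * (N * n ^ 2) := by
  obtain ⟨h1, h2, h3, h4, h5⟩ := monomials_le hn hN
  simp only [cCInf, cIota, cEta, cTau, ops_sup, ops_inf, ops_bind, opMul, opDiv, opAdd, opLog,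
    opAbs, opMin, Finset.sum_const, Finset.card_univ, Fintype.card_prod, Fintype.card_fin,
    smul_eq_mul]
  nlinarith

theorem ops_cMarginsInit_le (hn : 0 < n) (hN : 0 < N) (b : Fin n → ℝ)
    (π : Fin N → Fin n → Fin n → ℝ) (col : Fin N → Fin n → ℝ) :
    (cMarginsInit b π col).ops ≤ 5 * (N * n ^ 2) := by
  obtain ⟨h1, h2, h3, h4, h5⟩ := monomials_le hn hN
  simp only [cMarginsInit, ops_bind, ops_array, ops_cTotal, ops_cColSum, opSub, opDiv, opAdd,
    Finset.sum_const, Finset.card_univ, Fintype.card_fin, smul_eq_mul]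
  nlinarith

theorem ops_cRound (π : Fin n → Fin n → ℝ) (a b : Fin n → ℝ) :
    (cRound π a b).ops = 9 * (n * n) + 8 * n := by
  simp only [cRound, ops_bind, ops_array, ops_sum, ops_cRowSum, ops_cColSum, opSub, opDiv, opAdd,
    opMul, opMin, opAbs, Finset.sum_const, Finset.card_univ, Fintype.card_fin, smul_eq_mul]
  ring

end Operations

/-! ### The complete run of the program -/

section MainLoop

variable {P : Problem n N} {ε : ℝ}

/-- Induction on the number `d` of passes left. A pass costs at most 60 for the test and 50 for the
body, and the last test 60 more. Minimality of `T` keeps the earlier tests from succeeding; the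
state at index 0 is not tested. -/
theorem mainLoop_run (hn : 0 < n) (hN : 0 < N) {T : ℕ} (hT : IsLeast {t | 1 ≤ t ∧ Stops P ε t} T)
    (d t : ℕ) (hd : t + d = T) :
    ∃ ops, WhileRun (cTest P ε (cInf P) (iota P) (eta P ε) (dualOpt P (eta P ε)))
      (cBody P (eta P ε) (tau P ε)) (loopState P ε t) (loopState P ε T) d ops ∧
      ops ≤ (110 * d + 60) * (N * n ^ 2) := by
  induction d generalizing t with
  | zero =>
    have ht : t = T := hd
    subst ht
    refine ⟨_, WhileRun.done ?_, ?_⟩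
    · have h0 : (loopState P ε t).iter ≠ 0 := by
        have := hT.1.1
        change t ≠ 0
        omega
      unfold cTest
      rw [if_neg h0]
      change ¬ ¬ (cStops P ε (cInf P) (iota P) (eta P ε) (dualOpt P (eta P ε))
        (loopState P ε t)).val
      rw [cStops_val]
      exact not_not.2 hT.1.2
    · simpa using ops_cTest_le P (eta P ε) hn hN ε (cInf P) (iota P) _ _
  | succ d ih =>
    obtain ⟨ops, hrun, hops⟩ := ih (t + 1) (by omega)
    rw [← cBody_val hN] at hrun
    refine ⟨_, WhileRun.pass ?_ hrun, ?_⟩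
    · unfold cTest
      split_ifs with h0
      · trivial
      · change ¬ (cStops P ε (cInf P) (iota P) (eta P ε) (dualOpt P (eta P ε))
          (loopState P ε t)).val
        rw [cStops_val]
        intro h
        have h1 : t ≠ 0 := h0
        have := hT.2 ⟨Nat.one_le_iff_ne_zero.2 h1, h⟩
        omega
    · have h1 := ops_cTest_le P (eta P ε) hn hN ε (cInf P) (iota P)
        (dualOpt P (eta P ε)) (loopState P ε t)
      have h2 := ops_cBody_le P (eta P ε) hn hN (tau P ε) (loopState P ε t)
      nlinarith

/-- The whole program runs, with the output described by `outPlan` and `outLam`. -/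
theorem exists_pamRun (hP : P.Admissible) (hε : 0 < ε) {T : ℕ}
    (hT : IsLeast {t | 1 ≤ t ∧ Stops P ε t} T) :
    ∃ (bk : Fin N → Fin n → ℝ) (ops : ℕ),
      PAMRun P ε T bk (outPlan P ε T bk) (outLam P ε T) ops ∧
      IsMargins (lastPlan P ε T) P.b bk ∧ ops ≤ (110 * T + 200) * (N * n ^ 2) := by
  have hn := hP.pos_n
  have hN := hP.pos_N
  obtain ⟨t, rfl⟩ : ∃ t, T = t + 1 := ⟨T - 1, by have := hT.1.1; omega⟩
  obtain ⟨ops₁, hrun₁, hops₁⟩ := mainLoop_run hn hN hT (t + 1) 0 (by omega)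
  set π := lastPlan P ε (t + 1) with hπ
  have hπs : π = sPlan P (eta P ε) (pam P ε t).g (pam P ε t).lam := lastPlan_succ hP hε t
  have hπ0 : ∀ k i j, 0 ≤ π k i j := fun k i j => by rw [hπs]; exact sPlan_nonneg hP k i j
  have hmass : mass π = 1 := by rw [hπs]; exact mass_sPlan hP
  set col : Fin N → Fin n → ℝ := fun k => colSum (π k) with hcol
  have hcol0 : ∀ k j, 0 ≤ col k j := fun k j => Finset.sum_nonneg fun i _ => hπ0 k i j
  set e : Fin n → ℝ := fun j => (P.b j - colSum (total π) j) / N with he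
  have hN0 : (N : ℝ) ≠ 0 := by exact_mod_cast hN.ne'
  have hcolsum : ∀ j, ∑ k, col k j = colSum (total π) j := fun j => Finset.sum_comm
  have hinit : (cMarginsInit P.b π col).val = fun k j => col k j + e j := rfl
  have hinv : MarginsInv P.b e col fun k j => col k j + e j := by
    refine ⟨fun j => ?_, fun k => ?_, fun j hj k => ?_, fun j hj k => ?_⟩
    · rw [Finset.sum_add_distrib, hcolsum, Finset.sum_const, Finset.card_univ, Fintype.card_fin,
        nsmul_eq_mul, he]
      dsimp only
      rw [mul_div_cancel₀ _ hN0]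
      ring
    -- The column deficits sum to zero because `b` and the plan both have mass 1.
    · rw [Finset.sum_add_distrib, add_eq_left, he, ← Finset.sum_div, Finset.sum_sub_distrib,
        hP.b_mem.2, sum_colSum_total, hmass, sub_self, zero_div]
    · linarith
    · linarith
  obtain ⟨bk, m, ops₂, hrun₂, hinv₂, hbk0, hops₂⟩ := exists_marginsRun hP.b_pos hcol0 _ _ hinv
    (marginsPotential_le e col _ hN)
  have hmargins : IsMargins π P.b bk := by
    refine ⟨hbk0, hinv₂.col_sum, fun k => ?_, fun j k k' => ?_⟩
    · rw [hinv₂.row_sum k, sum_rowSum_eq_sum_colSum]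
    · rcases lt_or_ge (e j) 0 with h | h
      · exact mul_nonneg_of_nonpos_of_nonpos (sub_nonpos.2 (hinv₂.le_col j h k))
          (sub_nonpos.2 (hinv₂.le_col j h k'))
      · exact mul_nonneg (sub_nonneg.2 (hinv₂.col_le j h k)) (sub_nonneg.2 (hinv₂.col_le j h k'))
  -- `loopState P ε 0` is the program's initial state by definition, since `0 - 1 = 0` in `ℕ`; the
  -- output values agree by unfolding.
  refine ⟨bk, _, ⟨loopState P ε (t + 1), ops₁, ops₂, m, hrun₁, hrun₂, rfl, rfl, rfl⟩, hmargins, ?_⟩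
  obtain ⟨m1, m2, m3, m4, m5⟩ := monomials_le hn hN
  have h1 : (do
      let c ← cCInf P
      let iot ← cIota P
      let η ← cEta n N ε c
      let τ ← cTau η c
      pure (c, iot, η, τ) : Counted (ℝ × ℝ × ℝ × ℝ)).ops ≤ 20 * (N * n ^ 2) :=
    ops_parameters_le P hn hN ε
  generalize hX : (cMarginsInit _ _ _).ops = X
  have h2 : X ≤ 5 * (N * n ^ 2) := hX ▸ ops_cMarginsInit_le hn hN _ _ _
  simp only [ops_array, ops_cRowSum, ops_cColSum, ops_cRound, ops_cPlan, ops_cInit,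
    Finset.sum_const, Finset.card_univ, Fintype.card_fin, smul_eq_mul]
  have h3 : N * (9 * (n * n) + 8 * n) ≤ 17 * (N * n ^ 2) := by nlinarith
  have h4 : N * (n * (n * 5)) + (N * (n * n + n) + N + N * (n * n)) + N * (n * n) + N * (n * n)
      ≤ 11 * (N * n ^ 2) := by nlinarith
  have h5 : (110 * (t + 1) + 200) * (N * n ^ 2)
      = (110 * (t + 1) + 60) * (N * n ^ 2) + 140 * (N * n ^ 2) := by ring
  omega

end MainLoop

end EOT

/-! ### Main theorem -/

theorem mainTheorem1 :
    ∃ K : ℝ, 0 < K ∧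
      ∀ (n N : ℕ) (P : EOT.Problem n N) (ε : ℝ),
        P.a ∈ stdSimplex ℝ (Fin n) → P.b ∈ stdSimplex ℝ (Fin n) → (∀ j, 0 < P.b j) →
        (∃ k i j, P.C k i j ≠ 0) → 0 < ε →
        ∃ T : ℕ,
          IsLeast {t : ℕ | 1 ≤ t ∧ EOT.Stops P ε t} T ∧
          (T : ℝ) ≤ EOT.iterBound P ε ∧
          (∀ bk : Fin N → Fin n → ℝ, EOT.IsMargins (EOT.lastPlan P ε T) P.b bk →
            EOT.IsEpsOptimal P ε (EOT.outPlan P ε T bk) (EOT.outLam P ε T)) ∧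
          (∃ (bk : Fin N → Fin n → ℝ) (ops : ℕ),
            EOT.PAMRun P ε T bk (EOT.outPlan P ε T bk) (EOT.outLam P ε T) ops ∧
            EOT.IsMargins (EOT.lastPlan P ε T) P.b bk ∧
            (ops : ℝ) ≤ K * (N * n ^ 2) * EOT.iterBound P ε ∧
            (ε ≤ EOT.cInf P →
              (ops : ℝ) ≤ K * (N * n ^ 2) *
                (EOT.logDim n N * (1 + |EOT.iota P| / EOT.logDim n N) ^ 2) *
                  (EOT.cInf P ^ 2 / ε ^ 2))) ∧
          EOT.gamma0 P ε ≤ K / EOT.cInf P ^ 2 ∧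
          (ε ≤ EOT.cInf P →
            EOT.iterBound P ε ≤
              K * (EOT.logDim n N * (1 + |EOT.iota P| / EOT.logDim n N) ^ 2) *
                (EOT.cInf P ^ 2 / ε ^ 2)) := by
  -- The operation count needs `150 · 10000`, the largest of the constants required; the choice
  -- leaves room.
  refine ⟨3000000, by norm_num, fun n N P ε ha hb hb0 hC hε => ?_⟩
  have hP : P.Admissible := ⟨ha, hb, hb0, hC⟩
  have hex : ∃ t : ℕ, 1 ≤ t ∧ EOT.Stops P ε t := by
    obtain ⟨t, h1, -, h2⟩ := EOT.exists_stops hP hε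
    exact ⟨t, h1, h2⟩
  classical
  have hleast : IsLeast {t : ℕ | 1 ≤ t ∧ EOT.Stops P ε t} (Nat.find hex) :=
    ⟨Nat.find_spec hex, fun t ht => Nat.find_min' hex ht⟩
  set T := Nat.find hex
  have hTle : (T : ℝ) ≤ EOT.iterBound P ε := by
    obtain ⟨t, h1, h2, h3⟩ := EOT.exists_stops hP hε
    exact (Nat.cast_le.2 (hleast.2 ⟨h1, h3⟩)).trans h2
  have h5 := EOT.five_le_iterBound hP hε
  have hL := EOT.one_le_logDim hP
  obtain ⟨bk, ops, hrun, hmargins, hops⟩ := EOT.exists_pamRun hP hε hleast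
  -- Both `T ≤ iterBound` and `200 ≤ 40 · iterBound` hold, the latter because `iterBound ≥ 5`; hence
  -- 110 + 40.
  have hbound : (ops : ℝ) ≤ 150 * (N * n ^ 2) * EOT.iterBound P ε := by
    have h1 : (ops : ℝ) ≤ (110 * T + 200) * (N * n ^ 2) := by exact_mod_cast hops
    refine h1.trans ?_
    rw [mul_right_comm]
    exact mul_le_mul_of_nonneg_right (by linarith) (by positivity)
  refine ⟨T, hleast, hTle, fun bk hbk => ?_, ⟨bk, ops, hrun, hmargins, ?_, fun hεc => ?_⟩, ?_,
    fun hεc => ?_⟩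
  · obtain ⟨t, ht⟩ : ∃ t, T = t + 1 := ⟨T - 1, by have := hleast.1.1; omega⟩
    have hSt := hleast.1.2
    rw [ht] at hbk hSt ⊢
    exact EOT.isEpsOptimal_outPlan hP hε hSt hbk
  · refine hbound.trans (mul_le_mul_of_nonneg_right ?_ (by linarith))
    exact mul_le_mul_of_nonneg_right (by norm_num) (by positivity)
  · have h1 := EOT.iterBound_le hP hε hεc
    refine hbound.trans ((mul_le_mul_of_nonneg_left h1 (by positivity)).trans ?_)
    have h0 : 0 ≤ (N * n ^ 2 : ℝ) * (EOT.logDim n N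
        * (1 + |EOT.iota P| / EOT.logDim n N) ^ 2) * (EOT.cInf P ^ 2 / ε ^ 2) := by positivity
    linarith
  · refine (EOT.gamma0_le hP).trans ?_
    have hc := EOT.cInf_pos hP
    exact div_le_div_of_nonneg_right (by norm_num) (by positivity)
  · refine (EOT.iterBound_le hP hε hεc).trans ?_
    have h0 : 0 ≤ (EOT.logDim n N * (1 + |EOT.iota P| / EOT.logDim n N) ^ 2)
        * (EOT.cInf P ^ 2 / ε ^ 2) := by positivity
    linarith
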